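/- All graphs are finite and simple. Let $P_k$, $C_k$ denote the chordless path and the chordless cycle on $k$ vertices, and let the gem be the graph consisting of a $P_4$ together with a vertex adjacent to all four of its vertices. Let $F_3$ be the graph obtained from the cycle $C_6 = v_1v_2v_3v_4v_5v_6v_1$ by adding two vertices $z, r$ and the edges $zv_1$, $zv_4$, $rz$. A graph is $H$-free if it has no induced subgraph isomorphic to $H$. A clique-cutset of $G$ is a clique $K$ of $G$ such that $G\setminus K$ has more connected components than $G$. A vertex is bisimplicial if its neighborhood is the union of two (not necessarily disjoint) cliques. A blowup of a graph $H$ is a graph $G$ whose vertex set can be partitioned into (possibly empty) cliques $A_i$, $i\in V(H)$, such that for distinct $i,j \in V(H)$ the set $A_i$ is complete to $A_j$ if $ij\in E(H)$, and anticomplete to $A_j$ if $ij\notin E(H)$. **Theorem.** Let $G$ be a connected graph that is $P_7$-free, $C_7$-free, $C_4$-free and gem-free, and that contains an induced subgraph isomorphic to $F_3$. Then $G$ has a clique-cutset, or $G$ has a bisimplicial vertex, or $G$ is a blowup of the Petersen graph. -/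

import Mathlib

namespace PetersenBlowup

/-- `G` is `H`-free: no induced subgraph of `G` is isomorphic to `H`. -/
def InducedFree {U V : Type*} (H : SimpleGraph U) (G : SimpleGraph V) : Prop :=
  ¬ H.IsIndContained G

/-- The gem: the path `0 - 1 - 2 - 3` plus the vertex `4` adjacent to all of its vertices. -/
def gem : SimpleGraph (Fin 5) :=
  SimpleGraph.fromEdgeSet
    {s(0, 1), s(1, 2), s(2, 3), s(4, 0), s(4, 1), s(4, 2), s(4, 3)}

/-- The graph `F₃`: the cycle `0 - 1 - 2 - 3 - 4 - 5 - 0`, a vertex `6` adjacent to the opposite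
cycle vertices `0` and `3`, and a vertex `7` adjacent to `6` only. -/
def F3 : SimpleGraph (Fin 8) :=
  SimpleGraph.fromEdgeSet
    {s(0, 1), s(1, 2), s(2, 3), s(3, 4), s(4, 5), s(5, 0), s(6, 0), s(6, 3), s(7, 6)}

/-- The Petersen graph: the vertices are the two-element subsets of a five-element set, and two of
them are adjacent iff they are disjoint. -/
def petersen : SimpleGraph {s : Finset (Fin 5) // s.card = 2} where
  Adj s t := Disjoint s.1 t.1
  symm := ⟨fun _ _ h => h.symm⟩
  loopless := ⟨fun s h => by
    have h0 : s.1 = ∅ := by simpa using h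
    have h2 := s.2
    simp [h0] at h2⟩

/-- `K` is a clique-cutset of `G`: a clique such that `G \ K` has more connected components
than `G`. (Used for finite graphs.) -/
def IsCliqueCutset {V : Type*} (G : SimpleGraph V) (K : Set V) : Prop :=
  G.IsClique K ∧
    Nat.card G.ConnectedComponent < Nat.card (G.induce Kᶜ).ConnectedComponent

/-- A vertex is bisimplicial if its neighbourhood is the union of two cliques. -/
def IsBisimplicial {V : Type*} (G : SimpleGraph V) (v : V) : Prop :=
  ∃ S T : Set V, G.IsClique S ∧ G.IsClique T ∧ G.neighborSet v = S ∪ T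

/-- `G` is a blowup of `H`: the vertex set of `G` is partitioned into (possibly empty) cliques
`A i`, one for each vertex `i` of `H`, such that for `i ≠ j` the set `A i` is complete to `A j`
if `i` and `j` are adjacent in `H`, and anticomplete to `A j` otherwise. -/
def IsBlowup {V W : Type*} (G : SimpleGraph V) (H : SimpleGraph W) : Prop :=
  ∃ A : W → Set V,
    (⋃ i, A i) = Set.univ ∧
    (∀ i j, i ≠ j → Disjoint (A i) (A j)) ∧
    (∀ i, G.IsClique (A i)) ∧
    (∀ i j, H.Adj i j → ∀ x ∈ A i, ∀ y ∈ A j, G.Adj x y) ∧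
    (∀ i j, i ≠ j → ¬ H.Adj i j → ∀ x ∈ A i, ∀ y ∈ A j, ¬ G.Adj x y)

end PetersenBlowup

namespace PetersenBlowup

open SimpleGraph

/-! Assume that there is no clique-cutset. The basic tool is then: if `B` is not a clique and `d`
lies outside `B`, the neighbours in `B` of the component of `d` outside `B` do not form a clique, so
a chordless path with nonadjacent ends in `B` runs through that component
(`exists_chordlessPath_through`). By `P_7`-freeness it has at most five edges, so every claim about
such paths is a finite case analysis.

Two situations are distinguished. If `G` contains an induced Petersen graph, the vertices with the
adjacencies of one of its vertices form a blowup of it. A vertex outside this blowup cannot see two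
nonadjacent parts, and a path through such vertices between nonadjacent parts always creates an
excluded subgraph. So nothing lies outside, and `G` is the blowup (`isBlowup_of_hasPetersen`).

Otherwise the Petersen graph is approached through a hexagon. The twins of the vertices of a hexagon
form a blowup of it, a frame; an outside vertex can see two nonadjacent parts only if they are
antipodal, and is then called a connector. There are three kinds of connectors, and a hexagon with
one of each kind is the Petersen graph minus a vertex. An induced `F_3` produces such a frame
(`exists_hexFrame`): a path through the component of the pendant vertex, away from the hexagon, has
ends that each see exactly two opposite hexagon vertices. The path has length two and its ends are
of different kinds; its three vertices and the hexagon are the required nine vertices. Around such a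
frame, a path through the remaining vertices would give an excluded subgraph or a Petersen graph, so
only parts and connectors exist (`HexFrame.cover`), and every connector is bisimplicial
(`HexFrame.isBisimplicial`).

The local case analyses are carried by certificates: decision trees that branch on an undetermined
adjacency and end at a contradiction. They are checked by computation, and their soundness is proved
once (`Cert.check_false`). -/

/-- The four excluded induced subgraphs of the theorem are absent from `G`. -/
structure ExcludedFree {V : Type*} (G : SimpleGraph V) : Prop where
  p7 : InducedFree (pathGraph 7) G
  c7 : InducedFree (cycleGraph 7) G
  c4 : InducedFree (cycleGraph 4) G
  gem : InducedFree gem G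

/-! ### Recognising the excluded induced subgraphs -/

theorem isIndContained_of_adj_iff {V W : Type*} {G : SimpleGraph V} {H : SimpleGraph W} (u : W → V)
    (hinj : Function.Injective u) (h : ∀ i j, G.Adj (u i) (u j) ↔ H.Adj i j) :
    H.IsIndContained G :=
  ⟨⟨⟨u, hinj⟩, h _ _⟩⟩

/-- A map that preserves and reflects adjacency identifies only vertices with equal neighbourhoods,
and `H` has no two such vertices. -/
theorem injective_of_adj_iff {V W : Type*} {G : SimpleGraph V} {H : SimpleGraph W} (u : W → V)
    (h : ∀ i j, G.Adj (u i) (u j) ↔ H.Adj i j)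
    (hH : ∀ i j, (∀ k, H.Adj i k ↔ H.Adj j k) → i = j) : Function.Injective u := by
  intro i j hij
  exact hH i j fun k => by rw [← h i k, ← h j k, hij]

theorem adj_iff_of_lt {V : Type*} {n : ℕ} {G : SimpleGraph V} {H : SimpleGraph (Fin n)}
    (u : Fin n → V) (h : ∀ i j, i < j → (G.Adj (u i) (u j) ↔ H.Adj i j)) (i j : Fin n) :
    G.Adj (u i) (u j) ↔ H.Adj i j := by
  rcases lt_trichotomy i j with hij | rfl | hij
  · exact h i j hij
  · simp
  · rw [G.adj_comm, H.adj_comm]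
    exact h j i hij

/-- The excluded induced subgraphs, as labels. -/
inductive Pattern
  | p7 | c7 | c4 | gem

namespace Pattern

/-- Number of vertices. -/
def size : Pattern → ℕ
  | p7 => 7 | c7 => 7 | c4 => 4 | gem => 5

/-- Adjacency of the vertices `i < j`. -/
def adj : Pattern → ℕ → ℕ → Bool
  | p7, i, j => j == i + 1
  | c7, i, j => j == i + 1 || (i == 0 && j == 6)
  | c4, i, j => j == i + 1 || (i == 0 && j == 3)
  | gem, i, j => j == i + 1 || j == 4

end Pattern

theorem pathGraph_seven_adj (i j : Fin 7) (h : i < j) :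
    (pathGraph 7).Adj i j ↔ Pattern.p7.adj i j = true := by
  rw [pathGraph_adj]
  revert i j
  decide

theorem cycleGraph_seven_adj (i j : Fin 7) (h : i < j) :
    (cycleGraph 7).Adj i j ↔ Pattern.c7.adj i j = true := by
  rw [cycleGraph_adj]
  revert i j
  decide

theorem cycleGraph_four_adj (i j : Fin 4) (h : i < j) :
    (cycleGraph 4).Adj i j ↔ Pattern.c4.adj i j = true := by
  rw [cycleGraph_adj]
  revert i j
  decide

theorem gem_adj (i j : Fin 5) :
    gem.Adj i j ↔
      (if i < j then Pattern.gem.adj i j else if j < i then Pattern.gem.adj j i else false) =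
        true := by
  simp only [gem, fromEdgeSet_adj, Set.mem_insert_iff, Set.mem_singleton_iff, Sym2.eq_iff]
  revert i j
  decide

/-- Distinctness of the vertices is automatic for `P_7`, `C_7` and the gem, where no two vertices
share a neighbourhood. Opposite vertices of `C_4` do, which is why `h4` is needed there. -/
theorem Pattern.excluded {V : Type*} {G : SimpleGraph V} (hG : ExcludedFree G) (P : Pattern)
    (u : ℕ → V)
    (h : ∀ j < P.size, ∀ i < j, (G.Adj (u i) (u j) ↔ P.adj i j = true))
    (h4 : P = .c4 → u 0 ≠ u 2 ∧ u 1 ≠ u 3) : False := by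
  cases P with
  | p7 =>
    have h' := adj_iff_of_lt (H := pathGraph 7) (fun i : Fin 7 => u i)
      fun i j hij => (h j j.2 i hij).trans (pathGraph_seven_adj i j hij).symm
    refine hG.p7 (isIndContained_of_adj_iff _ (injective_of_adj_iff _ h' ?_) h')
    simp only [pathGraph_adj]
    decide
  | c7 =>
    have h' := adj_iff_of_lt (H := cycleGraph 7) (fun i : Fin 7 => u i)
      fun i j hij => (h j j.2 i hij).trans (cycleGraph_seven_adj i j hij).symm
    refine hG.c7 (isIndContained_of_adj_iff _ (injective_of_adj_iff _ h' ?_) h')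
    simp only [cycleGraph_adj]
    decide
  | c4 =>
    have h' := adj_iff_of_lt (H := cycleGraph 4) (fun i : Fin 4 => u i)
      fun i j hij => (h j j.2 i hij).trans (cycleGraph_four_adj i j hij).symm
    refine hG.c4 (isIndContained_of_adj_iff _ ?_ h')
    obtain ⟨h02, h13⟩ := h4 rfl
    intro i j hij
    by_contra hne
    have hn : ¬ G.Adj (u i) (u j) := fun ha => ha.ne hij
    have hn' := mt (h' i j).2 hn
    rw [cycleGraph_adj] at hn'
    have key : ∀ i j : Fin 4, i ≠ j → ¬ (i - j = 1 ∨ j - i = 1) →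
      (i = 0 ∧ j = 2) ∨ (i = 2 ∧ j = 0) ∨ (i = 1 ∧ j = 3) ∨ (i = 3 ∧ j = 1) := by decide
    rcases key i j hne hn' with ⟨rfl, rfl⟩ | ⟨rfl, rfl⟩ | ⟨rfl, rfl⟩ | ⟨rfl, rfl⟩
    exacts [h02 hij, h02 hij.symm, h13 hij, h13 hij.symm]
  | gem =>
    have h' := adj_iff_of_lt (H := PetersenBlowup.gem) (fun i : Fin 5 => u i)
      fun i j hij => (h j j.2 i hij).trans ((gem_adj i j).trans (by rw [if_pos hij])).symm
    refine hG.gem (isIndContained_of_adj_iff _ (injective_of_adj_iff _ h' ?_) h')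
    simp only [gem_adj]
    decide

/-! ### Configurations and their refutation by decision trees -/

/-- A literal `(i, j, b)`: the labels `i` and `j` are adjacent (`b = true`) or not. -/
abbrev Lit := ℕ × ℕ × Bool

/-- The literal holds for the vertices `v`. -/
def Lit.Holds {V : Type*} (G : SimpleGraph V) (v : ℕ → V) (l : Lit) : Prop :=
  G.Adj (v l.1) (v l.2.1) ↔ l.2.2 = true

/-- Sets of unordered pairs of labels below `32`, as bit masks. -/
def pairMem (m i j : ℕ) : Bool := Nat.blt j 32 && m.testBit (32 * i + j)

/-- Adds an unordered pair of labels. -/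
def pairInsert (m i j : ℕ) : ℕ := m ||| 2 ^ (32 * i + j) ||| 2 ^ (32 * j + i)

/-- All pairs of the mask are adjacent (`b = true`) or all are nonadjacent. -/
def MaskHolds {V : Type*} (G : SimpleGraph V) (v : ℕ → V) (b : Bool) (m : ℕ) : Prop :=
  ∀ i j, pairMem m i j = true → (G.Adj (v i) (v j) ↔ b = true)

theorem maskHolds_zero {V : Type*} (G : SimpleGraph V) (v : ℕ → V) (b : Bool) :
    MaskHolds G v b 0 := by
  intro i j h
  simp [pairMem] at h

theorem MaskHolds.insert {V : Type*} {G : SimpleGraph V} {v : ℕ → V} {b : Bool} {m i j : ℕ}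
    (h : MaskHolds G v b m) (hi : i < 32) (hj : j < 32) (hij : G.Adj (v i) (v j) ↔ b = true) :
    MaskHolds G v b (pairInsert m i j) := by
  intro k l hkl
  simp only [pairMem, pairInsert, Bool.and_eq_true, Nat.blt_eq, Nat.testBit_or,
    Nat.testBit_two_pow, Bool.or_eq_true, decide_eq_true_eq] at hkl
  obtain ⟨hl, (hm | hm) | hm⟩ := hkl
  · exact h k l (by simp [pairMem, hl, hm])
  -- The second entries are below `32`, so equal codes `32 * i + j` come from equal pairs.
  · obtain ⟨rfl, rfl⟩ : i = k ∧ j = l := by omega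
    exact hij
  · obtain ⟨rfl, rfl⟩ : j = k ∧ i = l := by omega
    rwa [G.adj_comm]

/-- The colours used to describe configurations of labelled vertices: `rel c d` is the adjacency
forced by the colours of two vertices, `clique c` says that the vertices of colour `c` form a
clique, and `det c a b` that no vertex of colour `c` is adjacent to vertices of both colours `a`
and `b`. -/
structure Palette (C : Type) where
  rel : C → C → Option Bool
  clique : C → C → Bool
  det : C → C → C → Bool

/-- The sets `S c` of vertices obey the rules of the palette. -/
structure Palette.Sound {V : Type*} {C : Type} (D : Palette C) (G : SimpleGraph V) (S : C → Set V) :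
    Prop where
  rel : ∀ c d b, D.rel c d = some b → ∀ x ∈ S c, ∀ y ∈ S d, (G.Adj x y ↔ b = true)
  clique : ∀ c d, D.clique c d = true → ∀ x ∈ S c, ∀ y ∈ S d, x = y ∨ G.Adj x y
  det : ∀ c a b, D.det c a b = true → ∀ x ∈ S c, ∀ y ∈ S a, ∀ z ∈ S b,
    ¬ (G.Adj x y ∧ G.Adj x z)

/-- Refutations of configurations. -/
inductive Cert
  | p7 (l : List ℕ)
  | c7 (l : List ℕ)
  | c4 (l : List ℕ)
  | gem (l : List ℕ)
  | det (d a b : ℕ)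
  | tw (x y w : ℕ)
  | ng (k : ℕ)
  | br (i j : ℕ) (yes no : Cert)

/-- A configuration: the colours of the labelled vertices, further literals, pairs of distinct
vertices, and sets of literals that are not all true. -/
structure Config (C : Type) where
  cols : List C
  lits : List Lit
  ne : List (ℕ × ℕ)
  ngs : List (List Lit)

/-- The vertices `v` form the configuration. -/
structure Config.Holds {V : Type*} {C : Type} (K : Config C) (G : SimpleGraph V) (S : C → Set V)
    (v : ℕ → V) : Prop where
  cols : ∀ i c, K.cols[i]? = some c → v i ∈ S c
  lits : ∀ l ∈ K.lits, l.Holds G v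
  ne : ∀ p ∈ K.ne, v p.1 ≠ v p.2
  ngs : ∀ g ∈ K.ngs, ¬ ∀ l ∈ g, l.Holds G v

/-- The literal lies in the masks of known adjacencies and nonadjacencies. -/
def known (E M : ℕ) (l : Lit) : Bool := pairMem (bif l.2.2 then E else M) l.1 l.2.1

theorem known_holds {V : Type*} {G : SimpleGraph V} {v : ℕ → V} {E M : ℕ}
    (hE : MaskHolds G v true E) (hM : MaskHolds G v false M) (l : Lit) (h : known E M l = true) :
    l.Holds G v := by
  obtain ⟨i, j, b⟩ := l
  cases b
  · exact hM i j h
  · exact hE i j h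

/-- The vertices with labels `i` and `j` are distinct. -/
def apart {C : Type} (K : Config C) (E M i j : ℕ) : Bool :=
  K.ne.contains (i, j) || K.ne.contains (j, i) ||
    (List.range 32).any fun w =>
      (pairMem E i w && pairMem M j w) || (pairMem M i w && pairMem E j w)

theorem apart_ne {V : Type*} {C : Type} {K : Config C} {G : SimpleGraph V} {S : C → Set V} {v : ℕ → V}
    (hK : K.Holds G S v) {E M : ℕ} (hE : MaskHolds G v true E) (hM : MaskHolds G v false M)
    {i j : ℕ} (h : apart K E M i j = true) : v i ≠ v j := by
  simp only [apart, Bool.or_eq_true, List.any_eq_true, Bool.and_eq_true] at h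
  rcases h with (h | h) | ⟨w, -, h | h⟩
  · exact hK.ne (i, j) (by simpa using h)
  · exact (hK.ne (j, i) (by simpa using h)).symm
  · intro hij
    have h1 := hE _ _ h.1
    have h2 := hM _ _ h.2
    rw [hij] at h1
    simp_all
  · intro hij
    have h1 := hM _ _ h.1
    have h2 := hE _ _ h.2
    rw [hij] at h1
    simp_all

/-- The labels `l` are known to induce the pattern. -/
def Pattern.check {C : Type} (P : Pattern) (K : Config C) (E M : ℕ) (l : List ℕ) : Bool :=
  ((List.range P.size).all fun j => (List.range j).all fun i =>
    known E M (l.getD i 0, l.getD j 0, P.adj i j)) &&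
  match P with
  | .c4 => apart K E M (l.getD 0 0) (l.getD 2 0) && apart K E M (l.getD 1 0) (l.getD 3 0)
  | _ => true

theorem Pattern.check_false {V : Type*} {C : Type} {K : Config C} {G : SimpleGraph V} {S : C → Set V}
    {v : ℕ → V} (hG : ExcludedFree G) (hK : K.Holds G S v) {E M : ℕ} (hE : MaskHolds G v true E)
    (hM : MaskHolds G v false M) {P : Pattern} {l : List ℕ} (h : P.check K E M l = true) :
    False := by
  unfold Pattern.check at h
  rw [Bool.and_eq_true] at h
  refine P.excluded hG (fun i => v (l.getD i 0)) ?_ ?_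
  · intro j hj i hij
    have h1 := List.all_eq_true.1 h.1 j (List.mem_range.2 hj)
    have h2 := List.all_eq_true.1 h1 i (List.mem_range.2 hij)
    exact known_holds hE hM _ h2
  · rintro rfl
    have h2 := h.2
    simp only [Bool.and_eq_true] at h2
    exact ⟨apart_ne hK hE hM h2.1, apart_ne hK hE hM h2.2⟩

/-- The check of a refutation, given the masks of known adjacencies and nonadjacencies. -/
def Cert.check {C : Type} (D : Palette C) (K : Config C) : Cert → ℕ → ℕ → Bool
  | p7 l, E, M => Pattern.p7.check K E M l
  | c7 l, E, M => Pattern.c7.check K E M l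
  | c4 l, E, M => Pattern.c4.check K E M l
  | gem l, E, M => Pattern.gem.check K E M l
  | det d a b, E, _ =>
    pairMem E d a && pairMem E d b &&
      match K.cols[d]?, K.cols[a]?, K.cols[b]? with
      | some d, some a, some b => D.det d a b
      | _, _, _ => false
  | tw x y w, E, M =>
    pairMem M x y && pairMem E x w && pairMem M y w &&
      match K.cols[x]?, K.cols[y]? with
      | some x, some y => D.clique x y
      | _, _ => false
  | ng k, E, M =>
    match K.ngs[k]? with
    | some g => g.all (known E M)
    | none => false
  | br i j yes no, E, M =>
    Nat.blt i 32 && Nat.blt j 32 && yes.check D K (pairInsert E i j) M &&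
      no.check D K E (pairInsert M i j)

/-- A branch `br` is excluded middle for one adjacency. Each leaf is impossible: an excluded induced
subgraph; a vertex adjacent to two colours that the palette forbids together (`det`); two
nonadjacent members of one clique that `w` shows to be distinct (`tw`); or a conjunction of literals
assumed to fail (`ng`). -/
theorem Cert.check_false {V : Type*} {C : Type} {D : Palette C} {K : Config C} {G : SimpleGraph V}
    {S : C → Set V} {v : ℕ → V} (hG : ExcludedFree G) (hD : D.Sound G S) (hK : K.Holds G S v)
    (c : Cert) : ∀ {E M : ℕ}, MaskHolds G v true E → MaskHolds G v false M →
    c.check D K E M = true → False := by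
  induction c with
  | p7 l => exact fun hE hM h => Pattern.check_false hG hK hE hM h
  | c7 l => exact fun hE hM h => Pattern.check_false hG hK hE hM h
  | c4 l => exact fun hE hM h => Pattern.check_false hG hK hE hM h
  | gem l => exact fun hE hM h => Pattern.check_false hG hK hE hM h
  | det d a b =>
    intro E M hE hM h
    simp only [Cert.check, Bool.and_eq_true] at h
    obtain ⟨⟨h1, h2⟩, h3⟩ := h
    split at h3
    · rename_i hd ha hb
      exact hD.det _ _ _ h3 _ (hK.cols _ _ hd) _ (hK.cols _ _ ha) _ (hK.cols _ _ hb)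
        ⟨(hE _ _ h1).2 rfl, (hE _ _ h2).2 rfl⟩
    · cases h3
  | tw x y w =>
    intro E M hE hM h
    simp only [Cert.check, Bool.and_eq_true] at h
    obtain ⟨⟨⟨h1, h2⟩, h2'⟩, h3⟩ := h
    split at h3
    · rename_i hx hy
      have h1' := hM _ _ h1
      have h2 := hE _ _ h2
      have h2' := hM _ _ h2'
      rcases hD.clique _ _ h3 _ (hK.cols _ _ hx) _ (hK.cols _ _ hy) with h | h
      · rw [h] at h2
        simp_all
      · simp_all
    · cases h3
  | ng k =>
    intro E M hE hM h
    simp only [Cert.check] at h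
    split at h
    · rename_i g hg
      exact hK.ngs g (List.mem_of_getElem? hg)
        fun l hl => known_holds hE hM l (List.all_eq_true.1 h l hl)
    · cases h
  | br i j yes no ih1 ih2 =>
    intro E M hE hM h
    simp only [Cert.check, Bool.and_eq_true, Nat.blt_eq] at h
    obtain ⟨⟨⟨hi, hj⟩, h1⟩, h2⟩ := h
    by_cases hij : G.Adj (v i) (v j)
    · exact ih1 (hE.insert hi hj (by simpa using hij)) hM h1
    · exact ih2 hE (hM.insert hi hj (by simpa using hij)) h2

/-- The literals forced by the colours. -/
def Config.colLits {C : Type} (D : Palette C) (K : Config C) : List Lit :=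
  (List.range K.cols.length).flatMap fun j => (List.range j).filterMap fun i =>
    match K.cols[i]?, K.cols[j]? with
    | some a, some b => (D.rel a b).map fun r => (i, j, r)
    | _, _ => none

/-- The mask of the literals of sign `b`. -/
def litMask (b : Bool) (l : List Lit) : ℕ :=
  l.foldl (fun m l => bif l.2.2 == b && Nat.blt l.1 32 && Nat.blt l.2.1 32 then
    pairInsert m l.1 l.2.1 else m) 0

theorem maskHolds_litMask {V : Type*} {G : SimpleGraph V} {v : ℕ → V} (b : Bool) (l : List Lit)
    (h : ∀ x ∈ l, x.Holds G v) : MaskHolds G v b (litMask b l) := by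
  unfold litMask
  -- The induction over the fold needs an arbitrary accumulator that satisfies the claim.
  generalize hm : (0 : ℕ) = m
  have h0 : MaskHolds G v b m := hm ▸ maskHolds_zero G v b
  clear hm
  induction l generalizing m with
  | nil => exact h0
  | cons x l ih =>
    refine ih (fun y hy => h y (List.mem_cons_of_mem _ hy)) _ ?_
    have hx := h x List.mem_cons_self
    dsimp only
    by_cases hb : (x.2.2 == b && Nat.blt x.1 32 && Nat.blt x.2.1 32) = true
    · rw [hb, cond_true]
      simp only [Bool.and_eq_true, beq_iff_eq, Nat.blt_eq] at hb
      exact h0.insert hb.1.2 hb.2 (by rw [← hb.1.1]; exact hx)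
    · rw [Bool.not_eq_true] at hb
      rwa [hb, cond_false]

/-- The certificate refutes the configuration. -/
def Config.refutedBy {C : Type} (D : Palette C) (K : Config C) (c : Cert) : Bool :=
  (fun l => c.check D K (litMask true l) (litMask false l)) (K.colLits D ++ K.lits)

theorem Config.Holds.forall_lits {V : Type*} {C : Type} {D : Palette C} {K : Config C}
    {G : SimpleGraph V} {S : C → Set V} {v : ℕ → V} (hK : K.Holds G S v) (hD : D.Sound G S) :
    ∀ l ∈ K.colLits D ++ K.lits, l.Holds G v := by
  intro l hl
  rcases List.mem_append.1 hl with hl | hl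
  · simp only [Config.colLits, List.mem_flatMap, List.mem_filterMap] at hl
    obtain ⟨j, -, i, -, hl⟩ := hl
    split at hl
    · rename_i a b ha hb
      obtain ⟨r, hr, rfl⟩ := Option.map_eq_some_iff.1 hl
      exact hD.rel _ _ _ hr _ (hK.cols _ _ ha) _ (hK.cols _ _ hb)
    · cases hl
  · exact hK.lits l hl

theorem Config.Holds.false {V : Type*} {C : Type} {D : Palette C} {K : Config C}
    {G : SimpleGraph V} {S : C → Set V} {v : ℕ → V} (hK : K.Holds G S v) (hG : ExcludedFree G)
    (hD : D.Sound G S) {c : Cert} (hc : K.refutedBy D c = true) : False :=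
  c.check_false hG hD hK (maskHolds_litMask _ _ (hK.forall_lits hD))
    (maskHolds_litMask _ _ (hK.forall_lits hD)) hc

/-- The configuration determines all adjacencies of the labels below `n`, as in the graph `H`. -/
theorem Config.Holds.adj_iff {V : Type*} {C : Type} {D : Palette C} {K : Config C}
    {G : SimpleGraph V} {S : C → Set V} {v : ℕ → V} (hK : K.Holds G S v) (hD : D.Sound G S)
    {n : ℕ} {H : SimpleGraph (Fin n)} [DecidableRel H.Adj]
    (h : ∀ i j : Fin n, i ≠ j → (i.val, j.val, decide (H.Adj i j)) ∈ K.colLits D ++ K.lits ∨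
      (j.val, i.val, decide (H.Adj i j)) ∈ K.colLits D ++ K.lits) (i j : Fin n) :
    G.Adj (v i) (v j) ↔ H.Adj i j := by
  by_cases hij : i = j
  · subst hij
    simp
  · rcases h i j hij with h | h
    · simpa [Lit.Holds] using hK.forall_lits hD _ h
    · rw [G.adj_comm]
      simpa [Lit.Holds] using hK.forall_lits hD _ h

/-! ### Chordless paths and clique-cutsets -/

/-- `p 0, …, p n` are the vertices of a chordless path with distinct ends. -/
structure IsChordlessPath {V : Type*} (G : SimpleGraph V) (p : ℕ → V) (n : ℕ) : Prop where
  adj_iff : ∀ i j, i < j → j ≤ n → (G.Adj (p i) (p j) ↔ j = i + 1)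
  ends_ne : p 0 ≠ p n

theorem IsChordlessPath.reverse {V : Type*} {G : SimpleGraph V} {p : ℕ → V} {n : ℕ}
    (h : IsChordlessPath G p n) : IsChordlessPath G (fun i => p (n - i)) n := by
  refine ⟨fun i j hij hj => ?_, ?_⟩
  · rw [G.adj_comm, h.adj_iff (n - j) (n - i) (by omega) (by omega)]
    omega
  · simpa using h.ends_ne.symm

/-- The first seven vertices of a longer path would induce `P_7`. This bound makes the analysis of
paths finite. -/
theorem IsChordlessPath.le_five {V : Type*} {G : SimpleGraph V} (hG : ExcludedFree G) {p : ℕ → V}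
    {n : ℕ} (h : IsChordlessPath G p n) : n ≤ 5 := by
  by_contra hn
  refine Pattern.excluded hG .p7 p ?_ (by simp)
  intro j hj i hij
  rw [h.adj_iff i j hij (by simp only [Pattern.size] at hj; omega)]
  simp [Pattern.adj]

/-- The vertices reachable from `d` by walks whose later vertices avoid `B`. -/
def reachAvoiding {V : Type*} (G : SimpleGraph V) (B : Set V) (d : V) : Set V :=
  {u | Relation.ReflTransGen (fun a b => G.Adj a b ∧ b ∉ B) d u}

theorem reachAvoiding_self {V : Type*} (G : SimpleGraph V) (B : Set V) (d : V) :
    d ∈ reachAvoiding G B d := Relation.ReflTransGen.refl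

theorem reachAvoiding_step {V : Type*} {G : SimpleGraph V} {B : Set V} {d u w : V}
    (hu : u ∈ reachAvoiding G B d) (h : G.Adj u w) (hw : w ∉ B) : w ∈ reachAvoiding G B d :=
  Relation.ReflTransGen.tail hu ⟨h, hw⟩

theorem notMem_of_mem_reachAvoiding {V : Type*} {G : SimpleGraph V} {B : Set V} {d u : V}
    (hd : d ∉ B) (hu : u ∈ reachAvoiding G B d) : u ∉ B := by
  rcases Relation.ReflTransGen.cases_tail hu with rfl | ⟨w, -, -, h⟩
  exacts [hd, h]

/-- A property passing between adjacent vertices of the reachable set holds for all of them as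
soon as it holds for one. -/
theorem forall_reachAvoiding {V : Type*} {G : SimpleGraph V} {B : Set V} {d : V}
    {P : V → Prop}
    (hP : ∀ u ∈ reachAvoiding G B d, ∀ w ∈ reachAvoiding G B d, G.Adj u w → P u → P w)
    {u : V} (hu : u ∈ reachAvoiding G B d) (h : P u) : ∀ w ∈ reachAvoiding G B d, P w := by
  have key : ∀ w ∈ reachAvoiding G B d, P d ↔ P w := by
    intro w hw
    induction hw with
    | refl => rfl
    | @tail a b ha hab ih =>
      have hb : b ∈ reachAvoiding G B d := reachAvoiding_step ha hab.1 hab.2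
      exact ih.trans ⟨hP a ha b hb hab.1, hP b hb a ha hab.1.symm⟩
  exact fun w hw => (key w hw).1 ((key u hu).2 h)

/-- A shortest walk gives a chordless path. -/
theorem exists_chordlessPath_of_reachable {V : Type*} {G : SimpleGraph V} {x y : V}
    (hxy : x ≠ y) (h : G.Reachable x y) :
    ∃ (p : ℕ → V) (n : ℕ), IsChordlessPath G p n ∧ p 0 = x ∧ p n = y ∧
      ∀ i, 0 < i → i < n → p i ≠ x ∧ p i ≠ y := by
  obtain ⟨w, hw⟩ := h.exists_walk_length_eq_dist
  have hmin : ∀ w' : G.Walk x y, w.length ≤ w'.length := fun w' => hw ▸ dist_le w'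
  refine ⟨w.getVert, w.length, ⟨fun i j hij hj => ⟨fun ha => ?_, ?_⟩, by simpa using hxy⟩,
    by simp, by simp, fun i h0 hi => ⟨fun hx => ?_, fun hy => ?_⟩⟩
  -- A chord from `p i` to `p j` gives a walk of length `i + 1 + (length - j)`, which is too short
  -- unless `j = i + 1`.
  · have := hmin ((w.take i).append ((Walk.cons ha .nil).append (w.drop j)))
    simp only [Walk.length_append, Walk.take_length, Walk.length_cons, Walk.length_nil,
      Walk.drop_length] at this
    omega
  · rintro rfl
    exact w.adj_getVert_succ (by omega)
  · have := hmin ((w.drop i).copy hx rfl)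
    simp only [Walk.length_copy, Walk.drop_length] at this
    omega
  · have := hmin ((w.take i).copy rfl hy)
    simp only [Walk.length_copy, Walk.take_length] at this
    omega

/-- In a connected graph without clique cutset, every component outside a set `B` that is not a
clique is traversed by a chordless path between two nonadjacent vertices of `B`. -/
theorem exists_chordlessPath_through {V : Type*} [Finite V] {G : SimpleGraph V}
    (hconn : G.Connected) (hcut : ∀ K, ¬ IsCliqueCutset G K) {B : Set V} (hB : ¬ G.IsClique B)
    {d : V} (hd : d ∉ B) :
    ∃ (p : ℕ → V) (n : ℕ), IsChordlessPath G p n ∧ 2 ≤ n ∧ p 0 ∈ B ∧ p n ∈ B ∧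
      ∀ i, 0 < i → i < n → p i ∈ reachAvoiding G B d := by
  set Q := reachAvoiding G B d with hQ
  set N : Set V := {x | x ∈ B ∧ ∃ u ∈ Q, G.Adj u x} with hN
  -- `N` is the attachment of the component of `d` in `B`. If it were a clique, some vertex of `B`
  -- would lie outside it, since `B` is no clique, and `N` would separate that vertex from `d`.
  by_cases hNc : G.IsClique N
  · exfalso
    refine hcut N ⟨hNc, ?_⟩
    have h1 : Nat.card G.ConnectedComponent = 1 := by
      have := hconn.preconnected.subsingleton_connectedComponent
      have := hconn.nonempty
      exact Nat.card_eq_one_iff_unique.2 ⟨inferInstance, inferInstance⟩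
    obtain ⟨b, hbB, hbN⟩ : ∃ b ∈ B, b ∉ N := by
      by_contra! h
      exact hB fun x hx y hy hxy => hNc (h x hx) (h y hy) hxy
    have hdN : d ∉ N := fun h => hd h.1
    rw [h1, Finite.one_lt_card_iff_nontrivial]
    refine ⟨(G.induce Nᶜ).connectedComponentMk ⟨d, hdN⟩,
      (G.induce Nᶜ).connectedComponentMk ⟨b, hbN⟩, fun h => ?_⟩
    have key : ∀ u : (Nᶜ : Set V), (G.induce Nᶜ).Reachable ⟨d, hdN⟩ u → u.1 ∈ Q := by
      intro u hu
      rw [SimpleGraph.reachable_iff_reflTransGen] at hu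
      induction hu with
      | refl => exact reachAvoiding_self G B d
      | @tail a c _ hac ih =>
        have hac' : G.Adj a.1 c.1 := hac
        exact reachAvoiding_step ih hac' fun hc => c.2 ⟨hc, a.1, ih, hac'⟩
    exact notMem_of_mem_reachAvoiding hd (key _ (ConnectedComponent.exact h)) hbB
  · obtain ⟨x, hx, y, hy, hxy, hna⟩ : ∃ x ∈ N, ∃ y ∈ N, x ≠ y ∧ ¬ G.Adj x y := by
      by_contra! h
      exact hNc fun x hx y hy hxy => h x hx y hy hxy
    -- A shortest path from `x` to `y` inside `Q ∪ {x, y}` meets `x` and `y` only at its ends, so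
    -- its interior lies in `Q`.
    set T : Set V := {u | u ∈ Q ∨ u = x ∨ u = y} with hT
    have hreach : ∀ u (hu : u ∈ Q), (G.induce T).Reachable
        ⟨d, Or.inl (reachAvoiding_self G B d)⟩ ⟨u, Or.inl hu⟩ := by
      intro u hu
      induction hu with
      | refl => rfl
      | @tail a c ha hac ih =>
        refine ih.trans (Adj.reachable ?_)
        exact hac.1
    have hend : ∀ v (hv : v ∈ T), v ∈ N → (G.induce T).Reachable
        ⟨d, Or.inl (reachAvoiding_self G B d)⟩ ⟨v, hv⟩ := by
      rintro v hv ⟨-, u, hu, huv⟩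
      exact (hreach u hu).trans (Adj.reachable huv)
    obtain ⟨p, n, hp, h0, hn, hi⟩ := exists_chordlessPath_of_reachable
      (G := G.induce T) (x := ⟨x, Or.inr (Or.inl rfl)⟩) (y := ⟨y, Or.inr (Or.inr rfl)⟩)
      (by simpa using hxy) ((hend x _ hx).symm.trans (hend y _ hy))
    have h0' : (p 0).1 = x := congrArg Subtype.val h0
    have hn' : (p n).1 = y := congrArg Subtype.val hn
    refine ⟨fun i => (p i).1, n, ⟨hp.adj_iff, fun h => hp.ends_ne (Subtype.ext h)⟩, ?_,
      by simpa only [h0'] using hx.1, by simpa only [hn'] using hy.1, ?_⟩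
    · rcases n with _ | _ | n
      · exact absurd (h0'.symm.trans hn') hxy
      · have := (hp.adj_iff 0 1 one_pos le_rfl).2 rfl
        rw [zero_add] at hn'
        exact absurd (h0' ▸ hn' ▸ this) hna
      · omega
    · intro i h1 h2
      rcases (p i).2 with h | h | h
      · exact h
      · exact absurd (Subtype.ext h) (hi i h1 h2).1
      · exact absurd (Subtype.ext h) (hi i h1 h2).2

/-! ### Blowup systems, twins and their palettes -/

/-- Nonempty cliques `B p` of `G`, one for each vertex of `H`, whose adjacencies are those of
`H`. -/
structure BlowupSystem {V W : Type*} (G : SimpleGraph V) (H : SimpleGraph W) (B : W → Set V) :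
    Prop where
  nonempty : ∀ p, (B p).Nonempty
  clique : ∀ p, ∀ x ∈ B p, ∀ y ∈ B p, x = y ∨ G.Adj x y
  adj_iff : ∀ p q, p ≠ q → ∀ x ∈ B p, ∀ y ∈ B q, (G.Adj x y ↔ H.Adj p q)

theorem BlowupSystem.of_embedding {V W : Type*} {G : SimpleGraph V} {H : SimpleGraph W} {f : W → V}
    (h : ∀ p q, G.Adj (f p) (f q) ↔ H.Adj p q) : BlowupSystem G H fun p => {f p} where
  nonempty _ := Set.singleton_nonempty _
  clique _ x hx y hy := Or.inl (hx.trans hy.symm)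
  adj_iff := by
    rintro p q - x rfl y rfl
    exact h p q

theorem BlowupSystem.comp {V W : Type*} {G : SimpleGraph V} {H : SimpleGraph W} {B : W → Set V}
    (h : BlowupSystem G H B) (e : H ≃g H) : BlowupSystem G H fun p => B (e p) where
  nonempty _ := h.nonempty _
  clique _ := h.clique _
  adj_iff p q hpq x hx y hy :=
    (h.adj_iff (e p) (e q) (e.injective.ne hpq) x hx y hy).trans e.map_adj_iff

/-- The vertices with the adjacencies of `f p` to the other vertices of the copy `f` of `H`. -/
def twins {V W : Type*} (G : SimpleGraph V) (H : SimpleGraph W) (f : W → V) (p : W) : Set V :=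
  {x | ∀ q, q ≠ p → (G.Adj x (f q) ↔ H.Adj p q)}

theorem mem_twins_self {V W : Type*} {G : SimpleGraph V} {H : SimpleGraph W} {f : W → V}
    (h : ∀ p q, G.Adj (f p) (f q) ↔ H.Adj p q) (p : W) : f p ∈ twins G H f p :=
  fun q _ => h p q

theorem twins_comp {V W : Type*} {G : SimpleGraph V} {H : SimpleGraph W} (f : W → V) (e : H ≃g H)
    (p : W) : twins G H (fun q => f (e q)) p = twins G H f (e p) := by
  ext x
  constructor
  · intro hx q hq
    have := hx (e.symm q) fun h => hq (by rw [← h, RelIso.apply_symm_apply])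
    dsimp only at this
    rw [RelIso.apply_symm_apply] at this
    rw [this, ← e.map_adj_iff, RelIso.apply_symm_apply]
  · intro hx q hq
    rw [hx (e q) (e.injective.ne hq), e.map_adj_iff]

/-- `d` has no neighbours in two nonadjacent parts. -/
def IsDetached {V W : Type*} (G : SimpleGraph V) (H : SimpleGraph W) (B : W → Set V) (d : V) :
    Prop :=
  ∀ p q, p ≠ q → ¬ H.Adj p q → ∀ a ∈ B p, ∀ b ∈ B q, ¬ (G.Adj d a ∧ G.Adj d b)

/-- The colours of the vertices around a blowup system: members of a part, connectors, detached
vertices, vertices anticomplete to the system, and vertices without restriction. -/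
inductive Col (W : Type)
  | mem (p : W) | conn (p : W) | det | anti | free

/-- The palette of a blowup system of `H`, where connectors of kind `p` and vertices of kind `q`
are known to be nonadjacent unless `near p q`. -/
def blowupPalette {W : Type} (H : SimpleGraph W) [DecidableEq W] [DecidableRel H.Adj]
    (near : W → W → Bool) : Palette (Col W) where
  rel
    | .mem p, .mem q => bif decide (p = q) then none else some (decide (H.Adj p q))
    | .mem p, .conn q => bif near q p then none else some false
    | .conn p, .mem q => bif near p q then none else some false
    | .conn p, .conn q => bif near p q then none else some false
    | .mem _, .anti => some false
    | .anti, .mem _ => some false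
    | _, _ => none
  clique
    | .mem p, .mem q => decide (p = q)
    | _, _ => false
  det
    | .det, .mem p, .mem q => !decide (p = q) && !decide (H.Adj p q)
    | _, _, _ => false

/-- The sets of the colours, for the parts `B` and the connectors `Z`. -/
def colSet {V : Type*} {W : Type} (G : SimpleGraph V) (H : SimpleGraph W) (B Z : W → Set V) :
    Col W → Set V
  | .mem p => B p
  | .conn p => Z p
  | .det => {d | IsDetached G H B d}
  | .anti => {d | ∀ p, ∀ a ∈ B p, ¬ G.Adj d a}
  | .free => Set.univ

theorem BlowupSystem.sound {V : Type*} {W : Type} {G : SimpleGraph V} {H : SimpleGraph W}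
    [DecidableEq W] [DecidableRel H.Adj] {B Z : W → Set V} (h : BlowupSystem G H B)
    {near : W → W → Bool}
    (hnear : ∀ p q, near p q = false → ∀ z ∈ Z p,
      (∀ a ∈ B q, ¬ G.Adj z a) ∧ ∀ a ∈ Z q, ¬ G.Adj z a) :
    (blowupPalette H near).Sound G (colSet G H B Z) where
  rel c d b hb x hx y hy := by
    cases c <;> cases d <;> simp only [blowupPalette, reduceCtorEq, Option.some.injEq] at hb
    case mem.mem p q =>
      by_cases hpq : p = q
      · simp [hpq] at hb
      · simp only [hpq, decide_false, cond_false, Option.some.injEq] at hb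
        rw [h.adj_iff p q hpq x hx y hy, ← hb, decide_eq_true_iff]
    case mem.conn p q =>
      cases hn : near q p <;> simp only [hn, cond_true, cond_false, reduceCtorEq,
        Option.some.injEq] at hb
      rw [← hb, G.adj_comm]
      simpa using (hnear q p hn y hy).1 x hx
    case conn.mem p q =>
      cases hn : near p q <;> simp only [hn, cond_true, cond_false, reduceCtorEq,
        Option.some.injEq] at hb
      rw [← hb]
      simpa using (hnear p q hn x hx).1 y hy
    case conn.conn p q =>
      cases hn : near p q <;> simp only [hn, cond_true, cond_false, reduceCtorEq,
        Option.some.injEq] at hb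
      rw [← hb]
      simpa using (hnear p q hn x hx).2 y hy
    case mem.anti p =>
      rw [← hb, G.adj_comm]
      simpa using hy p x hx
    case anti.mem p =>
      rw [← hb]
      simpa using hx p y hy
  clique c d hcd x hx y hy := by
    cases c <;> cases d <;> simp only [blowupPalette, reduceCtorEq, decide_eq_true_eq] at hcd
    subst hcd
    exact h.clique _ x hx y hy
  det c a b hc x hx y hy z hz := by
    cases c <;> cases a <;> cases b <;>
      simp only [blowupPalette, reduceCtorEq, Bool.and_eq_true, Bool.not_eq_true',
        decide_eq_false_iff_not] at hc
    exact hx _ _ hc.1 hc.2 y hy z hz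

/-! ### Refutation of listed vertices and of paths -/

/-- The colours of listed vertices. -/
def ColsHold {V C : Type*} (S : C → Set V) : List V → List C → Prop
  | x :: l, c :: cs => x ∈ S c ∧ ColsHold S l cs
  | _, [] => True
  | [], _ :: _ => False

/-- Literals as a conjunction. -/
def LitsHold {V : Type*} (G : SimpleGraph V) (v : ℕ → V) : List Lit → Prop
  | [] => True
  | (i, j, true) :: l => G.Adj (v i) (v j) ∧ LitsHold G v l
  | (i, j, false) :: l => ¬ G.Adj (v i) (v j) ∧ LitsHold G v l

/-- Inequalities as a conjunction. -/
def NesHold {V : Type*} (v : ℕ → V) : List (ℕ × ℕ) → Prop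
  | [] => True
  | (i, j) :: l => v i ≠ v j ∧ NesHold v l

/-- Excluded conjunctions of literals, as a conjunction. -/
def NgsHold {V : Type*} (G : SimpleGraph V) (v : ℕ → V) : List (List Lit) → Prop
  | [] => True
  | g :: l => ¬ LitsHold G v g ∧ NgsHold G v l

theorem ColsHold.mem {V C : Type*} {S : C → Set V} {x₀ : V} : ∀ {l : List V} {cs : List C},
    ColsHold S l cs → ∀ i c, cs[i]? = some c → l.getD i x₀ ∈ S c
  | [], [], _, i, c, hc => by simp at hc
  | _ :: _, [], _, i, c, hc => by simp at hc
  | [], _ :: _, h, _, _, _ => h.elim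
  | x :: l, c :: cs, h, 0, c', hc => by
    simp only [List.getElem?_cons_zero, Option.some.injEq] at hc
    exact hc ▸ h.1
  | x :: l, c :: cs, h, i + 1, c', hc => by
    simp only [List.getElem?_cons_succ] at hc
    simpa using h.2.mem i c' hc

theorem ColsHold.length_le {V C : Type*} {S : C → Set V} : ∀ {l : List V} {cs : List C},
    ColsHold S l cs → cs.length ≤ l.length
  | [], [], _ => by simp
  | _ :: _, [], _ => by simp
  | [], _ :: _, h => h.elim
  | _ :: _, _ :: _, h => by simpa using h.2.length_le

theorem litsHold_iff {V : Type*} {G : SimpleGraph V} {v : ℕ → V} : ∀ {l : List Lit},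
    LitsHold G v l ↔ ∀ x ∈ l, x.Holds G v
  | [] => by simp [LitsHold]
  | (i, j, true) :: l => by simp [LitsHold, litsHold_iff, Lit.Holds]
  | (i, j, false) :: l => by simp [LitsHold, litsHold_iff, Lit.Holds]

theorem nesHold_iff {V : Type*} {v : ℕ → V} : ∀ {l : List (ℕ × ℕ)},
    NesHold v l ↔ ∀ p ∈ l, v p.1 ≠ v p.2
  | [] => by simp [NesHold]
  | (i, j) :: l => by rw [NesHold, nesHold_iff]; simp

theorem ngsHold_iff {V : Type*} {G : SimpleGraph V} {v : ℕ → V} : ∀ {l : List (List Lit)},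
    NgsHold G v l ↔ ∀ g ∈ l, ¬ ∀ x ∈ g, x.Holds G v
  | [] => by simp [NgsHold]
  | g :: l => by rw [NgsHold, ngsHold_iff, litsHold_iff]; simp

/-- Refutation of a configuration of listed vertices. -/
theorem refute {V : Type*} {C : Type} {G : SimpleGraph V} {D : Palette C} {S : C → Set V}
    (hG : ExcludedFree G) (hD : D.Sound G S) (K : Config C) (x : V) (l : List V) (c : Cert)
    (hc : K.refutedBy D c = true) (hcols : ColsHold S (x :: l) K.cols)
    (hlits : LitsHold G (fun i => (x :: l).getD i x) K.lits)
    (hne : NesHold (fun i => (x :: l).getD i x) K.ne)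
    (hngs : NgsHold G (fun i => (x :: l).getD i x) K.ngs) : False :=
  Config.Holds.false (D := D) (c := c) (S := S) (v := fun i => (x :: l).getD i x)
    ⟨fun _ _ h => hcols.mem _ _ h, litsHold_iff.1 hlits, nesHold_iff.1 hne, ngsHold_iff.1 hngs⟩
    hG hD hc

/-- The literals saying that the labels `s, …, s + n` form a chordless path. -/
def pathLits (s n : ℕ) : List Lit :=
  (List.range (n + 1)).flatMap fun j => (List.range j).map fun i => (s + i, s + j, j == i + 1)

/-- The literals saying that label `k` has the adjacencies `xs`. -/
def adjLits (k : ℕ) (xs : List (ℕ × Bool)) : List Lit := xs.map fun x => (k, x.1, x.2)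

/-- A vertex has the listed adjacencies to listed vertices. -/
def AdjsHold {V : Type*} (G : SimpleGraph V) (l : List V) (y : V) : List (ℕ × Bool) → Prop
  | [] => True
  | (i, true) :: xs => G.Adj y (l.getD i y) ∧ AdjsHold G l y xs
  | (i, false) :: xs => ¬ G.Adj y (l.getD i y) ∧ AdjsHold G l y xs

/-- The configuration of static vertices coloured `cols` with literals `lits` followed by a
chordless path with `n + 1` vertices, whose ends are coloured `c₀` and `c₁` and have the
adjacencies `xs` and `ys` to the static vertices, and whose other vertices are coloured `ci`. -/
def pathConfig {C : Type} (cols : List C) (lits : List Lit) (c₀ ci c₁ : C)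
    (xs ys : List (ℕ × Bool)) (n : ℕ) : Config C where
  cols := cols ++ c₀ :: List.replicate (n - 1) ci ++ [c₁]
  lits := lits ++ adjLits cols.length xs ++ adjLits (cols.length + n) ys ++ pathLits cols.length n
  ne := [(cols.length, cols.length + n)]
  ngs := []

theorem adjsHold_holds {V : Type*} {G : SimpleGraph V} {l : List V} {v : ℕ → V} {k : ℕ}
    (hv : ∀ i, v i = l.getD i (v k) ∨ l.length ≤ i) : ∀ {xs : List (ℕ × Bool)},
    (∀ x ∈ xs, x.1 < l.length) → AdjsHold G l (v k) xs → ∀ x ∈ adjLits k xs, x.Holds G v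
  | [], _, _ => by simp [adjLits]
  | (i, b) :: xs, hx, h => by
    have hi : v i = l.getD i (v k) := by
      rcases hv i with h | h
      · exact h
      · have := hx (i, b) (by simp)
        simp only at this
        omega
    have ih := adjsHold_holds (G := G) hv (xs := xs) (fun x hx' => hx x (List.mem_cons_of_mem _ hx'))
    intro y hy
    simp only [adjLits, List.map_cons, List.mem_cons] at hy
    rcases hy with rfl | hy
    · cases b
      · simpa [Lit.Holds, hi] using h.1
      · simpa [Lit.Holds, hi] using h.1
    · cases b <;> exact ih h.2 y hy

/-- Refutation of a configuration with a path. -/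
theorem refute_path {V : Type*} {C : Type} {G : SimpleGraph V} {D : Palette C} {S : C → Set V}
    (hG : ExcludedFree G) (hD : D.Sound G S) {cols : List C} {lits : List Lit} {c₀ ci c₁ : C}
    {xs ys : List (ℕ × Bool)} {m : ℕ} (cert : ℕ → Cert)
    (hc : (List.range 6).all (fun n => Nat.blt n m ||
      (pathConfig cols lits c₀ ci c₁ xs ys n).refutedBy D (cert n)) = true)
    (hlen : xs.all (fun x => Nat.blt x.1 cols.length) && ys.all (fun x => Nat.blt x.1 cols.length)
      && lits.all (fun x => Nat.blt x.1 cols.length && Nat.blt x.2.1 cols.length) = true)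
    {p : ℕ → V} {n : ℕ} (hp : IsChordlessPath G p n) (hm : m ≤ n) (hm1 : 1 ≤ n)
    (l : List V) (hl : l.length = cols.length) (hcols : ColsHold S l cols)
    (hlits : LitsHold G (fun i => l.getD i (p 0)) lits)
    (h₀ : p 0 ∈ S c₀) (hi : ∀ i, 0 < i → i < n → p i ∈ S ci) (h₁ : p n ∈ S c₁)
    (hxs : AdjsHold G l (p 0) xs) (hys : AdjsHold G l (p n) ys) : False := by
  -- At most five edges: the lengths in `List.range 6` are all there are.
  have hn5 := hp.le_five hG
  have hcn := List.all_eq_true.1 hc n (List.mem_range.2 (by omega))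
  rw [Bool.or_eq_true, Nat.blt_eq] at hcn
  replace hcn := hcn.resolve_left (by omega)
  simp only [Bool.and_eq_true, List.all_eq_true, Nat.blt_eq,
    decide_eq_true_eq] at hlen
  obtain ⟨⟨hlx, hly⟩, hll⟩ := hlen
  set v : ℕ → V := fun i => if i < l.length then l.getD i (p 0) else p (i - l.length) with hv
  have hvl : ∀ i, i < l.length → ∀ y, v i = l.getD i y := by
    intro i hi y
    simp only [hv, if_pos hi]
    rw [List.getD_eq_getElem _ _ hi, List.getD_eq_getElem _ _ hi]
  have hvp : ∀ i, v (cols.length + i) = p i := by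
    intro i
    simp [hv, hl]
  have hvp0 : v cols.length = p 0 := hvp 0
  refine Config.Holds.false (S := S) (v := v) ⟨?_, ?_, ?_, ?_⟩ hG hD hcn
  · intro i c hic
    by_cases h1 : i < cols.length
    · simp only [pathConfig, List.append_assoc] at hic
      rw [List.getElem?_append_left h1] at hic
      rw [hvl i (hl ▸ h1) (p 0)]
      exact hcols.mem i c hic
    · obtain ⟨k, rfl⟩ := Nat.exists_eq_add_of_le (not_lt.1 h1)
      rw [hvp]
      simp only [pathConfig, List.append_assoc] at hic
      rw [List.getElem?_append_right (by omega), Nat.add_sub_cancel_left] at hic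
      rcases k with _ | k
      · simp only [List.cons_append, List.getElem?_cons_zero, Option.some.injEq] at hic
        exact hic ▸ h₀
      · simp only [List.cons_append, List.getElem?_cons_succ] at hic
        by_cases h2 : k < n - 1
        · rw [List.getElem?_append_left (by simpa using h2),
            List.getElem?_replicate_of_lt h2, Option.some.injEq] at hic
          exact hic ▸ hi _ (by omega) (by omega)
        · rw [List.getElem?_append_right (by simpa using h2), List.length_replicate] at hic
          -- After the `n - 1` inner colours only the colour of the last vertex remains.
          have hk : k - (n - 1) = 0 := by
            by_contra hk
            obtain ⟨t, ht⟩ := Nat.exists_eq_succ_of_ne_zero hk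
            rw [ht] at hic
            simp at hic
          rw [hk] at hic
          simp only [List.getElem?_cons_zero, Option.some.injEq] at hic
          have : k + 1 = n := by omega
          exact hic ▸ this ▸ h₁
  · intro x hx
    simp only [pathConfig, List.mem_append] at hx
    rcases hx with ((hx | hx) | hx) | hx
    · have h := litsHold_iff.1 hlits x hx
      have hlt := hll x hx
      rw [Lit.Holds, hvl _ (hl ▸ hlt.1) (p 0), hvl _ (hl ▸ hlt.2) (p 0)]
      exact h
    · refine adjsHold_holds (l := l) (k := cols.length) (fun i => ?_)
        (fun y hy => hl ▸ hlx y hy) (by rwa [hvp0]) x hx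
      by_cases h : i < l.length
      · exact Or.inl (hvl i h _)
      · exact Or.inr (not_lt.1 h)
    · refine adjsHold_holds (l := l) (k := cols.length + n) (fun i => ?_)
        (fun y hy => hl ▸ hly y hy) (by rwa [hvp]) x hx
      by_cases h : i < l.length
      · exact Or.inl (hvl i h _)
      · exact Or.inr (not_lt.1 h)
    · simp only [pathLits, List.mem_flatMap, List.mem_range, List.mem_map] at hx
      obtain ⟨j, hj, i, hij, rfl⟩ := hx
      rw [Lit.Holds, hvp, hvp, hp.adj_iff i j hij (by omega)]
      simp
  · intro q hq
    simp only [pathConfig, List.mem_singleton] at hq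
    subst hq
    rw [hvp, hvp0]
    exact hp.ends_ne
  · simp [pathConfig]

/-! ### The hexagon, its twins and its connectors -/

/-- The hexagon. -/
abbrev hexagon : SimpleGraph (Fin 6) := cycleGraph 6

/-- The rotation `t ↦ c + t` of the hexagon. -/
def hexRotate (c : Fin 6) : hexagon ≃g hexagon where
  toEquiv := Equiv.addLeft c
  map_rel_iff' {a b} := by
    simp only [Equiv.coe_addLeft, cycleGraph_adj]
    revert a b c
    decide

/-- The reflection `t ↦ c - t` of the hexagon. -/
def hexReflect (c : Fin 6) : hexagon ≃g hexagon where
  toEquiv := Equiv.subLeft c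
  map_rel_iff' {a b} := by
    simp only [Equiv.subLeft_apply, cycleGraph_adj]
    revert a b c
    decide

theorem hexRotate_apply (c t : Fin 6) : hexRotate c t = c + t := rfl

theorem hexReflect_apply (c t : Fin 6) : hexReflect c t = c - t := rfl

/-- Symmetries of the hexagon that commute with the antipodal map. -/
def IsHexSymm (e : hexagon ≃g hexagon) : Prop := ∀ p, e (p + 3) = e p + 3

theorem isHexSymm_rotate (c : Fin 6) : IsHexSymm (hexRotate c) := by
  intro p
  rw [hexRotate_apply, hexRotate_apply, add_assoc]

theorem isHexSymm_reflect (c : Fin 6) : IsHexSymm (hexReflect c) := by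
  intro p
  rw [hexReflect_apply, hexReflect_apply]
  revert c p
  decide

/-- The dihedral group is transitive on ordered pairs at a given distance. Rotations suffice when
`q` is reached in the positive direction; the other two positions need a reflection. -/
theorem exists_hexSymm (p q : Fin 6) : ∃ e : hexagon ≃g hexagon, IsHexSymm e ∧ e 0 = p ∧
    (e 0 = q ∨ e 1 = q ∨ e 2 = q ∨ e 3 = q) := by
  have key : ∀ p q : Fin 6, (p + 0 = q ∨ p + 1 = q ∨ p + 2 = q ∨ p + 3 = q) ∨
    (p - 1 = q ∨ p - 2 = q) := by decide
  rcases key p q with h | h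
  · exact ⟨hexRotate p, isHexSymm_rotate p, add_zero p, h⟩
  · exact ⟨hexReflect p, isHexSymm_reflect p, sub_zero p,
      by rcases h with h | h; exacts [Or.inr (Or.inl h), Or.inr (Or.inr (Or.inl h))]⟩

/-- No restriction on connectors. -/
def nearAll {W : Type} : W → W → Bool := fun _ _ => true

theorem BlowupSystem.sound_nearAll {V : Type*} {W : Type} {G : SimpleGraph V} {H : SimpleGraph W}
    [DecidableEq W] [DecidableRel H.Adj] {B Z : W → Set V} (h : BlowupSystem G H B) :
    (blowupPalette H nearAll).Sound G (colSet G H B Z) :=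
  h.sound fun _ _ h => by cases h

/-- The colours of the vertices of a hexagon, followed by `l`. -/
def hexCols (l : List (Col (Fin 6))) : List (Col (Fin 6)) :=
  .mem 0 :: .mem 1 :: .mem 2 :: .mem 3 :: .mem 4 :: .mem 5 :: l

/-- The adjacency of vertices with corresponding parts. -/
theorem adj_of_mem_twins {V W : Type*} {G : SimpleGraph V} {H : SimpleGraph W} {f : W → V} {x : V}
    {p : W} (hx : x ∈ twins G H f p) {q : W} (h : H.Adj p q) : G.Adj x (f q) :=
  (hx q h.ne').2 h

theorem not_adj_of_mem_twins {V W : Type*} {G : SimpleGraph V} {H : SimpleGraph W} {f : W → V}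
    {x : V} {p : W} (hx : x ∈ twins G H f p) {q : W} (hq : q ≠ p) (h : ¬ H.Adj p q) :
    ¬ G.Adj x (f q) :=
  mt (hx q hq).1 h

section

variable {V : Type*} {G : SimpleGraph V} (hG : ExcludedFree G) {f : Fin 6 → V}
  (hf : ∀ p q, G.Adj (f p) (f q) ↔ hexagon.Adj p q) {x y : V} (hx : x ∈ twins G hexagon f 0)

include hG hf hx

/-- Distinct nonadjacent `x`, `y` would form a `C_4` with their common neighbours `f 1` and `f 5`.
-/
theorem twins_zero_zero (hy : y ∈ twins G hexagon f 0) : x = y ∨ G.Adj x y := by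
  by_contra! h
  exact refute hG ((BlowupSystem.of_embedding hf).sound_nearAll (Z := fun _ => ∅))
    ⟨hexCols [], [(6, 1, true), (6, 5, true), (7, 1, true), (7, 5, true), (6, 7, false)],
      [(6, 7)], []⟩ (f 0) [f 1, f 2, f 3, f 4, f 5, x, y]
    (.c4 [1, 6, 5, 7]) (by decide +kernel)
    ⟨rfl, rfl, rfl, rfl, rfl, rfl, trivial⟩
    ⟨adj_of_mem_twins hx (by decide), adj_of_mem_twins hx (by decide),
      adj_of_mem_twins hy (by decide), adj_of_mem_twins hy (by decide), h.2, trivial⟩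
    ⟨h.1, trivial⟩ trivial

/-- Suppose `x` and `y` are nonadjacent. If `x` misses `f 0`, or `y` misses `f 1`, the missed vertex
lies in a `C_4` with its twin. Otherwise `y, f 1, x, f 5` is a path complete to `f 0`, a gem. -/
theorem twins_zero_one (hy : y ∈ twins G hexagon f 1) : G.Adj x y := by
  by_contra h
  exact refute hG ((BlowupSystem.of_embedding hf).sound_nearAll (Z := fun _ => ∅))
    ⟨hexCols [], [(6, 1, true), (6, 2, false), (6, 5, true), (7, 0, true), (7, 2, true),
      (7, 5, false), (6, 7, false)], [], []⟩ (f 0) [f 1, f 2, f 3, f 4, f 5, x, y]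
    (.br 0 6 (.br 1 7 (.gem [7, 1, 6, 5, 0]) (.c4 [1, 0, 7, 2])) (.c4 [0, 1, 6, 5]))
    (by decide +kernel)
    ⟨rfl, rfl, rfl, rfl, rfl, rfl, trivial⟩
    ⟨adj_of_mem_twins hx (by decide), not_adj_of_mem_twins hx (by decide) (by decide),
      adj_of_mem_twins hx (by decide), adj_of_mem_twins hy (by decide),
      adj_of_mem_twins hy (by decide), not_adj_of_mem_twins hy (by decide) (by decide),
      h, trivial⟩
    trivial trivial

/-- Suppose `x` and `y` are adjacent. Then `x` sees `f 0` by `C_4`-freeness, and `f 5, f 0, f 1, y`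
is a path complete to `x`, a gem. -/
theorem twins_zero_two (hy : y ∈ twins G hexagon f 2) : ¬ G.Adj x y := by
  intro h
  exact refute hG ((BlowupSystem.of_embedding hf).sound_nearAll (Z := fun _ => ∅))
    ⟨hexCols [], [(6, 1, true), (6, 2, false), (6, 5, true), (7, 0, false), (7, 1, true),
      (7, 5, false), (6, 7, true)], [], []⟩ (f 0) [f 1, f 2, f 3, f 4, f 5, x, y]
    (.br 0 6 (.gem [5, 0, 1, 7, 6]) (.c4 [0, 1, 6, 5]))
    (by decide +kernel)
    ⟨rfl, rfl, rfl, rfl, rfl, rfl, trivial⟩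
    ⟨adj_of_mem_twins hx (by decide), not_adj_of_mem_twins hx (by decide) (by decide),
      adj_of_mem_twins hx (by decide), not_adj_of_mem_twins hy (by decide) (by decide),
      adj_of_mem_twins hy (by decide), not_adj_of_mem_twins hy (by decide) (by decide),
      h, trivial⟩
    trivial trivial

/-- An edge `xy` would close the `C_4` formed by `f 1, f 2, y, x`. -/
theorem twins_zero_three (hy : y ∈ twins G hexagon f 3) : ¬ G.Adj x y := by
  intro h
  exact refute hG ((BlowupSystem.of_embedding hf).sound_nearAll (Z := fun _ => ∅))
    ⟨hexCols [], [(6, 1, true), (6, 2, false), (6, 3, false), (7, 0, false),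
      (7, 1, false), (7, 2, true), (6, 7, true)], [], []⟩
    (f 0) [f 1, f 2, f 3, f 4, f 5, x, y]
    (.c4 [1, 2, 7, 6])
    (by decide +kernel)
    ⟨rfl, rfl, rfl, rfl, rfl, rfl, trivial⟩
    ⟨adj_of_mem_twins hx (by decide), not_adj_of_mem_twins hx (by decide) (by decide),
      not_adj_of_mem_twins hx (by decide) (by decide),
      not_adj_of_mem_twins hy (by decide) (by decide),
      not_adj_of_mem_twins hy (by decide) (by decide), adj_of_mem_twins hy (by decide),
      h, trivial⟩
    trivial trivial

end

/-- The vertices that are twins of the vertices of a hexagon form a blowup of the hexagon. -/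
theorem blowupSystem_twins_hexagon {V : Type*} {G : SimpleGraph V} (hG : ExcludedFree G)
    {f : Fin 6 → V} (hf : ∀ p q, G.Adj (f p) (f q) ↔ hexagon.Adj p q) :
    BlowupSystem G hexagon (twins G hexagon f) where
  nonempty p := ⟨f p, mem_twins_self hf p⟩
  clique p x hx y hy := by
    obtain ⟨e, -, rfl, -⟩ := exists_hexSymm p p
    rw [← twins_comp] at hx hy
    exact twins_zero_zero hG (fun p q => (hf _ _).trans e.map_adj_iff) hx hy
  adj_iff p q hpq x hx y hy := by
    obtain ⟨e, -, rfl, h⟩ := exists_hexSymm p q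
    have hf' : ∀ p q, G.Adj (f (e p)) (f (e q)) ↔ hexagon.Adj p q :=
      fun p q => (hf _ _).trans e.map_adj_iff
    rcases h with rfl | rfl | rfl | rfl
    · exact absurd rfl hpq
    all_goals rw [← twins_comp] at hx hy; rw [e.map_adj_iff]
    · exact iff_of_true (twins_zero_one hG hf' hx hy) (by decide)
    · exact iff_of_false (twins_zero_two hG hf' hx hy) (by decide)
    · exact iff_of_false (twins_zero_three hG hf' hx hy) (by decide)

/-- A blowup of the hexagon such that no other vertex has neighbours in two parts at distance
two. -/
structure HexFrame {V : Type*} (G : SimpleGraph V) (A : Fin 6 → Set V) : Prop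
    extends BlowupSystem G hexagon A where
  attach : ∀ d, (∀ p, d ∉ A p) → ∀ p q, p ≠ q → ¬ hexagon.Adj p q → q ≠ p + 3 →
    ∀ a ∈ A p, ∀ b ∈ A q, ¬ (G.Adj d a ∧ G.Adj d b)

/-- The vertices outside `A` with neighbours in the opposite parts `A p` and `A (p + 3)`. -/
def connectors {V : Type*} (G : SimpleGraph V) (A : Fin 6 → Set V) (p : Fin 6) : Set V :=
  {z | (∀ q, z ∉ A q) ∧ (∃ a ∈ A p, G.Adj z a) ∧ ∃ b ∈ A (p + 3), G.Adj z b}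

theorem HexFrame.comp {V : Type*} {G : SimpleGraph V} {A : Fin 6 → Set V} (h : HexFrame G A)
    {e : hexagon ≃g hexagon} (he : IsHexSymm e) : HexFrame G fun p => A (e p) where
  toBlowupSystem := h.toBlowupSystem.comp e
  attach d hd p q hpq hadj hq a ha b hb := by
    refine h.attach d (fun r => ?_) (e p) (e q) (e.injective.ne hpq)
      (fun h => hadj (e.map_adj_iff.1 h)) (fun h => hq (e.injective (h.trans (he p).symm))) a ha b hb
    have := hd (e.symm r)
    rwa [RelIso.apply_symm_apply] at this

theorem connectors_comp {V : Type*} {G : SimpleGraph V} {A : Fin 6 → Set V}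
    {e : hexagon ≃g hexagon} (he : IsHexSymm e) (p : Fin 6) :
    connectors G (fun p => A (e p)) p = connectors G A (e p) := by
  ext z
  simp only [connectors, Set.mem_ofPred_eq, he p]
  refine and_congr_left' ⟨fun h q => ?_, fun h q => h _⟩
  have := h (e.symm q)
  rwa [RelIso.apply_symm_apply] at this

theorem connectors_add_three {V : Type*} {G : SimpleGraph V} {A : Fin 6 → Set V} (p : Fin 6) :
    connectors G A (p + 3) = connectors G A p := by
  have : p + 3 + 3 = p := by revert p; decide
  ext z
  simp only [connectors, Set.mem_ofPred_eq, this]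
  tauto

/-- Each way for `d` to see the hexagon leads to a `C_4`, a gem or a separation of adjacent twins,
except the pattern of a twin of `f 1`. That pattern is the excluded conjunction, ruled out by `hd`.
-/
theorem attach_zero_two {V : Type*} {G : SimpleGraph V} (hG : ExcludedFree G) {f : Fin 6 → V}
    (hf : ∀ p q, G.Adj (f p) (f q) ↔ hexagon.Adj p q) {d x y : V}
    (hd : d ∉ twins G hexagon f 1) (hx : x ∈ twins G hexagon f 0) (hy : y ∈ twins G hexagon f 2) :
    ¬ (G.Adj d x ∧ G.Adj d y) := by
  intro h
  refine refute hG ((blowupSystem_twins_hexagon hG hf).sound_nearAll (Z := fun _ => ∅))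
    ⟨hexCols [.mem 0, .mem 2], [(8, 6, true), (8, 7, true)], [],
      [[(8, 0, true), (8, 2, true), (8, 3, false), (8, 4, false), (8, 5, false)]]⟩
    (f 0) [f 1, f 2, f 3, f 4, f 5, x, y, d]
    (.br 3 8 (.br 1 8 (.gem [6, 1, 7, 3, 8]) (.c4 [1, 6, 8, 7])) (.br 4 8 (.c4 [4, 8, 7, 3])
      (.br 5 8 (.br 1 8 (.gem [7, 1, 6, 5, 8]) (.c4 [1, 6, 8, 7])) (.br 0 8 (.br 2 8 (.ng 0)
      (.br 1 8 (.br 2 7 (.gem [2, 7, 8, 0, 1]) (.tw 7 2 8)) (.c4 [1, 0, 8, 7]))) (.br 0 6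
      (.br 1 8 (.gem [8, 1, 0, 5, 6]) (.c4 [1, 6, 8, 7])) (.tw 6 0 8))))))
    (by decide +kernel)
    ⟨mem_twins_self hf 0, mem_twins_self hf 1, mem_twins_self hf 2, mem_twins_self hf 3,
      mem_twins_self hf 4, mem_twins_self hf 5, hx, hy, trivial⟩
    ⟨h.1, h.2, trivial⟩ trivial ⟨?_, trivial⟩
  rintro ⟨h0, h2, h3, h4, h5, -⟩
  refine hd fun q hq => ?_
  fin_cases q
  · exact iff_of_true h0 (by decide)
  · exact absurd rfl hq
  · exact iff_of_true h2 (by decide)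
  · exact iff_of_false h3 (by decide)
  · exact iff_of_false h4 (by decide)
  · exact iff_of_false h5 (by decide)

theorem hexFrame_twins {V : Type*} {G : SimpleGraph V} (hG : ExcludedFree G)
    {f : Fin 6 → V} (hf : ∀ p q, G.Adj (f p) (f q) ↔ hexagon.Adj p q) :
    HexFrame G (twins G hexagon f) where
  toBlowupSystem := blowupSystem_twins_hexagon hG hf
  attach d hd p q hpq hadj hq a ha b hb := by
    obtain ⟨e, he, rfl, h⟩ := exists_hexSymm p q
    have hf' : ∀ p q, G.Adj (f (e p)) (f (e q)) ↔ hexagon.Adj p q :=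
      fun p q => (hf _ _).trans e.map_adj_iff
    rcases h with rfl | rfl | rfl | rfl
    · exact absurd rfl hpq
    · exact absurd (e.map_adj_iff.2 (by decide)) hadj
    · have hd1 := hd (e 1)
      rw [← twins_comp] at ha hb hd1
      exact attach_zero_two hG hf' hd1 ha hb
    · exact absurd (he 0) hq

theorem no_c4 {V : Type*} {G : SimpleGraph V} (hG : ExcludedFree G) {a b c d : V}
    (hab : G.Adj a b) (hbc : G.Adj b c) (hcd : G.Adj c d) (hda : G.Adj d a) (hac : a ≠ c)
    (hbd : b ≠ d) : G.Adj a c ∨ G.Adj b d := by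
  by_contra! h
  refine Pattern.excluded hG .c4 (fun i => [a, b, c, d].getD i a) ?_ fun _ => ⟨hac, hbd⟩
  intro j hj i hij
  simp only [Pattern.size] at hj
  interval_cases j <;> interval_cases i <;>
    simp [Pattern.adj, hab, hbc, hcd, hda.symm, h.1, h.2]

/-- Connectors of kind `p` may be adjacent to vertices of kind `q` only if `q` is `p` or
antipodal to `p`. -/
def hexNear (p q : Fin 6) : Bool := decide (q = p) || decide (q = p + 3)

/-- A part other than `p` and `p + 3` is at distance two from one of them, and the connector already
has neighbours in both. -/
theorem not_adj_connector_part {V : Type*} {G : SimpleGraph V} {A : Fin 6 → Set V}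
    (h : HexFrame G A) {p q : Fin 6} (hpq : hexNear p q = false) {z a : V}
    (hz : z ∈ connectors G A p) (ha : a ∈ A q) : ¬ G.Adj z a := by
  intro hza
  obtain ⟨hzA, ⟨b, hb, hzb⟩, c, hc, hzc⟩ := hz
  have key : ∀ p q, hexNear p q = false → (q ≠ p ∧ ¬ hexagon.Adj q p ∧ p ≠ q + 3) ∨
    (q ≠ p + 3 ∧ ¬ hexagon.Adj q (p + 3) ∧ p + 3 ≠ q + 3) := by decide
  rcases key p q hpq with ⟨h1, h2, h3⟩ | ⟨h1, h2, h3⟩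
  · exact h.attach z hzA q p h1 h2 h3 a ha b hb ⟨hza, hzb⟩
  · exact h.attach z hzA q (p + 3) h1 h2 h3 a ha c hc ⟨hza, hzc⟩

/-- Since kinds `q` and `q + 3` agree, `p` and `q` may be taken adjacent. An edge `zw` would then
close a `C_4` with neighbours `a`, `b` of the connectors in these parts; its diagonals are missing
by the previous lemma. -/
theorem not_adj_connector_connector {V : Type*} {G : SimpleGraph V} (hG : ExcludedFree G)
    {A : Fin 6 → Set V} (h : HexFrame G A) {p q : Fin 6} (hpq : hexNear p q = false) {z w : V}
    (hz : z ∈ connectors G A p) (hw : w ∈ connectors G A q) : ¬ G.Adj z w := by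
  wlog hadj : hexagon.Adj p q generalizing q
  · have key : ∀ p q, hexNear p q = false → ¬ hexagon.Adj p q →
      hexNear p (q + 3) = false ∧ hexagon.Adj p (q + 3) := by decide
    exact this (key p q hpq hadj).1 (by rwa [connectors_add_three]) (key p q hpq hadj).2
  have key : ∀ p q, hexNear p q = false → hexNear q p = false := by decide
  have hqp := key p q hpq
  intro hzw
  obtain ⟨hzA, ⟨a, ha, hza⟩, -⟩ := id hz
  obtain ⟨hwA, ⟨b, hb, hwb⟩, -⟩ := id hw
  have hab : G.Adj a b := (h.adj_iff p q hadj.ne a ha b hb).2 hadj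
  rcases no_c4 hG hza hab hwb.symm hzw.symm (fun e => hzA q (e ▸ hb)) (fun e => hwA p (e ▸ ha))
    with h1 | h1
  · exact not_adj_connector_part h hpq hz hb h1
  · exact not_adj_connector_part h hqp hw ha h1.symm

theorem HexFrame.sound_near {V : Type*} {G : SimpleGraph V} (hG : ExcludedFree G)
    {A : Fin 6 → Set V} (h : HexFrame G A) :
    (blowupPalette hexagon hexNear).Sound G (colSet G hexagon A (connectors G A)) :=
  h.toBlowupSystem.sound fun _ _ hpq _ hz =>
    ⟨fun _ ha => not_adj_connector_part h hpq hz ha,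
      fun _ hw => not_adj_connector_connector hG h hpq hz hw⟩

theorem HexFrame.isDetached {V : Type*} {G : SimpleGraph V} {A : Fin 6 → Set V}
    (h : HexFrame G A) {d : V} (hA : ∀ p, d ∉ A p) (hZ : ∀ p, d ∉ connectors G A p) :
    IsDetached G hexagon A d := by
  intro p q hpq hadj a ha b hb hab
  by_cases hq : q = p + 3
  · subst hq
    exact hZ p ⟨hA, ⟨a, ha, hab.1⟩, b, hb, hab.2⟩
  · exact h.attach d hA p q hpq hadj hq a ha b hb hab

/-! ### The Petersen graph as a completed hexagon -/

instance : DecidableRel petersen.Adj := fun s t => inferInstanceAs (Decidable (Disjoint s.1 t.1))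

/-- The vertices of the Petersen graph in an order that starts with a hexagon. -/
def petersenLabel : Fin 10 → {s : Finset (Fin 5) // s.card = 2} :=
  -- After the hexagon `0, …, 5`, the labels `6`, `7`, `8` see the opposite pairs `{0, 3}`, `{1,
  -- 4}`, `{2, 5}`, and `9` sees `6`, `7`, `8`.
  ![⟨{0, 2}, rfl⟩, ⟨{1, 3}, rfl⟩, ⟨{0, 4}, rfl⟩, ⟨{1, 2}, rfl⟩, ⟨{0, 3}, rfl⟩, ⟨{1, 4}, rfl⟩,
    ⟨{3, 4}, rfl⟩, ⟨{2, 4}, rfl⟩, ⟨{2, 3}, rfl⟩, ⟨{0, 1}, rfl⟩]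

theorem petersenLabel_bijective : Function.Bijective petersenLabel := by
  unfold Function.Bijective Function.Injective Function.Surjective
  decide +kernel

/-- `G` contains an induced Petersen graph. -/
def HasPetersen {V : Type*} (G : SimpleGraph V) : Prop :=
  ∃ f : {s : Finset (Fin 5) // s.card = 2} → V, ∀ p q, G.Adj (f p) (f q) ↔ petersen.Adj p q

theorem hasPetersen_of_labels {V : Type*} {G : SimpleGraph V} {u : Fin 10 → V}
    (h : ∀ i j, G.Adj (u i) (u j) ↔ (petersen.comap petersenLabel).Adj i j) : HasPetersen G := by
  let e := Equiv.ofBijective _ petersenLabel_bijective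
  refine ⟨fun p => u (e.symm p), fun p q => ?_⟩
  rw [h, comap_adj]
  have key (p) : petersenLabel (e.symm p) = p := e.apply_symm_apply p
  rw [key, key]

/-! ### Paths through the vertices outside parts and connectors -/

/-- Refutations for paths between parts at distance two. -/
def certPartPartTwo : ℕ → Cert
  | 2 =>
    .det 10 9 11
  | 3 =>
    .br 0 11 (.det 11 0 12) (.br 2 10 (.det 10 2 9) (.br 3 10 (.det 10 3 9) (.br 4 10 (.det 10 4
    9) (.br 4 11 (.det 11 4 12) (.br 5 11 (.det 11 5 12) (.br 1 10 (.br 1 11 (.gem [12, 11, 10, 9,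
    1]) (.c4 [1, 10, 11, 12])) (.br 1 11 (.c4 [1, 11, 10, 9]) (.br 7 10 (.c4 [7, 10, 9, 1]) (.br 7
    11 (.c4 [7, 11, 12, 1]) (.br 3 11 (.c7 [3, 11, 10, 9, 1, 7, 4]) (.p7 [3, 4, 7, 1, 9, 10,
    11])))))))))))
  | 4 =>
    .br 0 12 (.det 12 0 13) (.br 2 10 (.det 10 2 9) (.br 3 10 (.det 10 3 9) (.br 4 10 (.det 10 4
    9) (.br 4 12 (.det 12 4 13) (.br 5 12 (.det 12 5 13) (.br 3 12 (.br 1 12 (.det 12 1 3) (.br 1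
    11 (.c4 [1, 11, 12, 13]) (.br 7 12 (.c4 [7, 12, 3, 4]) (.br 1 10 (.br 5 10 (.det 10 1 5) (.br
    5 11 (.c4 [5, 11, 10, 9]) (.br 4 11 (.c7 [4, 11, 12, 13, 1, 9, 5]) (.p7 [4, 5, 9, 10, 11, 12,
    13])))) (.br 7 10 (.c4 [7, 10, 9, 1]) (.p7 [10, 9, 1, 7, 4, 3, 12])))))) (.br 3 11 (.c4 [3,
    11, 12, 13]) (.br 4 11 (.br 0 11 (.det 11 0 4) (.br 1 11 (.det 11 1 4) (.br 1 10 (.br 1 12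
    (.c4 [1, 12, 11, 10]) (.br 2 11 (.det 11 2 4) (.br 2 12 (.br 5 10 (.det 10 1 5) (.p7 [10, 9,
    5, 4, 3, 2, 12])) (.p7 [0, 1, 2, 3, 4, 11, 12])))) (.c7 [1, 9, 10, 11, 4, 3, 13])))) (.p7 [4,
    3, 13, 12, 11, 10, 9])))))))))
  | 5 =>
    .br 0 13 (.det 13 0 14) (.br 2 10 (.det 10 2 9) (.br 3 10 (.det 10 3 9) (.br 4 10 (.det 10 4
    9) (.br 4 13 (.det 13 4 14) (.br 5 13 (.det 13 5 14) (.br 3 13 (.br 1 13 (.det 13 1 3) (.br 1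
    12 (.c4 [1, 12, 13, 14]) (.br 1 10 (.br 5 10 (.det 10 1 5) (.br 5 11 (.c4 [5, 11, 10, 9]) (.br
    5 12 (.br 2 12 (.det 12 2 5) (.br 3 12 (.det 12 3 5) (.br 2 13 (.br 2 11 (.c4 [2, 11, 12, 13])
    (.br 3 11 (.c4 [3, 11, 12, 13]) (.br 1 11 (.br 4 11 (.det 11 1 4) (.p7 [13, 3, 4, 5, 9, 1,
    11])) (.p7 [3, 2, 1, 10, 11, 12, 5])))) (.c7 [2, 3, 13, 12, 5, 9, 1])))) (.p7 [5, 9, 10, 11,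
    12, 13, 14])))) (.br 1 11 (.c4 [1, 11, 10, 9]) (.c7 [1, 9, 10, 11, 12, 13, 14]))))) (.br 3 12
    (.c4 [3, 12, 13, 14]) (.br 3 11 (.br 0 11 (.det 11 0 3) (.br 1 11 (.det 11 1 3) (.br 5 10 (.br
    1 10 (.det 10 1 5) (.br 5 11 (.det 11 3 5) (.br 0 10 (.br 0 12 (.c4 [0, 12, 11, 10]) (.br 4 11
    (.c4 [4, 11, 10, 5]) (.br 1 13 (.p7 [13, 1, 0, 5, 4, 3, 11]) (.br 1 12 (.c4 [1, 12, 13, 14])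
    (.c7 [1, 14, 13, 12, 11, 10, 0]))))) (.c7 [0, 5, 10, 11, 3, 14, 1])))) (.p7 [10, 9, 5, 4, 3,
    14, 13])))) (.p7 [3, 14, 13, 12, 11, 10, 9])))))))))
  | _ => .ng 0

/-- Refutations for paths between opposite parts. -/
def certPartPartThree : ℕ → Cert
  | 2 =>
    .det 10 9 11
  | 3 =>
    .br 0 11 (.det 11 0 12) (.br 1 11 (.det 11 1 12) (.br 2 10 (.det 10 2 9) (.br 3 10 (.det 10 3
    9) (.br 4 10 (.det 10 4 9) (.br 5 11 (.det 11 5 12) (.br 1 10 (.br 2 11 (.c4 [2, 11, 10, 1])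
    (.br 5 10 (.det 10 1 5) (.br 8 10 (.c4 [8, 10, 1, 2]) (.br 8 11 (.c4 [8, 11, 12, 2]) (.c7 [8,
    2, 12, 11, 10, 9, 5]))))) (.br 7 10 (.c4 [7, 10, 9, 1]) (.br 8 10 (.p7 [8, 10, 9, 1, 7, 4, 3])
    (.br 4 11 (.br 2 11 (.det 11 2 4) (.br 3 11 (.br 5 10 (.c4 [5, 10, 11, 4]) (.br 0 10 (.br 8 11
    (.c4 [8, 11, 3, 2]) (.c7 [8, 2, 3, 11, 10, 0, 5])) (.p7 [5, 0, 1, 2, 3, 11, 10]))) (.c7 [3, 4,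
    11, 10, 9, 1, 2]))) (.br 7 11 (.c4 [7, 11, 12, 4]) (.c7 [7, 4, 12, 11, 10, 9, 1])))))))))))
  | 4 =>
    .br 0 12 (.det 12 0 13) (.br 1 12 (.det 12 1 13) (.br 2 10 (.det 10 2 9) (.br 4 10 (.det 10 4
    9) (.br 5 12 (.det 12 5 13) (.br 1 10 (.br 5 10 (.det 10 1 5) (.br 5 11 (.c4 [5, 11, 10, 9])
    (.br 4 11 (.br 0 11 (.det 11 0 4) (.br 1 11 (.det 11 1 4) (.br 0 10 (.br 2 11 (.det 11 2 4)
    (.br 2 12 (.br 4 12 (.det 12 2 4) (.c4 [4, 11, 12, 13])) (.p7 [2, 13, 12, 11, 10, 0, 5])))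
    (.p7 [5, 0, 1, 10, 11, 12, 13])))) (.br 2 11 (.c7 [2, 11, 10, 9, 5, 4, 13]) (.p7 [2, 13, 4, 5,
    9, 10, 11]))))) (.br 1 11 (.c4 [1, 11, 10, 9]) (.br 2 11 (.br 2 12 (.br 4 11 (.det 11 2 4)
    (.br 4 12 (.det 12 2 4) (.p7 [4, 13, 12, 11, 10, 9, 1]))) (.c4 [2, 11, 12, 13])) (.br 4 11
    (.c7 [4, 11, 10, 9, 1, 2, 13]) (.p7 [4, 13, 2, 1, 9, 10, 11])))))))))
  | 5 =>
    .br 1 13 (.det 13 1 14) (.br 2 10 (.det 10 2 9) (.br 3 10 (.det 10 3 9) (.br 4 10 (.det 10 4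
    9) (.br 5 13 (.det 13 5 14) (.br 1 10 (.br 5 10 (.det 10 1 5) (.br 5 11 (.c4 [5, 11, 10, 9])
    (.br 5 12 (.br 1 12 (.det 12 1 5) (.br 2 12 (.det 12 2 5) (.br 2 13 (.br 2 11 (.c4 [2, 11, 12,
    13]) (.br 1 11 (.br 3 11 (.det 11 1 3) (.br 4 11 (.det 11 1 4) (.p7 [2, 3, 4, 5, 9, 10, 11])))
    (.p7 [14, 2, 1, 10, 11, 12, 5]))) (.c7 [2, 14, 13, 12, 5, 9, 1])))) (.p7 [5, 9, 10, 11, 12,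
    13, 14])))) (.br 1 11 (.c4 [1, 11, 10, 9]) (.br 1 12 (.br 3 12 (.det 12 1 3) (.br 4 12 (.det
    12 1 4) (.br 4 13 (.br 2 13 (.det 13 2 4) (.br 2 11 (.br 0 11 (.det 11 0 2) (.br 2 12 (.c4 [2,
    12, 13, 14]) (.c4 [2, 1, 12, 11]))) (.p7 [13, 14, 2, 1, 9, 10, 11]))) (.p7 [4, 14, 13, 12, 1,
    9, 10])))) (.p7 [1, 9, 10, 11, 12, 13, 14]))))))))
  | _ => .ng 0

/-- Refutations for paths from a part to a connector of that part. -/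
def certPartConnZero : ℕ → Cert
  | 2 =>
    .br 0 8 (.br 1 9 (.br 5 9 (.det 9 1 5) (.br 0 9 (.gem [10, 9, 8, 5, 0]) (.c4 [0, 1, 9, 10])))
    (.br 0 9 (.gem [10, 9, 8, 1, 0]) (.c4 [0, 8, 9, 10]))) (.tw 0 8 10)
  | 3 =>
    .br 0 8 (.br 3 9 (.det 9 3 8) (.br 4 9 (.det 9 4 8) (.br 0 9 (.br 0 10 (.gem [11, 10, 9, 8,
    0]) (.c4 [0, 9, 10, 11])) (.br 6 9 (.c7 [6, 9, 8, 0, 11, 3, 4]) (.p7 [6, 4, 3, 11, 0, 8,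
    9]))))) (.tw 0 8 11)
  | 4 =>
    .br 0 8 (.br 2 9 (.det 9 2 8) (.br 3 9 (.det 9 3 8) (.br 4 9 (.det 9 4 8) (.br 1 9 (.br 5 9
    (.det 9 1 5) (.br 0 9 (.br 7 9 (.c4 [7, 9, 1, 2]) (.p7 [9, 8, 5, 7, 2, 3, 12])) (.gem [5, 0,
    1, 9, 8]))) (.br 6 9 (.c4 [6, 9, 8, 1]) (.p7 [9, 8, 1, 6, 4, 3, 12])))))) (.tw 0 8 12)
  | 5 =>
    .br 0 8 (.br 2 9 (.det 9 2 8) (.br 3 9 (.det 9 3 8) (.br 4 9 (.det 9 4 8) (.br 1 9 (.br 5 9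
    (.det 9 1 5) (.br 0 9 (.br 7 9 (.c4 [7, 9, 1, 2]) (.p7 [9, 8, 5, 7, 2, 3, 13])) (.gem [5, 0,
    1, 9, 8]))) (.br 6 9 (.c4 [6, 9, 8, 1]) (.p7 [9, 8, 1, 6, 4, 3, 13])))))) (.tw 0 8 13)
  | _ => .ng 0

/-- Refutations for paths from a part to a connector of other parts. -/
def certPartConnOne : ℕ → Cert
  | 2 =>
    .br 2 9 (.det 9 2 8) (.br 1 9 (.br 3 9 (.det 9 1 3) (.br 4 9 (.det 9 1 4) (.br 7 9 (.c4 [7, 9,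
    1, 2]) (.p7 [7, 2, 3, 4, 10, 9, 8])))) (.c4 [1, 8, 9, 10]))
  | 3 =>
    .br 2 9 (.det 9 2 8) (.br 3 9 (.det 9 3 8) (.br 4 9 (.det 9 4 8) (.br 7 9 (.p7 [8, 9, 7, 2, 3,
    4, 11]) (.br 1 10 (.br 1 9 (.gem [8, 9, 10, 11, 1]) (.c4 [1, 8, 9, 10])) (.br 0 10 (.c4 [0,
    10, 11, 1]) (.br 1 9 (.c4 [1, 9, 10, 11]) (.br 2 10 (.c4 [2, 10, 11, 1]) (.br 3 10 (.br 4 10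
    (.br 5 10 (.det 10 3 5) (.br 5 9 (.c4 [5, 9, 10, 4]) (.br 0 9 (.br 7 10 (.c4 [7, 10, 3, 2])
    (.c7 [7, 2, 3, 10, 9, 0, 5])) (.p7 [5, 0, 1, 2, 3, 10, 9])))) (.c4 [4, 3, 10, 11])) (.br 4 10
    (.c7 [4, 10, 9, 8, 1, 2, 3]) (.p7 [4, 3, 2, 1, 8, 9, 10]))))))))))
  | 4 =>
    .br 2 9 (.det 9 2 8) (.br 3 9 (.det 9 3 8) (.br 4 9 (.det 9 4 8) (.br 7 9 (.p7 [8, 9, 7, 2, 3,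
    4, 12]) (.br 1 11 (.br 3 11 (.det 11 1 3) (.br 4 11 (.det 11 1 4) (.br 4 10 (.c4 [4, 10, 11,
    12]) (.br 3 10 (.br 0 10 (.det 10 0 3) (.br 1 10 (.det 10 1 3) (.br 1 9 (.c4 [1, 9, 10, 11])
    (.c7 [1, 8, 9, 10, 3, 4, 12])))) (.p7 [3, 4, 12, 11, 10, 9, 8]))))) (.br 0 11 (.c4 [0, 11, 12,
    1]) (.br 1 10 (.c4 [1, 10, 11, 12]) (.br 2 11 (.c4 [2, 11, 12, 1]) (.br 0 10 (.br 0 8 (.br 2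
    10 (.det 10 0 2) (.br 3 10 (.det 10 0 3) (.br 4 10 (.det 10 0 4) (.br 1 9 (.br 5 9 (.det 9 1
    5) (.br 0 9 (.br 5 10 (.c4 [5, 10, 9, 8]) (.gem [5, 8, 9, 10, 0])) (.c4 [0, 1, 9, 10]))) (.p7
    [10, 9, 8, 1, 2, 3, 4]))))) (.tw 0 8 10)) (.br 5 10 (.br 2 10 (.det 10 2 5) (.br 3 10 (.det 10
    3 5) (.br 5 9 (.br 1 9 (.det 9 1 5) (.br 3 11 (.c7 [3, 11, 10, 9, 8, 1, 2]) (.p7 [3, 2, 1, 12,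
    11, 10, 9]))) (.c4 [5, 8, 9, 10])))) (.br 5 9 (.br 1 9 (.det 9 1 5) (.br 4 10 (.c4 [4, 10, 9,
    5]) (.br 2 10 (.c7 [2, 10, 9, 5, 4, 12, 1]) (.p7 [2, 1, 12, 4, 5, 9, 10])))) (.br 2 10 (.br 1
    9 (.c4 [1, 9, 10, 2]) (.br 4 10 (.det 10 2 4) (.p7 [5, 4, 12, 1, 2, 10, 9]))) (.br 3 10 (.br 7
    10 (.c4 [7, 10, 3, 2]) (.c7 [7, 2, 3, 10, 9, 8, 5])) (.br 4 10 (.br 1 9 (.br 7 10 (.c4 [7, 10,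
    4, 5]) (.c7 [7, 5, 4, 10, 9, 1, 2])) (.c7 [1, 8, 9, 10, 4, 3, 2])) (.p7 [2, 3, 4, 5, 8, 9,
    10]))))))))))))))
  | 5 =>
    .br 2 9 (.det 9 2 8) (.br 3 9 (.det 9 3 8) (.br 4 9 (.det 9 4 8) (.br 7 9 (.p7 [8, 9, 7, 2, 3,
    4, 13]) (.br 1 12 (.br 3 12 (.det 12 1 3) (.br 4 12 (.det 12 1 4) (.br 4 11 (.c4 [4, 11, 12,
    13]) (.br 4 10 (.br 0 10 (.det 10 0 4) (.br 1 10 (.det 10 1 4) (.br 2 10 (.det 10 2 4) (.br 2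
    12 (.p7 [2, 12, 13, 4, 10, 9, 8]) (.br 5 12 (.det 12 1 5) (.br 7 12 (.c4 [7, 12, 1, 2]) (.br 0
    12 (.p7 [0, 12, 13, 4, 3, 2, 7]) (.br 6 12 (.c4 [6, 12, 1, 0]) (.br 6 8 (.br 6 9 (.br 3 10
    (.br 5 10 (.det 10 3 5) (.br 5 9 (.c4 [5, 9, 10, 4]) (.br 0 9 (.br 0 11 (.c4 [0, 11, 10, 9])
    (.br 5 11 (.c4 [5, 11, 10, 4]) (.p7 [5, 0, 9, 10, 11, 12, 13]))) (.p7 [9, 6, 0, 5, 4, 13,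
    12])))) (.br 1 9 (.br 0 9 (.br 0 11 (.c4 [0, 11, 10, 9]) (.br 1 11 (.c4 [1, 11, 10, 9]) (.br 2
    11 (.c4 [2, 11, 12, 1]) (.br 3 11 (.c4 [3, 11, 10, 4]) (.c7 [3, 4, 10, 11, 12, 1, 2]))))) (.c4
    [0, 1, 9, 6])) (.c7 [1, 8, 9, 10, 4, 3, 2]))) (.p7 [9, 8, 6, 3, 4, 13, 12])) (.p7 [6, 3, 4, 5,
    8, 1, 12])))))))))) (.p7 [4, 13, 12, 11, 10, 9, 8]))))) (.br 0 12 (.c4 [0, 12, 13, 1]) (.br 1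
    11 (.c4 [1, 11, 12, 13]) (.br 1 9 (.br 5 9 (.det 9 1 5) (.br 5 10 (.c4 [5, 10, 9, 8]) (.br 6 9
    (.p7 [6, 9, 1, 2, 7, 5, 4]) (.br 6 8 (.br 6 10 (.c4 [6, 10, 9, 8]) (.br 0 9 (.br 0 10 (.br 0 8
    (.gem [5, 8, 9, 10, 0]) (.tw 0 8 10)) (.br 2 10 (.br 1 10 (.gem [2, 10, 9, 0, 1]) (.c4 [1, 2,
    10, 9])) (.br 3 10 (.br 1 10 (.det 10 1 3) (.br 7 10 (.c4 [7, 10, 3, 2]) (.c7 [7, 2, 3, 10, 9,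
    0, 5]))) (.br 4 10 (.br 1 10 (.det 10 1 4) (.br 7 10 (.c4 [7, 10, 4, 5]) (.c7 [7, 5, 4, 10, 9,
    1, 2]))) (.p7 [13, 4, 3, 6, 0, 9, 10]))))) (.br 0 8 (.gem [5, 0, 1, 9, 8]) (.tw 8 0 9)))) (.p7
    [6, 3, 2, 7, 5, 8, 9]))))) (.br 1 10 (.c4 [1, 10, 9, 8]) (.c7 [1, 8, 9, 10, 11, 12,
    13])))))))))
  | _ => .ng 0

/-- Refutations for paths between connectors of the same parts. -/
def certConnConnZero : ℕ → Cert
  | 2 =>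
    .br 0 12 (.br 3 12 (.c4 [3, 12, 0, 10]) (.br 3 11 (.br 0 11 (.det 11 0 3) (.c4 [0, 10, 11,
    12])) (.br 2 11 (.c4 [2, 11, 10, 3]) (.br 4 11 (.c4 [4, 11, 10, 3]) (.br 1 11 (.br 5 11 (.det
    11 1 5) (.p7 [5, 4, 3, 2, 1, 11, 12])) (.br 0 11 (.br 6 11 (.c4 [6, 11, 0, 1]) (.p7 [6, 1, 2,
    3, 10, 11, 12])) (.c4 [0, 10, 11, 12]))))))) (.br 0 8 (.br 9 10 (.br 8 10 (.c4 [8, 10, 9, 12])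
    (.br 3 12 (.br 0 11 (.br 3 11 (.det 11 0 3) (.c4 [3, 10, 11, 12])) (.br 1 11 (.c4 [1, 11, 10,
    0]) (.br 5 11 (.c4 [5, 11, 10, 0]) (.br 8 11 (.c4 [8, 11, 10, 0]) (.br 2 11 (.br 4 11 (.det 11
    2 4) (.p7 [4, 5, 0, 1, 2, 11, 12])) (.br 3 11 (.br 4 11 (.p7 [10, 11, 4, 5, 8, 1, 2]) (.br 6
    11 (.c4 [6, 11, 3, 4]) (.p7 [6, 4, 5, 0, 10, 11, 12]))) (.c4 [3, 10, 11, 12]))))))) (.p7 [10,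
    3, 2, 7, 5, 8, 12]))) (.p7 [12, 9, 4, 6, 1, 0, 10])) (.tw 8 0 12))
  | 3 =>
    .br 0 13 (.br 3 13 (.c4 [3, 13, 0, 10]) (.br 0 11 (.br 0 12 (.gem [13, 12, 11, 10, 0]) (.c4
    [0, 11, 12, 13])) (.br 0 12 (.c4 [0, 12, 11, 10]) (.br 1 11 (.c4 [1, 11, 10, 0]) (.br 1 12
    (.c4 [1, 12, 13, 0]) (.br 5 11 (.c4 [5, 11, 10, 0]) (.br 5 12 (.c4 [5, 12, 13, 0]) (.br 2 11
    (.br 4 11 (.det 11 2 4) (.br 6 11 (.c4 [6, 11, 2, 1]) (.p7 [6, 4, 5, 0, 10, 11, 2]))) (.br 7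
    11 (.br 3 11 (.c4 [3, 11, 7, 2]) (.br 3 12 (.c4 [3, 12, 11, 10]) (.br 2 12 (.br 4 12 (.det 12
    2 4) (.c7 [4, 3, 2, 12, 13, 0, 5])) (.p7 [1, 2, 3, 10, 11, 12, 13])))) (.br 3 11 (.p7 [11, 3,
    2, 7, 5, 0, 13]) (.br 3 12 (.c4 [3, 12, 11, 10]) (.br 2 12 (.br 4 12 (.det 12 2 4) (.c7 [4, 3,
    2, 12, 13, 0, 5])) (.p7 [1, 2, 3, 10, 11, 12, 13]))))))))))))) (.br 0 8 (.br 9 10 (.br 8 10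
    (.c4 [8, 10, 9, 13]) (.br 3 13 (.br 3 11 (.br 3 12 (.gem [13, 12, 11, 10, 3]) (.c4 [3, 11, 12,
    13])) (.br 2 11 (.c4 [2, 11, 10, 3]) (.br 3 12 (.c4 [3, 12, 11, 10]) (.br 2 12 (.c4 [2, 12,
    13, 3]) (.br 4 11 (.c4 [4, 11, 10, 3]) (.br 4 12 (.c4 [4, 12, 13, 3]) (.br 1 11 (.br 5 11
    (.det 11 1 5) (.br 0 11 (.br 6 11 (.gem [6, 1, 0, 10, 11]) (.br 7 11 (.c4 [7, 11, 1, 2]) (.p7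
    [7, 5, 4, 6, 1, 11, 10]))) (.c4 [0, 1, 11, 10]))) (.br 6 11 (.br 0 11 (.c4 [0, 11, 6, 1]) (.br
    0 12 (.c4 [0, 12, 11, 10]) (.br 1 12 (.br 5 12 (.det 12 1 5) (.c7 [5, 0, 1, 12, 13, 3, 4]))
    (.p7 [0, 1, 2, 3, 13, 12, 11])))) (.br 0 11 (.p7 [11, 0, 1, 6, 4, 3, 13]) (.br 0 12 (.c4 [0,
    12, 11, 10]) (.br 1 12 (.br 5 12 (.det 12 1 5) (.c7 [5, 0, 1, 12, 13, 3, 4])) (.p7 [0, 1, 2,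
    3, 13, 12, 11])))))))))))) (.p7 [10, 3, 2, 7, 5, 8, 13]))) (.p7 [13, 9, 4, 6, 1, 0, 10])) (.tw
    8 0 13))
  | 4 =>
    .br 0 14 (.br 3 14 (.c4 [3, 14, 0, 10]) (.br 3 9 (.br 9 10 (.c4 [9, 10, 0, 14]) (.br 0 11 (.br
    2 11 (.det 11 0 2) (.br 3 11 (.det 11 0 3) (.br 3 12 (.c4 [3, 12, 11, 10]) (.br 4 11 (.det 11
    0 4) (.br 6 11 (.p7 [14, 0, 11, 6, 4, 3, 2]) (.br 9 11 (.det 11 0 9) (.br 1 11 (.p7 [6, 1, 11,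
    10, 3, 9, 14]) (.br 5 11 (.p7 [5, 11, 10, 3, 2, 1, 6]) (.br 0 12 (.br 0 13 (.gem [13, 12, 11,
    10, 0]) (.c4 [0, 12, 13, 14])) (.br 1 12 (.c4 [1, 12, 11, 0]) (.br 5 12 (.c4 [5, 12, 11, 0])
    (.br 2 12 (.br 4 12 (.det 12 2 4) (.c7 [4, 3, 2, 12, 11, 0, 5])) (.br 4 12 (.c7 [4, 12, 11, 0,
    1, 2, 3]) (.p7 [4, 3, 2, 1, 0, 11, 12])))))))))))))) (.br 0 12 (.c4 [0, 12, 11, 10]) (.br 1 11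
    (.c4 [1, 11, 10, 0]) (.br 5 11 (.c4 [5, 11, 10, 0]) (.br 0 13 (.br 2 13 (.det 13 0 2) (.br 3
    13 (.det 13 0 3) (.br 4 13 (.det 13 0 4) (.br 9 13 (.det 13 0 9) (.br 6 13 (.p7 [10, 0, 13, 6,
    4, 9, 2]) (.br 1 13 (.p7 [6, 1, 13, 14, 9, 3, 10]) (.br 1 12 (.c4 [1, 12, 13, 0]) (.br 5 13
    (.p7 [5, 13, 14, 9, 2, 1, 6]) (.br 5 12 (.c4 [5, 12, 13, 0]) (.br 9 12 (.c4 [9, 12, 13, 14])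
    (.br 2 12 (.br 4 12 (.det 12 2 4) (.c7 [4, 9, 2, 12, 13, 0, 5])) (.br 4 12 (.c7 [4, 12, 13, 0,
    1, 2, 9]) (.p7 [4, 9, 2, 1, 0, 13, 12]))))))))))))) (.br 1 13 (.c4 [1, 13, 14, 0]) (.br 1 12
    (.br 3 12 (.det 12 1 3) (.br 4 12 (.det 12 1 4) (.br 5 12 (.det 12 1 5) (.br 2 12 (.p7 [12, 2,
    3, 4, 5, 0, 14]) (.br 2 11 (.c4 [2, 11, 12, 1]) (.br 2 13 (.c4 [2, 13, 12, 1]) (.br 3 13 (.br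
    3 11 (.c4 [3, 11, 12, 13]) (.br 4 11 (.c4 [4, 11, 10, 3]) (.p7 [5, 4, 3, 10, 11, 12, 1])))
    (.p7 [2, 3, 10, 0, 14, 13, 12])))))))) (.br 2 12 (.br 4 12 (.det 12 2 4) (.br 5 12 (.det 12 2
    5) (.br 3 12 (.br 6 12 (.c4 [6, 12, 2, 1]) (.p7 [12, 3, 4, 6, 1, 0, 14])) (.p7 [12, 2, 3, 4,
    5, 0, 14])))) (.br 2 11 (.br 2 13 (.c4 [2, 13, 12, 11]) (.c7 [2, 11, 12, 13, 14, 0, 1])) (.br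
    2 13 (.c7 [2, 13, 12, 11, 10, 0, 1]) (.p7 [2, 1, 0, 14, 13, 12, 11])))))))))))) (.tw 9 3 14)))
    (.br 0 8 (.br 9 10 (.br 8 10 (.c4 [8, 10, 9, 14]) (.br 3 14 (.br 3 11 (.br 0 11 (.det 11 0 3)
    (.br 0 12 (.c4 [0, 12, 11, 10]) (.br 1 11 (.det 11 1 3) (.br 5 11 (.det 11 3 5) (.br 6 11 (.p7
    [14, 3, 11, 6, 1, 0, 5]) (.br 7 11 (.p7 [3, 11, 7, 5, 0, 1, 6]) (.br 8 11 (.det 11 3 8) (.br 2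
    11 (.p7 [7, 2, 11, 10, 0, 8, 14]) (.br 4 11 (.p7 [4, 11, 10, 0, 1, 2, 7]) (.br 3 12 (.br 3 13
    (.gem [13, 12, 11, 10, 3]) (.c4 [3, 12, 13, 14])) (.br 2 12 (.c4 [2, 12, 11, 3]) (.br 4 12
    (.c4 [4, 12, 11, 3]) (.br 1 12 (.br 5 12 (.det 12 1 5) (.c7 [5, 0, 1, 12, 11, 3, 4])) (.br 5
    12 (.c7 [5, 12, 11, 3, 2, 1, 0]) (.p7 [5, 0, 1, 2, 3, 11, 12]))))))))))))))) (.br 2 11 (.c4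
    [2, 11, 10, 3]) (.br 3 12 (.c4 [3, 12, 11, 10]) (.br 4 11 (.c4 [4, 11, 10, 3]) (.br 3 13 (.br
    0 13 (.det 13 0 3) (.br 1 13 (.det 13 1 3) (.br 5 13 (.det 13 3 5) (.br 8 13 (.det 13 3 8)
    (.br 6 13 (.p7 [10, 3, 13, 6, 1, 8, 5]) (.br 4 13 (.p7 [6, 4, 13, 14, 8, 0, 10]) (.br 2 13
    (.p7 [2, 13, 14, 8, 5, 4, 6]) (.br 2 12 (.c4 [2, 12, 13, 3]) (.br 4 12 (.c4 [4, 12, 13, 3])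
    (.br 8 12 (.c4 [8, 12, 13, 14]) (.br 1 12 (.br 5 12 (.det 12 1 5) (.c7 [5, 8, 1, 12, 13, 3,
    4])) (.br 5 12 (.c7 [5, 12, 13, 3, 2, 1, 8]) (.p7 [5, 8, 1, 2, 3, 13, 12]))))))))))))) (.br 2
    13 (.c4 [2, 13, 14, 3]) (.br 2 12 (.br 0 12 (.det 12 0 2) (.br 4 12 (.det 12 2 4) (.br 5 12
    (.det 12 2 5) (.br 1 12 (.p7 [12, 1, 0, 5, 4, 3, 14]) (.br 1 11 (.c4 [1, 11, 12, 2]) (.br 1 13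
    (.c4 [1, 13, 12, 2]) (.br 0 13 (.br 0 11 (.c4 [0, 11, 12, 13]) (.br 5 11 (.c4 [5, 11, 10, 0])
    (.p7 [4, 5, 0, 10, 11, 12, 2]))) (.p7 [1, 0, 10, 3, 14, 13, 12])))))))) (.br 1 12 (.br 4 12
    (.det 12 1 4) (.br 5 12 (.det 12 1 5) (.br 0 12 (.br 7 12 (.c4 [7, 12, 0, 5]) (.p7 [12, 0, 5,
    7, 2, 3, 14])) (.p7 [12, 1, 0, 5, 4, 3, 14])))) (.br 1 11 (.br 1 13 (.c4 [1, 13, 12, 11]) (.c7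
    [1, 11, 12, 13, 14, 3, 2])) (.br 1 13 (.c7 [1, 13, 12, 11, 10, 3, 2]) (.p7 [1, 2, 3, 14, 13,
    12, 11]))))))))))) (.p7 [10, 3, 2, 7, 5, 8, 14]))) (.p7 [14, 9, 4, 6, 1, 0, 10])) (.tw 8 0
    14))
  | 5 =>
    .br 0 15 (.br 3 15 (.c4 [3, 15, 0, 10]) (.br 3 9 (.br 9 10 (.c4 [9, 10, 0, 15]) (.br 0 11 (.br
    2 11 (.det 11 0 2) (.br 3 11 (.det 11 0 3) (.br 3 12 (.c4 [3, 12, 11, 10]) (.br 4 11 (.det 11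
    0 4) (.br 6 11 (.p7 [15, 0, 11, 6, 4, 3, 2]) (.br 9 11 (.det 11 0 9) (.br 1 11 (.p7 [6, 1, 11,
    10, 3, 9, 15]) (.br 1 12 (.br 0 12 (.gem [1, 12, 11, 10, 0]) (.c4 [0, 1, 12, 11])) (.br 2 12
    (.br 0 12 (.det 12 0 2) (.br 4 12 (.det 12 2 4) (.p7 [4, 3, 2, 12, 11, 0, 15]))) (.br 6 12
    (.c7 [6, 12, 11, 10, 3, 2, 1]) (.p7 [6, 1, 2, 3, 10, 11, 12]))))))))))) (.br 0 12 (.c4 [0, 12,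
    11, 10]) (.br 0 14 (.br 2 14 (.det 14 0 2) (.br 3 14 (.det 14 0 3) (.br 4 14 (.det 14 0 4)
    (.br 9 14 (.det 14 0 9) (.br 6 14 (.p7 [10, 0, 14, 6, 4, 9, 2]) (.br 1 14 (.p7 [6, 1, 14, 15,
    9, 3, 10]) (.br 9 13 (.c4 [9, 13, 14, 15]) (.br 1 13 (.br 0 13 (.gem [1, 13, 14, 15, 0]) (.c4
    [0, 1, 13, 14])) (.br 2 13 (.br 0 13 (.det 13 0 2) (.br 4 13 (.det 13 2 4) (.p7 [4, 9, 2, 13,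
    14, 0, 10]))) (.br 6 13 (.c7 [6, 13, 14, 15, 9, 2, 1]) (.p7 [6, 1, 2, 9, 15, 14,
    13]))))))))))) (.br 0 13 (.c4 [0, 13, 14, 15]) (.c7 [0, 15, 14, 13, 12, 11, 10])))))) (.tw 9 3
    15))) (.br 0 8 (.br 9 10 (.br 8 10 (.c4 [8, 10, 9, 15]) (.br 3 15 (.br 3 11 (.br 0 11 (.det 11
    0 3) (.br 0 12 (.c4 [0, 12, 11, 10]) (.br 1 11 (.det 11 1 3) (.br 5 11 (.det 11 3 5) (.br 6 11
    (.p7 [15, 3, 11, 6, 1, 0, 5]) (.br 7 11 (.p7 [3, 11, 7, 5, 0, 1, 6]) (.br 8 11 (.det 11 3 8)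
    (.br 2 11 (.p7 [7, 2, 11, 10, 0, 8, 15]) (.br 4 11 (.p7 [4, 11, 10, 0, 1, 2, 7]) (.br 2 12
    (.br 3 12 (.gem [2, 12, 11, 10, 3]) (.c4 [3, 2, 12, 11])) (.br 1 12 (.br 3 12 (.det 12 1 3)
    (.br 4 12 (.det 12 1 4) (.br 5 12 (.det 12 1 5) (.c7 [5, 0, 1, 12, 11, 3, 4])))) (.br 4 12
    (.p7 [4, 12, 11, 10, 0, 1, 2]) (.br 6 12 (.br 3 12 (.c4 [3, 12, 6, 4]) (.p7 [15, 3, 11, 12, 6,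
    1, 0])) (.p7 [4, 6, 1, 0, 10, 11, 12])))))))))))))) (.br 2 11 (.c4 [2, 11, 10, 3]) (.br 3 12
    (.c4 [3, 12, 11, 10]) (.br 3 14 (.br 0 14 (.det 14 0 3) (.br 1 14 (.det 14 1 3) (.br 5 14
    (.det 14 3 5) (.br 8 14 (.det 14 3 8) (.br 6 14 (.p7 [10, 3, 14, 6, 1, 8, 5]) (.br 4 14 (.p7
    [6, 4, 14, 15, 8, 0, 10]) (.br 2 14 (.p7 [2, 14, 15, 8, 5, 4, 6]) (.br 8 13 (.c4 [8, 13, 14,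
    15]) (.br 2 13 (.br 0 13 (.det 13 0 2) (.p7 [10, 0, 8, 15, 14, 13, 2])) (.br 1 13 (.br 3 13
    (.det 13 1 3) (.br 4 13 (.det 13 1 4) (.br 5 13 (.det 13 1 5) (.c7 [5, 8, 1, 13, 14, 3, 4]))))
    (.br 4 13 (.p7 [4, 13, 14, 15, 8, 1, 2]) (.br 6 13 (.br 0 13 (.c4 [0, 13, 6, 1]) (.p7 [0, 8,
    15, 14, 13, 6, 4])) (.p7 [4, 6, 1, 8, 15, 14, 13]))))))))))))) (.br 2 14 (.c4 [2, 14, 15, 3])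
    (.br 3 13 (.c4 [3, 13, 14, 15]) (.c7 [3, 15, 14, 13, 12, 11, 10]))))))) (.p7 [10, 3, 2, 7, 5,
    8, 15]))) (.p7 [15, 9, 4, 6, 1, 0, 10])) (.tw 8 0 15))
  | _ => .ng 0

/-- Refutations for paths between connectors of different parts. -/
def certConnConnOne : ℕ → Cert
  | 3 =>
    .br 0 8 (.br 2 8 (.det 8 0 2) (.br 3 8 (.det 8 0 3) (.br 3 9 (.c4 [3, 9, 8, 7]) (.br 4 8 (.det
    8 0 4) (.br 6 8 (.p7 [0, 8, 6, 2, 3, 4, 10]) (.br 1 8 (.br 5 8 (.det 8 1 5) (.p7 [4, 5, 6, 2,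
    1, 8, 7])) (.br 1 9 (.br 0 9 (.gem [8, 0, 1, 10, 9]) (.c4 [0, 1, 9, 8])) (.br 0 9 (.c4 [0, 9,
    10, 1]) (.br 2 9 (.c4 [2, 9, 10, 1]) (.c7 [2, 1, 10, 9, 8, 7, 3])))))))))) (.br 0 9 (.br 2 9
    (.det 9 0 2) (.br 1 9 (.br 3 9 (.det 9 0 3) (.br 4 9 (.det 9 0 4) (.br 6 9 (.c4 [6, 9, 1, 2])
    (.p7 [6, 2, 3, 4, 10, 9, 0])))) (.c4 [1, 0, 9, 10]))) (.br 1 8 (.c4 [1, 8, 7, 0]) (.br 5 8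
    (.c4 [5, 8, 7, 0]) (.br 2 8 (.br 4 8 (.det 8 2 4) (.p7 [5, 4, 10, 1, 2, 8, 7])) (.br 4 8 (.br
    3 8 (.br 6 8 (.c4 [6, 8, 3, 2]) (.p7 [6, 2, 1, 0, 7, 8, 4])) (.c4 [3, 4, 8, 7])) (.br 4 9 (.br
    1 9 (.det 9 1 4) (.br 2 9 (.det 9 2 4) (.p7 [2, 1, 0, 7, 8, 9, 4]))) (.br 3 9 (.c4 [3, 9, 10,
    4]) (.br 5 9 (.c4 [5, 9, 10, 4]) (.c7 [5, 4, 10, 9, 8, 7, 0])))))))))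
  | 4 =>
    .br 0 8 (.br 2 8 (.det 8 0 2) (.br 3 8 (.det 8 0 3) (.br 3 9 (.c4 [3, 9, 8, 7]) (.br 4 8 (.det
    8 0 4) (.br 6 8 (.p7 [0, 8, 6, 2, 3, 4, 11]) (.br 1 8 (.br 5 8 (.det 8 1 5) (.p7 [4, 5, 6, 2,
    1, 8, 7])) (.br 4 9 (.br 0 9 (.det 9 0 4) (.br 1 9 (.det 9 1 4) (.br 2 9 (.det 9 2 4) (.c7 [2,
    3, 4, 9, 8, 0, 1])))) (.br 1 9 (.c7 [1, 9, 8, 7, 3, 4, 11]) (.p7 [1, 11, 4, 3, 7, 8,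
    9]))))))))) (.br 0 9 (.br 2 9 (.det 9 0 2) (.br 3 9 (.det 9 0 3) (.br 4 9 (.det 9 0 4) (.br 6
    9 (.p7 [6, 9, 0, 7, 3, 4, 11]) (.br 4 10 (.br 0 10 (.det 10 0 4) (.br 1 10 (.det 10 1 4) (.br
    1 9 (.c4 [1, 9, 10, 11]) (.br 2 10 (.det 10 2 4) (.br 3 10 (.br 3 8 (.c4 [3, 8, 9, 10]) (.br 2
    8 (.c4 [2, 8, 7, 3]) (.br 1 8 (.br 4 8 (.det 8 1 4) (.br 5 8 (.det 8 1 5) (.br 5 9 (.c7 [5, 9,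
    8, 1, 2, 3, 4]) (.p7 [5, 4, 3, 2, 1, 8, 9])))) (.p7 [11, 1, 2, 3, 7, 8, 9])))) (.c7 [3, 4, 10,
    9, 0, 1, 2])))))) (.br 3 10 (.c4 [3, 10, 11, 4]) (.br 0 10 (.br 1 8 (.c4 [1, 8, 7, 0]) (.br 2
    10 (.det 10 0 2) (.br 1 10 (.br 1 9 (.br 2 8 (.c4 [2, 8, 9, 1]) (.br 3 8 (.br 5 8 (.det 8 3 5)
    (.br 5 9 (.det 9 1 5) (.br 6 8 (.c4 [6, 8, 3, 2]) (.c7 [6, 2, 3, 8, 9, 0, 5])))) (.p7 [2, 3,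
    7, 8, 9, 10, 11]))) (.gem [11, 1, 0, 9, 10])) (.c4 [1, 0, 10, 11])))) (.c7 [0, 9, 10, 11, 4,
    3, 7])))))))) (.br 1 8 (.c4 [1, 8, 7, 0]) (.br 5 8 (.c4 [5, 8, 7, 0]) (.br 2 8 (.br 4 8 (.det
    8 2 4) (.p7 [5, 4, 11, 1, 2, 8, 7])) (.br 4 8 (.br 3 8 (.br 6 8 (.c4 [6, 8, 3, 2]) (.p7 [6, 2,
    1, 0, 7, 8, 4])) (.c4 [3, 4, 8, 7])) (.br 1 9 (.br 3 9 (.det 9 1 3) (.br 4 9 (.det 9 1 4) (.br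
    3 8 (.br 5 9 (.det 9 1 5) (.c7 [5, 0, 1, 9, 8, 3, 4])) (.c7 [3, 7, 8, 9, 1, 11, 4])))) (.br 4
    9 (.c7 [4, 9, 8, 7, 0, 1, 11]) (.p7 [4, 11, 1, 0, 7, 8, 9]))))))))
  | 5 =>
    .br 0 8 (.br 2 8 (.det 8 0 2) (.br 3 8 (.det 8 0 3) (.br 3 9 (.c4 [3, 9, 8, 7]) (.br 4 8 (.det
    8 0 4) (.br 6 8 (.p7 [0, 8, 6, 2, 3, 4, 12]) (.br 1 8 (.br 5 8 (.det 8 1 5) (.p7 [4, 5, 6, 2,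
    1, 8, 7])) (.br 4 9 (.br 0 9 (.det 9 0 4) (.br 1 9 (.det 9 1 4) (.br 2 9 (.det 9 2 4) (.c7 [2,
    3, 4, 9, 8, 0, 1])))) (.br 1 9 (.c7 [1, 9, 8, 7, 3, 4, 12]) (.p7 [1, 12, 4, 3, 7, 8,
    9]))))))))) (.br 0 9 (.br 2 9 (.det 9 0 2) (.br 3 9 (.det 9 0 3) (.br 4 9 (.det 9 0 4) (.br 0
    10 (.br 1 8 (.c4 [1, 8, 7, 0]) (.br 3 10 (.det 10 0 3) (.br 4 10 (.det 10 0 4) (.br 4 11 (.br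
    0 11 (.det 11 0 4) (.br 1 11 (.det 11 1 4) (.br 1 10 (.c4 [1, 10, 11, 12]) (.br 1 9 (.p7 [10,
    9, 1, 12, 4, 3, 7]) (.p7 [1, 12, 11, 10, 9, 8, 7]))))) (.br 3 11 (.c4 [3, 11, 12, 4]) (.p7 [7,
    3, 4, 12, 11, 10, 9])))))) (.br 0 11 (.c4 [0, 11, 10, 9]) (.br 1 11 (.br 3 11 (.det 11 1 3)
    (.br 3 10 (.br 1 10 (.det 10 1 3) (.br 1 9 (.c4 [1, 9, 10, 11]) (.br 4 10 (.br 4 11 (.det 11 1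
    4) (.c4 [4, 10, 11, 12])) (.c7 [4, 3, 10, 9, 0, 1, 12])))) (.p7 [3, 7, 0, 9, 10, 11, 12])))
    (.br 1 10 (.c4 [1, 10, 11, 12]) (.br 1 8 (.br 3 8 (.det 8 1 3) (.br 2 8 (.c4 [2, 8, 7, 3])
    (.br 4 8 (.det 8 1 4) (.br 5 8 (.det 8 1 5) (.br 1 9 (.br 5 9 (.det 9 1 5) (.p7 [8, 9, 0, 5,
    4, 3, 2])) (.c4 [1, 0, 9, 8])))))) (.p7 [8, 7, 0, 1, 12, 11, 10]))))))))) (.br 1 8 (.c4 [1, 8,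
    7, 0]) (.br 5 8 (.c4 [5, 8, 7, 0]) (.br 2 8 (.br 4 8 (.det 8 2 4) (.p7 [5, 4, 12, 1, 2, 8,
    7])) (.br 4 8 (.br 3 8 (.br 6 8 (.c4 [6, 8, 3, 2]) (.p7 [6, 2, 1, 0, 7, 8, 4])) (.c4 [3, 4, 8,
    7])) (.br 1 9 (.br 3 9 (.det 9 1 3) (.br 4 9 (.det 9 1 4) (.br 3 8 (.br 5 9 (.det 9 1 5) (.c7
    [5, 0, 1, 9, 8, 3, 4])) (.c7 [3, 7, 8, 9, 1, 12, 4])))) (.br 4 9 (.c7 [4, 9, 8, 7, 0, 1, 12])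
    (.p7 [4, 12, 1, 0, 7, 8, 9]))))))))
  | _ => .ng 0


section

variable {V : Type*} {G : SimpleGraph V} (hG : ExcludedFree G) {A : Fin 6 → Set V}
  (hA : HexFrame G A) (hZ : ∀ p, (connectors G A p).Nonempty) {p : ℕ → V} {n : ℕ}
  (hp : IsChordlessPath G p n) (hn : 2 ≤ n)
  (hi : ∀ i, 0 < i → i < n → IsDetached G hexagon A (p i))

include hG hA hZ hp hn hi

/-- The hexagon is assembled from neighbours of one connector of each kind. Each connector then sees
exactly its opposite pair on it, so the static vertices induce a Petersen graph minus a vertex. The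
ends of the path may or may not belong to this hexagon. -/
theorem no_path_part_part_two (h₀ : p 0 ∈ A 0) (h₁ : p n ∈ A 2) : False := by
  obtain ⟨x, hx, ⟨a, ha, hxa⟩, b, hb, hxb⟩ := hZ 0
  obtain ⟨y, hy, ⟨c, hc, hyc⟩, d, hd, hyd⟩ := hZ 1
  obtain ⟨z, hz, ⟨e, he, hze⟩, f, hf, hzf⟩ := hZ 2
  exact refute_path hG (hA.sound_near hG)
    (cols := hexCols [.conn 0, .conn 1, .conn 2])
    (lits := [(6, 0, true), (6, 3, true), (7, 1, true), (7, 4, true), (8, 2, true), (8, 5, true)])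
    (c₀ := .mem 0) (ci := .det) (c₁ := .mem 2) (xs := []) (ys := []) (m := 2)
    certPartPartTwo (by decide +kernel) (by decide) hp hn (by omega)
    [a, c, e, b, d, f, x, y, z] rfl
    ⟨ha, hc, he, hb, hd, hf, ⟨hx, ⟨a, ha, hxa⟩, b, hb, hxb⟩, ⟨hy, ⟨c, hc, hyc⟩, d, hd, hyd⟩,
      ⟨hz, ⟨e, he, hze⟩, f, hf, hzf⟩, trivial⟩
    ⟨hxa, hxb, hyc, hyd, hze, hzf, trivial⟩ h₀ hi h₁ trivial trivial

theorem no_path_part_part_three (h₀ : p 0 ∈ A 0) (h₁ : p n ∈ A 3) : False := by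
  obtain ⟨x, hx, ⟨a, ha, hxa⟩, b, hb, hxb⟩ := hZ 0
  obtain ⟨y, hy, ⟨c, hc, hyc⟩, d, hd, hyd⟩ := hZ 1
  obtain ⟨z, hz, ⟨e, he, hze⟩, f, hf, hzf⟩ := hZ 2
  exact refute_path hG (hA.sound_near hG)
    (cols := hexCols [.conn 0, .conn 1, .conn 2])
    (lits := [(6, 0, true), (6, 3, true), (7, 1, true), (7, 4, true), (8, 2, true), (8, 5, true)])
    (c₀ := .mem 0) (ci := .det) (c₁ := .mem 3) (xs := []) (ys := []) (m := 2)
    certPartPartThree (by decide +kernel) (by decide) hp hn (by omega)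
    [a, c, e, b, d, f, x, y, z] rfl
    ⟨ha, hc, he, hb, hd, hf, ⟨hx, ⟨a, ha, hxa⟩, b, hb, hxb⟩, ⟨hy, ⟨c, hc, hyc⟩, d, hd, hyd⟩,
      ⟨hz, ⟨e, he, hze⟩, f, hf, hzf⟩, trivial⟩
    ⟨hxa, hxb, hyc, hyd, hze, hzf, trivial⟩ h₀ hi h₁ trivial trivial

/-- The end `p n` itself serves as the connector of kind `0`; its chosen neighbour in `A 0` may
differ from `p 0`. -/
theorem no_path_part_conn_zero (h₀ : p 0 ∈ A 0) (h₁ : p n ∈ connectors G A 0) : False := by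
  obtain ⟨-, ⟨a, ha, hxa⟩, b, hb, hxb⟩ := id h₁
  obtain ⟨y, hy, ⟨c, hc, hyc⟩, d, hd, hyd⟩ := hZ 1
  obtain ⟨z, hz, ⟨e, he, hze⟩, f, hf, hzf⟩ := hZ 2
  exact refute_path hG (hA.sound_near hG)
    (cols := hexCols [.conn 1, .conn 2])
    (lits := [(6, 1, true), (6, 4, true), (7, 2, true), (7, 5, true)])
    (c₀ := .mem 0) (ci := .det) (c₁ := .conn 0) (xs := []) (ys := [(0, true), (3, true)]) (m := 2)
    certPartConnZero (by decide +kernel) (by decide) hp hn (by omega)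
    [a, c, e, b, d, f, y, z] rfl
    ⟨ha, hc, he, hb, hd, hf, ⟨hy, ⟨c, hc, hyc⟩, d, hd, hyd⟩,
      ⟨hz, ⟨e, he, hze⟩, f, hf, hzf⟩, trivial⟩
    ⟨hyc, hyd, hze, hzf, trivial⟩ h₀ hi h₁ trivial ⟨hxa, hxb, trivial⟩

theorem no_path_part_conn_one (h₀ : p 0 ∈ A 0) (h₁ : p n ∈ connectors G A 1) : False := by
  obtain ⟨x, hx, ⟨a, ha, hxa⟩, b, hb, hxb⟩ := hZ 0
  obtain ⟨-, ⟨c, hc, hyc⟩, d, hd, hyd⟩ := id h₁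
  obtain ⟨z, hz, ⟨e, he, hze⟩, f, hf, hzf⟩ := hZ 2
  exact refute_path hG (hA.sound_near hG)
    (cols := hexCols [.conn 0, .conn 2])
    (lits := [(6, 0, true), (6, 3, true), (7, 2, true), (7, 5, true)])
    (c₀ := .mem 0) (ci := .det) (c₁ := .conn 1) (xs := []) (ys := [(1, true), (4, true)]) (m := 2)
    certPartConnOne (by decide +kernel) (by decide) hp hn (by omega)
    [a, c, e, b, d, f, x, z] rfl
    ⟨ha, hc, he, hb, hd, hf, ⟨hx, ⟨a, ha, hxa⟩, b, hb, hxb⟩,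
      ⟨hz, ⟨e, he, hze⟩, f, hf, hzf⟩, trivial⟩
    ⟨hxa, hxb, hze, hzf, trivial⟩ h₀ hi h₁ trivial ⟨hyc, hyd, trivial⟩

/-- Connectors of one kind may attach at different vertices of `A 0` and `A 3`; hence the two extra
static vertices `a'` and `b'`. -/
theorem no_path_conn_conn_zero (h₀ : p 0 ∈ connectors G A 0) (h₁ : p n ∈ connectors G A 0) :
    False := by
  obtain ⟨-, ⟨a, ha, hxa⟩, b, hb, hxb⟩ := id h₀
  obtain ⟨-, ⟨a', ha', hxa'⟩, b', hb', hxb'⟩ := id h₁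
  obtain ⟨y, hy, ⟨c, hc, hyc⟩, d, hd, hyd⟩ := hZ 1
  obtain ⟨z, hz, ⟨e, he, hze⟩, f, hf, hzf⟩ := hZ 2
  exact refute_path hG (hA.sound_near hG)
    (cols := hexCols [.conn 1, .conn 2, .mem 0, .mem 3])
    (lits := [(6, 1, true), (6, 4, true), (7, 2, true), (7, 5, true)])
    (c₀ := .conn 0) (ci := .det) (c₁ := .conn 0) (xs := [(0, true), (3, true)])
    (ys := [(8, true), (9, true)]) (m := 2)
    certConnConnZero (by decide +kernel) (by decide) hp hn (by omega)
    [a, c, e, b, d, f, y, z, a', b'] rfl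
    ⟨ha, hc, he, hb, hd, hf, ⟨hy, ⟨c, hc, hyc⟩, d, hd, hyd⟩,
      ⟨hz, ⟨e, he, hze⟩, f, hf, hzf⟩, ha', hb', trivial⟩
    ⟨hyc, hyd, hze, hzf, trivial⟩ h₀ hi h₁ ⟨hxa, hxb, trivial⟩ ⟨hxa', hxb', trivial⟩

/-- Three or more edges are refuted. With two edges, the inner vertex is forced to miss the hexagon
and to see the third connector as well, and so it is the tenth vertex of a Petersen graph. -/
theorem hasPetersen_of_path_conn_conn_one (h₀ : p 0 ∈ connectors G A 0)
    (h₁ : p n ∈ connectors G A 1) : HasPetersen G := by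
  obtain ⟨-, ⟨a, ha, hxa⟩, b, hb, hxb⟩ := id h₀
  obtain ⟨-, ⟨c, hc, hyc⟩, d, hd, hyd⟩ := id h₁
  obtain ⟨z, hz, ⟨e, he, hze⟩, f, hf, hzf⟩ := hZ 2
  rcases hn.lt_or_eq with hn | rfl
  · exact (refute_path hG (hA.sound_near hG)
      (cols := hexCols [.conn 2])
      (lits := [(6, 2, true), (6, 5, true)])
      (c₀ := .conn 0) (ci := .det) (c₁ := .conn 1) (xs := [(0, true), (3, true)])
      (ys := [(1, true), (4, true)]) (m := 3)
      certConnConnOne (by decide +kernel) (by decide) hp hn (by omega)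
      [a, c, e, b, d, f, z] rfl
      ⟨ha, hc, he, hb, hd, hf, ⟨hz, ⟨e, he, hze⟩, f, hf, hzf⟩, trivial⟩
      ⟨hze, hzf, trivial⟩ h₀ hi h₁ ⟨hxa, hxb, trivial⟩ ⟨hyc, hyd, trivial⟩).elim
  · by_contra hP
    have h10 : G.Adj (p 1) (p 0) := ((hp.adj_iff 0 1 one_pos (by omega)).2 rfl).symm
    have h12 : G.Adj (p 1) (p 2) := (hp.adj_iff 1 2 (by omega) le_rfl).2 rfl
    have hcols : ColsHold (colSet G hexagon A (connectors G A))
        [a, c, e, b, d, f, p 0, p 2, z, p 1] (hexCols [.conn 0, .conn 1, .conn 2, .det]) :=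
      ⟨ha, hc, he, hb, hd, hf, h₀, h₁, ⟨hz, ⟨e, he, hze⟩, f, hf, hzf⟩, hi 1 one_pos one_lt_two,
        trivial⟩
    refine refute hG (hA.sound_near hG)
      ⟨hexCols [.conn 0, .conn 1, .conn 2, .det], [(6, 0, true), (6, 3, true), (7, 1, true),
        (7, 4, true), (8, 2, true), (8, 5, true), (9, 6, true), (9, 7, true)], [],
        [[(9, 0, false), (9, 1, false), (9, 2, false), (9, 3, false), (9, 4, false),
          (9, 5, false), (9, 8, true)]]⟩
      a [c, e, b, d, f, p 0, p 2, z, p 1]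
      (.br 0 9 (.br 1 9 (.gem [7, 1, 0, 6, 9]) (.c4 [1, 0, 9, 7])) (.br 1 9 (.c4 [1, 9, 6, 0])
        (.br 2 9 (.c4 [2, 9, 7, 1]) (.br 5 9 (.c4 [5, 9, 6, 0]) (.br 8 9 (.br 3 9
        (.c4 [3, 9, 8, 2]) (.br 4 9 (.c4 [4, 9, 6, 3]) (.ng 0))) (.p7 [2, 8, 5, 0, 6, 9, 7]))))))
      (by decide +kernel) hcols ⟨hxa, hxb, hyc, hyd, hze, hzf, h10, h12, trivial⟩ trivial
      ⟨?_, trivial⟩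
    -- The only pattern that the certificate leaves open; it fixes all adjacencies among the ten
    -- vertices.
    rintro ⟨n0, n1, n2, n3, n4, n5, h18, -⟩
    refine hP (hasPetersen_of_labels
      (u := fun i => [a, c, e, b, d, f, p 0, p 2, z, p 1].getD i a) ?_)
    refine Config.Holds.adj_iff (v := fun i => [a, c, e, b, d, f, p 0, p 2, z, p 1].getD i a)
      (K := ⟨hexCols [.conn 0, .conn 1, .conn 2, .det], [(6, 0, true), (6, 3, true), (7, 1, true),
        (7, 4, true), (8, 2, true), (8, 5, true), (9, 6, true), (9, 7, true), (9, 0, false),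
        (9, 1, false), (9, 2, false), (9, 3, false), (9, 4, false), (9, 5, false), (9, 8, true)],
        [], []⟩) (S := colSet G hexagon A (connectors G A))
      ⟨fun _ _ h => hcols.mem _ _ h, litsHold_iff.1 ?_, by simp, by simp⟩ (hA.sound_near hG)
      (by decide +kernel)
    exact ⟨hxa, hxb, hyc, hyd, hze, hzf, h10, h12, n0, n1, n2, n3, n4, n5, h18, trivial⟩

end

/-- Kinds matter only up to antipodes, so two kinds are either equal or represented by adjacent
positions. -/
theorem exists_hexSymm_connectors {V : Type*} (G : SimpleGraph V) (A : Fin 6 → Set V)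
    (p q : Fin 6) : ∃ e : hexagon ≃g hexagon, IsHexSymm e ∧ e 0 = p ∧
      (connectors G A q = connectors G A (e 0) ∨ connectors G A q = connectors G A (e 1)) := by
  have key : ∀ p q : Fin 6, (p + 0 = q ∨ p + 0 = q + 3 ∨ p + 1 = q ∨ p + 1 = q + 3) ∨
    (p - 1 = q ∨ p - 1 = q + 3) := by decide
  have h3 := connectors_add_three (G := G) (A := A) q
  rcases key p q with h | h
  · refine ⟨hexRotate p, isHexSymm_rotate p, add_zero p, ?_⟩
    simp only [hexRotate_apply]
    rcases h with h | h | h | h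
    · exact Or.inl (h ▸ rfl)
    · exact Or.inl (h ▸ h3.symm)
    · exact Or.inr (h ▸ rfl)
    · exact Or.inr (h ▸ h3.symm)
  · refine ⟨hexReflect p, isHexSymm_reflect p, sub_zero p, Or.inr ?_⟩
    simp only [hexReflect_apply]
    rcases h with h | h
    · exact h ▸ rfl
    · exact h ▸ h3.symm

section

variable {V : Type*} {G : SimpleGraph V} (hG : ExcludedFree G) {A : Fin 6 → Set V}
  (hA : HexFrame G A) (hZ : ∀ p, (connectors G A p).Nonempty) {p : ℕ → V} {n : ℕ}
  (hp : IsChordlessPath G p n) (hn : 2 ≤ n)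
  (hi : ∀ i, 0 < i → i < n → (∀ q, p i ∉ A q) ∧ ∀ q, p i ∉ connectors G A q)

include hG hA hZ hp hn hi

omit hG hp hn in
theorem hexFrame_comp_path {e : hexagon ≃g hexagon} (he : IsHexSymm e) :
    HexFrame G (fun q => A (e q)) ∧ (∀ q, (connectors G (fun q => A (e q)) q).Nonempty) ∧
      ∀ i, 0 < i → i < n → IsDetached G hexagon (fun q => A (e q)) (p i) := by
  refine ⟨hA.comp he, fun q => connectors_comp (G := G) he q ▸ hZ _, fun i h1 h2 => ?_⟩
  refine (hA.comp he).isDetached (fun q => (hi i h1 h2).1 _) fun q => ?_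
  rw [connectors_comp he]
  exact (hi i h1 h2).2 _

theorem no_path_part_part {a b : Fin 6} (h₀ : p 0 ∈ A a) (h₁ : p n ∈ A b) : False := by
  obtain ⟨e, he, rfl, h⟩ := exists_hexSymm a b
  obtain ⟨hA', hZ', hi'⟩ := hexFrame_comp_path hA hZ hi he
  have hna : ¬ G.Adj (p 0) (p n) := by
    rw [hp.adj_iff 0 n (by omega) le_rfl]
    omega
  rcases h with rfl | rfl | rfl | rfl
  · rcases hA.clique _ _ h₀ _ h₁ with h | h
    exacts [hp.ends_ne h, hna h]
  · exact hna ((hA'.adj_iff 0 1 (by decide) _ h₀ _ h₁).2 (by decide))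
  · exact no_path_part_part_two hG hA' hZ' hp hn hi' h₀ h₁
  · exact no_path_part_part_three hG hA' hZ' hp hn hi' h₀ h₁

theorem no_path_part_conn {a b : Fin 6} (h₀ : p 0 ∈ A a) (h₁ : p n ∈ connectors G A b) :
    False := by
  obtain ⟨e, he, rfl, h⟩ := exists_hexSymm_connectors G A a b
  obtain ⟨hA', hZ', hi'⟩ := hexFrame_comp_path hA hZ hi he
  rcases h with h | h <;> rw [h, ← connectors_comp he] at h₁
  · exact no_path_part_conn_zero hG hA' hZ' hp hn hi' h₀ h₁
  · exact no_path_part_conn_one hG hA' hZ' hp hn hi' h₀ h₁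

theorem hasPetersen_of_path_conn_conn {a b : Fin 6} (h₀ : p 0 ∈ connectors G A a)
    (h₁ : p n ∈ connectors G A b) : HasPetersen G := by
  obtain ⟨e, he, rfl, h⟩ := exists_hexSymm_connectors G A a b
  obtain ⟨hA', hZ', hi'⟩ := hexFrame_comp_path hA hZ hi he
  rw [← connectors_comp he] at h₀
  rcases h with h | h <;> rw [h, ← connectors_comp he] at h₁
  · exact (no_path_conn_conn_zero hG hA' hZ' hp hn hi' h₀ h₁).elim
  · exact hasPetersen_of_path_conn_conn_one hG hA' hZ' hp hn hi' h₀ h₁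

end

/-! ### Bisimplicial connectors -/

/-- Around a hexagon with connectors of all kinds, there is either an induced Petersen graph or
no further vertex. -/
theorem HexFrame.cover {V : Type*} [Finite V] {G : SimpleGraph V} (hconn : G.Connected)
    (hcut : ∀ K, ¬ IsCliqueCutset G K) (hG : ExcludedFree G) {A : Fin 6 → Set V}
    (hA : HexFrame G A) (hZ : ∀ p, (connectors G A p).Nonempty) (hP : ¬ HasPetersen G) (d : V) :
    (∃ p, d ∈ A p) ∨ ∃ p, d ∈ connectors G A p := by
  set B : Set V := {d | (∃ p, d ∈ A p) ∨ ∃ p, d ∈ connectors G A p} with hB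
  by_contra hd
  have hBc : ¬ G.IsClique B := by
    obtain ⟨x, hx⟩ := hA.nonempty 0
    obtain ⟨y, hy⟩ := hA.nonempty 2
    have hna : ¬ G.Adj x y := fun h =>
      absurd ((hA.adj_iff 0 2 (by decide) x hx y hy).1 h) (by decide)
    obtain ⟨w, hw⟩ := hA.nonempty 5
    have hxw : G.Adj x w := (hA.adj_iff 0 5 (by decide) x hx w hw).2 (by decide)
    have hyw : ¬ G.Adj y w := fun h =>
      absurd ((hA.adj_iff 2 5 (by decide) y hy w hw).1 h) (by decide)
    exact fun h => hna (h (Or.inl ⟨0, hx⟩) (Or.inl ⟨2, hy⟩) fun e => hyw (e ▸ hxw))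
  obtain ⟨p, n, hp, hn, h₀, h₁, hi⟩ :=
    exists_chordlessPath_through hconn hcut hBc (d := d) hd
  have hi' : ∀ i, 0 < i → i < n → (∀ q, p i ∉ A q) ∧ ∀ q, p i ∉ connectors G A q := by
    intro i h1 h2
    have h := notMem_of_mem_reachAvoiding (B := B) hd (hi i h1 h2)
    exact ⟨fun q hq => h (Or.inl ⟨q, hq⟩), fun q hq => h (Or.inr ⟨q, hq⟩)⟩
  rcases h₀ with ⟨a, h₀⟩ | ⟨a, h₀⟩ <;> rcases h₁ with ⟨b, h₁⟩ | ⟨b, h₁⟩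
  · exact no_path_part_part hG hA hZ hp hn hi' h₀ h₁
  · exact no_path_part_conn hG hA hZ hp hn hi' h₀ h₁
  · refine no_path_part_conn hG hA hZ hp.reverse hn (fun i h1 h2 => hi' _ ?_ ?_)
      (by simpa using h₁) (by simpa using h₀)
    · omega
    · omega
  · exact hP (hasPetersen_of_path_conn_conn hG hA hZ hp hn hi' h₀ h₁)

/-- By symmetry `x ∈ A 0`. If `w` misses `x`, take its neighbour `c` in `A 0`, which is adjacent to
`x`. Either `z` misses `c` and `c, x, z, w` is a `C_4`, or `w, z, x` and a vertex of `A 1` form a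
path complete to `c`, a gem. -/
theorem adj_of_adj_connectors {V : Type*} {G : SimpleGraph V} (hG : ExcludedFree G)
    {A : Fin 6 → Set V} (hA : HexFrame G A) {z w x : V} (hz : z ∈ connectors G A 0)
    (hw : w ∈ connectors G A 0) (hzw : G.Adj z w) (hx : x ∈ A 0 ∪ A 3) (hzx : G.Adj z x) :
    G.Adj w x := by
  wlog hx0 : x ∈ A 0 generalizing A
  · have h3 : connectors G (fun p => A (hexRotate 3 p)) 0 = connectors G A 0 := by
      rw [connectors_comp (isHexSymm_rotate 3)]
      exact connectors_add_three 0
    exact this (A := fun p => A (hexRotate 3 p)) (hA.comp (isHexSymm_rotate 3)) (by rwa [h3])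
      (by rwa [h3]) (Or.inl (hx.resolve_left hx0)) (hx.resolve_left hx0)
  by_contra hwx
  obtain ⟨-, -, b, hb, hzb⟩ := id hz
  obtain ⟨-, ⟨c, hc, hwc⟩, d, hd, hwd⟩ := id hw
  obtain ⟨a1, h1⟩ := hA.nonempty 1
  obtain ⟨a2, h2⟩ := hA.nonempty 2
  obtain ⟨a4, h4⟩ := hA.nonempty 4
  obtain ⟨a5, h5⟩ := hA.nonempty 5
  exact refute hG (hA.sound_near hG)
    ⟨hexCols [.mem 0, .mem 3, .conn 0, .conn 0], [(8, 0, true), (8, 3, true), (9, 6, true),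
      (9, 7, true), (8, 9, true), (9, 0, false)], [], []⟩
    x [a1, a2, b, a4, a5, c, d, z, w]
    (.br 0 6 (.br 6 8 (.gem [9, 8, 0, 1, 6]) (.c4 [6, 0, 8, 9])) (.tw 6 0 9))
    (by decide +kernel) ⟨hx0, h1, h2, hb, h4, h5, hc, hd, hz, hw, trivial⟩
    ⟨hzx, hzb, hwc, hwd, hzw, hwx, trivial⟩ trivial trivial

/-- If there are no vertices outside the parts and the connectors, connectors are
bisimplicial. -/
theorem HexFrame.isBisimplicial {V : Type*} {G : SimpleGraph V} (hG : ExcludedFree G)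
    {A : Fin 6 → Set V} (hA : HexFrame G A)
    (hcov : ∀ d, (∃ p, d ∈ A p) ∨ ∃ p, d ∈ connectors G A p) {z : V}
    (hz : z ∈ connectors G A 0) : IsBisimplicial G z := by
  obtain ⟨hzA, ⟨a, ha, hza⟩, b, hb, hzb⟩ := id hz
  have hab : ¬ G.Adj a b := fun h =>
    absurd ((hA.adj_iff 0 3 (by decide) a ha b hb).1 h) (by decide)
  have hne : a ≠ b := by
    rintro rfl
    obtain ⟨c, hc⟩ := hA.nonempty 1
    have h := (hA.adj_iff 0 1 (by decide) a ha c hc).2 (by decide)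
    exact absurd ((hA.adj_iff (0 + 3) 1 (by decide) a hb c hc).1 h) (by decide)
  -- All neighbours of `z` lie in `A 0`, in `A 3` or among the connectors of the same kind.
  -- Neighbouring connectors share the neighbours of `z` in the parts, so they can join either side;
  -- here they join `A 0`.
  refine ⟨{x | G.Adj z x ∧ (x ∈ A 0 ∨ x ∈ connectors G A 0)}, {x | G.Adj z x ∧ x ∈ A 3},
    ?_, ?_, ?_⟩
  · rintro x ⟨hzx, hx⟩ y ⟨hzy, hy⟩ hxy
    rcases hx with hx | hx <;> rcases hy with hy | hy
    · exact (hA.clique 0 x hx y hy).resolve_left hxy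
    · exact (adj_of_adj_connectors hG hA hz hy hzy (Or.inl hx) hzx).symm
    · exact adj_of_adj_connectors hG hA hz hx hzx (Or.inl hy) hzy
    -- Both connectors see `a` and `b`, which are nonadjacent, so `x, a, y, b` forces the edge `xy`.
    · have h1 := adj_of_adj_connectors hG hA hz hx hzx (Or.inl ha) hza
      have h2 := adj_of_adj_connectors hG hA hz hx hzx (Or.inr hb) hzb
      have h3 := adj_of_adj_connectors hG hA hz hy hzy (Or.inl ha) hza
      have h4 := adj_of_adj_connectors hG hA hz hy hzy (Or.inr hb) hzb
      exact (no_c4 hG h1 h3.symm h4 h2.symm hxy hne).resolve_right hab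
  · rintro x ⟨-, hx⟩ y ⟨-, hy⟩ hxy
    exact (hA.clique 3 x hx y hy).resolve_left hxy
  · ext x
    refine ⟨fun hzx => ?_, fun h => h.elim (·.1) (·.1)⟩
    rw [mem_neighborSet] at hzx
    have key : ∀ p, hexNear 0 p = true → p = 0 ∨ p = 3 := by decide
    rcases hcov x with ⟨p, hx⟩ | ⟨p, hx⟩ <;> by_cases hp : hexNear 0 p = true
    · rcases key p hp with rfl | rfl
      · exact Or.inl ⟨hzx, Or.inl hx⟩
      · exact Or.inr ⟨hzx, hx⟩
    · exact absurd hzx (not_adj_connector_part hA (by simpa using hp) hz hx)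
    · rcases key p hp with rfl | rfl
      · exact Or.inl ⟨hzx, Or.inr hx⟩
      · exact Or.inl ⟨hzx, Or.inr (connectors_add_three (G := G) (A := A) 0 ▸ hx)⟩
    · exact absurd hzx (not_adj_connector_connector hG hA (by simpa using hp) hz hx)

/-! ### Graphs containing an induced Petersen graph -/

/-- The vertex type of the Petersen graph. -/
abbrev PetersenVertex : Type := {s : Finset (Fin 5) // s.card = 2}

/-- The automorphism of the Petersen graph given by a permutation of the five elements. -/
def petersenIso (σ : Equiv.Perm (Fin 5)) : petersen ≃g petersen where
  toFun s := ⟨s.1.map σ.toEmbedding, by rw [Finset.card_map, s.2]⟩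
  invFun s := ⟨s.1.map σ.symm.toEmbedding, by rw [Finset.card_map, s.2]⟩
  left_inv s := by
    ext x
    simp
  right_inv s := by
    ext x
    simp
  map_rel_iff' {s t} := Finset.disjoint_map _

theorem exists_petersenIso_zero (p : PetersenVertex) :
    ∃ σ, petersenIso σ (petersenLabel 0) = p := by
  revert p
  decide +kernel

/-- The stabiliser of a vertex has three orbits: the vertex, its neighbours and its non-neighbours.
Pairs of parts thus reduce to the labels `(0, 0)`, `(0, 1)` and `(0, 2)`. -/
theorem exists_petersenIso_fix (q : PetersenVertex) :
    ∃ σ, petersenIso σ (petersenLabel 0) = petersenLabel 0 ∧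
      (petersenIso σ (petersenLabel 0) = q ∨ petersenIso σ (petersenLabel 1) = q ∨
        petersenIso σ (petersenLabel 2) = q) := by
  revert q
  decide +kernel

theorem exists_petersenIso (p q : PetersenVertex) : ∃ e : petersen ≃g petersen,
    e (petersenLabel 0) = p ∧ (e (petersenLabel 0) = q ∨ e (petersenLabel 1) = q ∨
      e (petersenLabel 2) = q) := by
  obtain ⟨σ, rfl⟩ := exists_petersenIso_zero p
  obtain ⟨τ, h0, h⟩ := exists_petersenIso_fix ((petersenIso σ).symm q)
  refine ⟨(petersenIso τ).trans (petersenIso σ), congrArg (petersenIso σ) h0, ?_⟩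
  simpa only [RelIso.eq_symm_apply, RelIso.trans_apply] using h

/-- The colours of the vertices of a Petersen graph, followed by `l`. -/
def petersenCols (l : List (Col PetersenVertex)) : List (Col PetersenVertex) :=
  .mem (petersenLabel 0) :: .mem (petersenLabel 1) :: .mem (petersenLabel 2) ::
    .mem (petersenLabel 3) :: .mem (petersenLabel 4) :: .mem (petersenLabel 5) ::
    .mem (petersenLabel 6) :: .mem (petersenLabel 7) :: .mem (petersenLabel 8) ::
    .mem (petersenLabel 9) :: l

section

variable {V : Type*} {G : SimpleGraph V} (hG : ExcludedFree G) {f : PetersenVertex → V}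
  (hf : ∀ p q, G.Adj (f p) (f q) ↔ petersen.Adj p q) {x y : V}
  (hx : x ∈ twins G petersen f (petersenLabel 0))

include hG hf hx

theorem petersen_twins_zero_zero (hy : y ∈ twins G petersen f (petersenLabel 0)) :
    x = y ∨ G.Adj x y := by
  by_contra! h
  exact refute hG ((BlowupSystem.of_embedding hf).sound_nearAll (Z := fun _ => ∅))
    ⟨petersenCols [], [(10, 1, true), (10, 5, true), (11, 1, true), (11, 5, true),
      (10, 11, false)], [(10, 11)], []⟩ (f (petersenLabel 0))
    [f (petersenLabel 1), f (petersenLabel 2), f (petersenLabel 3), f (petersenLabel 4),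
      f (petersenLabel 5), f (petersenLabel 6), f (petersenLabel 7), f (petersenLabel 8),
      f (petersenLabel 9), x, y]
    (.c4 [1, 10, 5, 11]) (by decide +kernel)
    ⟨rfl, rfl, rfl, rfl, rfl, rfl, rfl, rfl, rfl, rfl, trivial⟩
    ⟨adj_of_mem_twins hx (by decide), adj_of_mem_twins hx (by decide),
      adj_of_mem_twins hy (by decide), adj_of_mem_twins hy (by decide), h.2, trivial⟩
    ⟨h.1, trivial⟩ trivial

/-- Write `f i` for the vertex with label `i`. If `x` and `y` were nonadjacent, `f 7, y, f 2, f 3, f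
6, x, f 5` would induce `P_7`. -/
theorem petersen_twins_zero_one (hy : y ∈ twins G petersen f (petersenLabel 1)) : G.Adj x y := by
  by_contra h
  exact refute hG ((BlowupSystem.of_embedding hf).sound_nearAll (Z := fun _ => ∅))
    ⟨petersenCols [], [(10, 2, false), (10, 3, false), (10, 5, true), (10, 6, true),
      (10, 7, false), (11, 2, true), (11, 3, false), (11, 5, false), (11, 6, false),
      (11, 7, true), (10, 11, false)], [], []⟩ (f (petersenLabel 0))
    [f (petersenLabel 1), f (petersenLabel 2), f (petersenLabel 3), f (petersenLabel 4),
      f (petersenLabel 5), f (petersenLabel 6), f (petersenLabel 7), f (petersenLabel 8),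
      f (petersenLabel 9), x, y]
    (.p7 [7, 11, 2, 3, 6, 10, 5]) (by decide +kernel)
    ⟨rfl, rfl, rfl, rfl, rfl, rfl, rfl, rfl, rfl, rfl, trivial⟩
    ⟨not_adj_of_mem_twins hx (by decide) (by decide),
      not_adj_of_mem_twins hx (by decide) (by decide), adj_of_mem_twins hx (by decide),
      adj_of_mem_twins hx (by decide), not_adj_of_mem_twins hx (by decide) (by decide),
      adj_of_mem_twins hy (by decide), not_adj_of_mem_twins hy (by decide) (by decide),
      not_adj_of_mem_twins hy (by decide) (by decide),
      not_adj_of_mem_twins hy (by decide) (by decide), adj_of_mem_twins hy (by decide),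
      h, trivial⟩ trivial trivial

/-- With labels as indices, an edge `xy` would give the `C_4` on `f 3, f 6, x, y`. -/
theorem petersen_twins_zero_two (hy : y ∈ twins G petersen f (petersenLabel 2)) :
    ¬ G.Adj x y := by
  intro h
  exact refute hG ((BlowupSystem.of_embedding hf).sound_nearAll (Z := fun _ => ∅))
    ⟨petersenCols [], [(10, 3, false), (10, 6, true), (10, 1, true), (11, 3, true),
      (11, 6, false), (10, 11, true), (11, 0, false), (10, 8, false), (11, 8, true)], [], []⟩
    (f (petersenLabel 0))
    [f (petersenLabel 1), f (petersenLabel 2), f (petersenLabel 3), f (petersenLabel 4),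
      f (petersenLabel 5), f (petersenLabel 6), f (petersenLabel 7), f (petersenLabel 8),
      f (petersenLabel 9), x, y]
    (.c4 [3, 6, 10, 11]) (by decide +kernel)
    ⟨rfl, rfl, rfl, rfl, rfl, rfl, rfl, rfl, rfl, rfl, trivial⟩
    ⟨not_adj_of_mem_twins hx (by decide) (by decide), adj_of_mem_twins hx (by decide),
      adj_of_mem_twins hx (by decide), adj_of_mem_twins hy (by decide),
      not_adj_of_mem_twins hy (by decide) (by decide), h,
      not_adj_of_mem_twins hy (by decide) (by decide),
      not_adj_of_mem_twins hx (by decide) (by decide), adj_of_mem_twins hy (by decide),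
      trivial⟩ trivial trivial

end

/-- The vertices that are twins of the vertices of a Petersen graph form a blowup of it. -/
theorem blowupSystem_twins_petersen {V : Type*} {G : SimpleGraph V} (hG : ExcludedFree G)
    {f : PetersenVertex → V} (hf : ∀ p q, G.Adj (f p) (f q) ↔ petersen.Adj p q) :
    BlowupSystem G petersen (twins G petersen f) where
  nonempty p := ⟨f p, mem_twins_self hf p⟩
  clique p x hx y hy := by
    obtain ⟨e, rfl, -⟩ := exists_petersenIso p p
    rw [← twins_comp] at hx hy
    exact petersen_twins_zero_zero hG (fun p q => (hf _ _).trans e.map_adj_iff) hx hy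
  adj_iff p q hpq x hx y hy := by
    obtain ⟨e, rfl, h⟩ := exists_petersenIso p q
    have hf' : ∀ p q, G.Adj (f (e p)) (f (e q)) ↔ petersen.Adj p q :=
      fun p q => (hf _ _).trans e.map_adj_iff
    rcases h with rfl | rfl | rfl
    · exact absurd rfl hpq
    all_goals rw [← twins_comp] at hx hy; rw [e.map_adj_iff]
    · exact iff_of_true (petersen_twins_zero_one hG hf' hx hy) (by decide)
    · exact iff_of_false (petersen_twins_zero_two hG hf' hx hy) (by decide)

/-- The label `1` is the common neighbour of `0` and `2`. A vertex that sees the twins of both is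
forced to have its adjacencies, against `hd`. -/
theorem petersen_attach_zero_two {V : Type*} {G : SimpleGraph V} (hG : ExcludedFree G)
    {f : PetersenVertex → V} (hf : ∀ p q, G.Adj (f p) (f q) ↔ petersen.Adj p q) {d x y : V}
    (hd : d ∉ twins G petersen f (petersenLabel 1))
    (hx : x ∈ twins G petersen f (petersenLabel 0))
    (hy : y ∈ twins G petersen f (petersenLabel 2)) : ¬ (G.Adj d x ∧ G.Adj d y) := by
  intro h
  refine refute hG ((blowupSystem_twins_petersen hG hf).sound_nearAll (Z := fun _ => ∅))
    ⟨petersenCols [.mem (petersenLabel 0), .mem (petersenLabel 2)],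
      [(12, 10, true), (12, 11, true)], [],
      [[(12, 0, true), (12, 2, true), (12, 3, false), (12, 4, false), (12, 5, false),
        (12, 6, false), (12, 7, true), (12, 8, false), (12, 9, false)]]⟩ (f (petersenLabel 0))
    [f (petersenLabel 1), f (petersenLabel 2), f (petersenLabel 3), f (petersenLabel 4),
      f (petersenLabel 5), f (petersenLabel 6), f (petersenLabel 7), f (petersenLabel 8),
      f (petersenLabel 9), x, y, d]
    (.br 3 12 (.br 1 12 (.gem [10, 1, 11, 3, 12]) (.c4 [1, 10, 12, 11])) (.br 4 12
      (.c4 [4, 12, 11, 3]) (.br 6 12 (.c4 [6, 12, 11, 3]) (.br 9 12 (.c4 [9, 12, 10, 6])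
      (.br 7 12 (.br 5 12 (.c4 [5, 12, 7, 4]) (.br 0 12 (.br 8 12 (.c4 [8, 12, 0, 5]) (.br 2 12
      (.ng 0) (.p7 [3, 2, 8, 5, 0, 12, 7]))) (.p7 [5, 0, 6, 3, 11, 12, 7])))
      (.p7 [4, 7, 9, 6, 10, 12, 11]))))))
    (by decide +kernel)
    ⟨mem_twins_self hf _, mem_twins_self hf _, mem_twins_self hf _, mem_twins_self hf _,
      mem_twins_self hf _, mem_twins_self hf _, mem_twins_self hf _, mem_twins_self hf _,
      mem_twins_self hf _, mem_twins_self hf _, hx, hy, trivial⟩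
    ⟨h.1, h.2, trivial⟩ trivial ⟨?_, trivial⟩
  rintro ⟨h0, h2, h3, h4, h5, h6, h7, h8, h9, -⟩
  refine hd fun q hq => ?_
  obtain ⟨i, rfl⟩ := petersenLabel_bijective.2 q
  fin_cases i
  · exact iff_of_true h0 (by decide)
  · exact absurd rfl hq
  · exact iff_of_true h2 (by decide)
  · exact iff_of_false h3 (by decide)
  · exact iff_of_false h4 (by decide)
  · exact iff_of_false h5 (by decide)
  · exact iff_of_false h6 (by decide)
  · exact iff_of_true h7 (by decide)
  · exact iff_of_false h8 (by decide)
  · exact iff_of_false h9 (by decide)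

theorem isDetached_twins_petersen {V : Type*} {G : SimpleGraph V} (hG : ExcludedFree G)
    {f : PetersenVertex → V} (hf : ∀ p q, G.Adj (f p) (f q) ↔ petersen.Adj p q) {d : V}
    (hd : ∀ p, d ∉ twins G petersen f p) : IsDetached G petersen (twins G petersen f) d := by
  intro p q hpq hadj a ha b hb
  obtain ⟨e, rfl, h⟩ := exists_petersenIso p q
  rcases h with rfl | rfl | rfl
  · exact absurd rfl hpq
  · exact absurd (e.map_adj_iff.2 (by decide)) hadj
  · have hd1 := hd (e (petersenLabel 1))
    rw [← twins_comp] at ha hb hd1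
    exact petersen_attach_zero_two hG (fun p q => (hf _ _).trans e.map_adj_iff) hd1 ha hb

/-- Refutations for paths between nonadjacent parts of a Petersen graph. -/
def certPetersen : ℕ → Cert
  | 2 =>
    .det 9 8 10
  | 3 =>
    .br 1 9 (.det 9 1 8) (.br 2 9 (.det 9 2 8) (.br 2 10 (.det 10 2 11) (.br 5 9 (.det 9 5 8) (.br
    5 10 (.det 10 5 11) (.br 1 10 (.br 0 10 (.det 10 0 1) (.br 0 9 (.c4 [0, 9, 10, 11]) (.c7 [0,
    8, 9, 10, 1, 2, 5]))) (.p7 [5, 2, 1, 11, 10, 9, 8]))))))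
  | 4 =>
    .br 1 9 (.det 9 1 8) (.br 2 9 (.det 9 2 8) (.br 2 11 (.det 11 2 12) (.br 3 11 (.det 11 3 12)
    (.br 5 9 (.det 9 5 8) (.br 5 11 (.det 11 5 12) (.br 0 10 (.br 0 9 (.br 0 11 (.gem [11, 10, 9,
    8, 0]) (.c4 [0, 10, 11, 12])) (.c4 [0, 8, 9, 10])) (.br 1 11 (.br 0 11 (.det 11 0 1) (.br 0 9
    (.br 3 9 (.det 9 0 3) (.br 3 10 (.c4 [3, 10, 9, 8]) (.br 2 10 (.c7 [2, 10, 11, 12, 0, 8, 3])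
    (.p7 [2, 3, 8, 9, 10, 11, 12])))) (.p7 [9, 8, 0, 5, 2, 1, 11]))) (.br 1 10 (.c4 [1, 10, 11,
    12]) (.br 2 10 (.br 0 9 (.br 3 9 (.det 9 0 3) (.p7 [9, 8, 3, 2, 1, 12, 11])) (.c7 [0, 8, 9,
    10, 2, 1, 12])) (.p7 [2, 1, 12, 11, 10, 9, 8]))))))))))
  | 5 =>
    .br 1 9 (.det 9 1 8) (.br 2 9 (.det 9 2 8) (.br 2 12 (.det 12 2 13) (.br 3 12 (.det 12 3 13)
    (.br 5 9 (.det 9 5 8) (.br 5 12 (.det 12 5 13) (.br 1 12 (.br 0 12 (.det 12 0 1) (.br 0 9 (.br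
    0 11 (.c4 [0, 11, 12, 13]) (.br 3 9 (.det 9 0 3) (.br 3 10 (.c4 [3, 10, 9, 8]) (.br 3 11 (.br
    1 11 (.det 11 1 3) (.br 1 10 (.c4 [1, 10, 11, 12]) (.br 0 10 (.br 2 10 (.det 10 0 2) (.p7 [12,
    1, 2, 3, 8, 0, 10])) (.p7 [1, 13, 0, 9, 10, 11, 3])))) (.p7 [3, 8, 9, 10, 11, 12, 13])))))
    (.p7 [9, 8, 0, 5, 2, 1, 12]))) (.br 1 11 (.c4 [1, 11, 12, 13]) (.br 1 10 (.br 0 10 (.det 10 0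
    1) (.br 3 9 (.br 0 9 (.det 9 0 3) (.br 0 12 (.br 2 10 (.br 3 10 (.det 10 1 3) (.c4 [3, 2, 10,
    9])) (.p7 [2, 1, 10, 9, 8, 0, 12])) (.p7 [12, 13, 0, 5, 2, 3, 9]))) (.p7 [9, 8, 3, 2, 1, 13,
    12]))) (.p7 [1, 13, 12, 11, 10, 9, 8])))))))))
  | _ => .ng 0

theorem no_path_petersen_zero_two {V : Type*} {G : SimpleGraph V} (hG : ExcludedFree G)
    {B : PetersenVertex → Set V} (hB : BlowupSystem G petersen B) {p : ℕ → V} {n : ℕ}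
    (hp : IsChordlessPath G p n) (hn : 2 ≤ n)
    (hi : ∀ i, 0 < i → i < n → IsDetached G petersen B (p i)) (h₀ : p 0 ∈ B (petersenLabel 0))
    (h₁ : p n ∈ B (petersenLabel 2)) : False := by
  choose f hf using hB.nonempty
  exact refute_path hG (hB.sound_nearAll (Z := fun _ => ∅))
    (cols := [.mem (petersenLabel 1), .mem (petersenLabel 3), .mem (petersenLabel 4),
      .mem (petersenLabel 5), .mem (petersenLabel 6), .mem (petersenLabel 7),
      .mem (petersenLabel 8), .mem (petersenLabel 9)])
    (lits := []) (c₀ := .mem (petersenLabel 0)) (ci := .det) (c₁ := .mem (petersenLabel 2))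
    (xs := []) (ys := []) (m := 2) certPetersen (by decide +kernel) (by decide) hp hn (by omega)
    [f (petersenLabel 1), f (petersenLabel 3), f (petersenLabel 4), f (petersenLabel 5),
      f (petersenLabel 6), f (petersenLabel 7), f (petersenLabel 8), f (petersenLabel 9)] rfl
    ⟨hf _, hf _, hf _, hf _, hf _, hf _, hf _, hf _, trivial⟩ trivial h₀ hi h₁ trivial trivial

/-- Without clique cutset, a graph with an induced Petersen graph is a blowup of it. -/
theorem isBlowup_of_hasPetersen {V : Type*} [Finite V] {G : SimpleGraph V} (hconn : G.Connected)
    (hcut : ∀ K, ¬ IsCliqueCutset G K) (hG : ExcludedFree G) (hP : HasPetersen G) :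
    IsBlowup G petersen := by
  obtain ⟨f, hf⟩ := hP
  have hB := blowupSystem_twins_petersen hG hf
  have hdet : ∀ d, (∀ p, d ∉ twins G petersen f p) →
      IsDetached G petersen (twins G petersen f) d := fun d => isDetached_twins_petersen hG hf
  have hfB : ∀ p, f p ∈ ⋃ q, twins G petersen f q :=
    fun p => Set.mem_iUnion.2 ⟨p, mem_twins_self hf p⟩
  generalize twins G petersen f = B at hB hdet hfB
  have hcov : ∀ d, d ∈ ⋃ p, B p := by
    by_contra! h
    obtain ⟨d, hd⟩ := h
    have hBc : ¬ G.IsClique (⋃ p, B p) := fun hc => by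
      have h02 : ¬ petersen.Adj (petersenLabel 0) (petersenLabel 2) := by decide
      have h16 : petersen.Adj (petersenLabel 0) (petersenLabel 6) := by decide
      have h26 : ¬ petersen.Adj (petersenLabel 2) (petersenLabel 6) := by decide
      have hne : f (petersenLabel 0) ≠ f (petersenLabel 2) := fun h =>
        h26 ((hf _ _).1 (h ▸ (hf _ _).2 h16))
      exact h02 ((hf _ _).1 (hc (hfB _) (hfB _) hne))
    obtain ⟨p, n, hp, hn, h₀, h₁, hi⟩ := exists_chordlessPath_through hconn hcut hBc hd
    have hna : ¬ G.Adj (p 0) (p n) := by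
      rw [hp.adj_iff 0 n (by omega) le_rfl]
      omega
    obtain ⟨a, h₀⟩ := Set.mem_iUnion.1 h₀
    obtain ⟨b, h₁⟩ := Set.mem_iUnion.1 h₁
    obtain ⟨e, rfl, h⟩ := exists_petersenIso a b
    have hi' : ∀ i, 0 < i → i < n → IsDetached G petersen (fun q => B (e q)) (p i) := by
      intro i h1 h2 r s hrs hadj a ha b hb
      refine hdet (p i) (fun q hq => ?_) (e r) (e s) (e.injective.ne hrs)
        (fun h => hadj (e.map_adj_iff.1 h)) a ha b hb
      exact notMem_of_mem_reachAvoiding hd (hi i h1 h2) (Set.mem_iUnion.2 ⟨q, hq⟩)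
    -- The ends are distinct and nonadjacent, which excludes equal and adjacent parts.
    rcases h with rfl | rfl | rfl
    · rcases hB.clique _ _ h₀ _ h₁ with h | h
      exacts [hp.ends_ne h, hna h]
    · exact hna ((hB.adj_iff _ _ (e.injective.ne (by decide)) _ h₀ _ h₁).2
        (e.map_adj_iff.2 (by decide)))
    · exact no_path_petersen_zero_two hG (hB.comp e) hp hn hi' h₀ h₁
  -- For distinct vertices of the Petersen graph a third one sees the first only. A common member of
  -- both parts would have to see and to miss the corresponding part.
  have hirr : ∀ p q, p ≠ q → ∀ x ∈ B p, x ∉ B q := by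
    intro p q hpq x hxp hxq
    have key : ∀ p q : PetersenVertex, p ≠ q →
        ∃ r, r ≠ p ∧ r ≠ q ∧ petersen.Adj p r ∧ ¬ petersen.Adj q r := by decide +kernel
    obtain ⟨r, h1, h2, h3, h4⟩ := key p q hpq
    obtain ⟨y, hy⟩ := hB.nonempty r
    exact h4 ((hB.adj_iff q r h2.symm x hxq y hy).1 ((hB.adj_iff p r h1.symm x hxp y hy).2 h3))
  exact ⟨B, Set.eq_univ_of_forall hcov,
    fun p q hpq => Set.disjoint_left.2 fun x hx hx' => hirr p q hpq x hx hx',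
    fun p x hx y hy hxy => (hB.clique p x hx y hy).resolve_left hxy,
    fun p q hpq x hx y hy => (hB.adj_iff p q hpq.ne x hx y hy).2 hpq,
    fun p q hpq hadj x hx y hy h => hadj ((hB.adj_iff p q hpq x hx y hy).1 h)⟩

/-! ### From `F_3` to a frame with connectors of all kinds -/

/-- The neighbours of `x` on the hexagon are `f i` and its antipode. -/
def IsOpp {V : Type*} (G : SimpleGraph V) (f : Fin 6 → V) (i : Fin 6) (x : V) : Prop :=
  ∀ j, G.Adj x (f j) ↔ j = i ∨ j = i + 3

/-- The neighbours of `x` on the hexagon are `f i` and the vertices adjacent to it. -/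
def IsNear {V : Type*} (G : SimpleGraph V) (f : Fin 6 → V) (i : Fin 6) (x : V) : Prop :=
  ∀ j, G.Adj x (f j) ↔ j = i ∨ hexagon.Adj i j

/-- `x` has no neighbours on the hexagon. -/
def IsAnti {V : Type*} (G : SimpleGraph V) (f : Fin 6 → V) (x : V) : Prop :=
  ∀ j, ¬ G.Adj x (f j)

theorem IsOpp.comp {V : Type*} {G : SimpleGraph V} {f : Fin 6 → V} {e : hexagon ≃g hexagon}
    (he : IsHexSymm e) {i : Fin 6} {x : V} :
    IsOpp G (fun j => f (e j)) i x ↔ IsOpp G f (e i) x := by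
  refine ⟨fun h j => ?_, fun h j => ?_⟩
  · have := h (e.symm j)
    simp only [RelIso.apply_symm_apply] at this
    rw [this, ← he, ← e.injective.eq_iff, ← e.injective.eq_iff (b := i + 3),
      RelIso.apply_symm_apply]
  · rw [h, ← he, e.injective.eq_iff, e.injective.eq_iff]

theorem IsNear.comp {V : Type*} {G : SimpleGraph V} {f : Fin 6 → V} {e : hexagon ≃g hexagon}
    {i : Fin 6} {x : V} : IsNear G (fun j => f (e j)) i x ↔ IsNear G f (e i) x := by
  refine ⟨fun h j => ?_, fun h j => ?_⟩
  · have := h (e.symm j)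
    simp only [RelIso.apply_symm_apply] at this
    rw [this, ← e.injective.eq_iff, ← e.map_adj_iff, RelIso.apply_symm_apply]
  · rw [h, e.injective.eq_iff, e.map_adj_iff]

theorem IsOpp.add_three {V : Type*} {G : SimpleGraph V} {f : Fin 6 → V} {i : Fin 6} {x : V}
    (h : IsOpp G f i x) : IsOpp G f (i + 3) x := by
  have key : ∀ i j : Fin 6, (j = i ∨ j = i + 3) ↔ (j = i + 3 ∨ j = i + 3 + 3) := by decide
  exact fun j => (h j).trans (key i j)

theorem IsAnti.mem_colSet {V : Type*} {G : SimpleGraph V} {f : Fin 6 → V} {Z : Fin 6 → Set V}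
    {x : V} (h : IsAnti G f x) : x ∈ colSet G hexagon (fun p => {f p}) Z .anti := by
  rintro p _ rfl
  exact h p

/-- Adjacencies to a hexagon, as a list. -/
def hexLits (k : ℕ) (b : Fin 6 → Bool) : List Lit :=
  [(k, 0, b 0), (k, 1, b 1), (k, 2, b 2), (k, 3, b 3), (k, 4, b 4), (k, 5, b 5)]

theorem litsHold_hexLits {V : Type*} {G : SimpleGraph V} {v : ℕ → V} {f : Fin 6 → V} {k : ℕ}
    {b : Fin 6 → Bool} (hv : ∀ i : Fin 6, v i = f i) :
    LitsHold G v (hexLits k b) ↔ ∀ i, (G.Adj (v k) (f i) ↔ b i = true) := by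
  have h0 : v 0 = f 0 := hv 0
  have h1 : v 1 = f 1 := hv 1
  have h2 : v 2 = f 2 := hv 2
  have h3 : v 3 = f 3 := hv 3
  have h4 : v 4 = f 4 := hv 4
  have h5 : v 5 = f 5 := hv 5
  rw [litsHold_iff]
  simp only [hexLits, List.forall_mem_cons, Lit.Holds, h0, h1, h2, h3, h4, h5, Fin.forall_fin_succ]
  simp

/-- The literals of the vertices with the adjacencies of `IsOpp`. -/
def oppLits (k : ℕ) (i : Fin 6) : List Lit := hexLits k fun j => decide (j = i ∨ j = i + 3)

/-- The literals of the vertices with the adjacencies of `IsNear`. -/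
def nearLits (k : ℕ) (i : Fin 6) : List Lit := hexLits k fun j => decide (j = i ∨ hexagon.Adj i j)

section

variable {V : Type*} {G : SimpleGraph V} {v : ℕ → V} {f : Fin 6 → V} {k : ℕ} {i : Fin 6}

theorem litsHold_oppLits (hv : ∀ i : Fin 6, v i = f i) :
    LitsHold G v (oppLits k i) ↔ IsOpp G f i (v k) := by
  simp only [oppLits, litsHold_hexLits hv, decide_eq_true_eq]
  rfl

theorem litsHold_nearLits (hv : ∀ i : Fin 6, v i = f i) :
    LitsHold G v (nearLits k i) ↔ IsNear G f i (v k) := by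
  simp only [nearLits, litsHold_hexLits hv, decide_eq_true_eq]
  rfl

theorem litsHold_append {l m : List Lit} :
    LitsHold G v (l ++ m) ↔ LitsHold G v l ∧ LitsHold G v m := by
  simp only [litsHold_iff, List.forall_mem_append]

end

/-- Neighbours of vertices away from the hexagon are of two kinds. -/
theorem isOpp_or_isNear {V : Type*} {G : SimpleGraph V} (hG : ExcludedFree G) {f : Fin 6 → V}
    (hf : ∀ p q, G.Adj (f p) (f q) ↔ hexagon.Adj p q) {u x : V} (hu : IsAnti G f u)
    (hux : G.Adj u x) {k : Fin 6} (hx : G.Adj x (f k)) :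
    ∃ i, IsOpp G f i x ∨ IsNear G f i x := by
  wlog hk : k = 0 generalizing f k
  · obtain ⟨i, h⟩ := this (f := fun j => f (hexRotate k j)) (k := 0)
      (fun p q => (hf _ _).trans (hexRotate k).map_adj_iff) (fun j => hu _)
      (by rwa [hexRotate_apply, add_zero]) rfl
    rw [IsOpp.comp (isHexSymm_rotate k), IsNear.comp] at h
    exact ⟨_, h⟩
  subst hk
  by_contra! h
  have hv : ∀ i : Fin 6, [f 0, f 1, f 2, f 3, f 4, f 5, u, x].getD i (f 0) = f i := by
    intro i
    fin_cases i <;> rfl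
  exact refute hG ((BlowupSystem.of_embedding hf).sound_nearAll (Z := fun _ => ∅))
    ⟨hexCols [.anti], [(6, 7, true), (7, 0, true)], [],
      -- As `x` sees `f 0`, these are the only admissible centres. The other patterns give a gem, a
      -- `C_4`, or a `P_7` ending in `x, u`.
      [oppLits 7 0, nearLits 7 0, nearLits 7 1, nearLits 7 5]⟩ (f 0)
    [f 1, f 2, f 3, f 4, f 5, u, x]
    (.br 1 7 (.br 3 7 (.br 2 7 (.gem [3, 2, 1, 0, 7]) (.c4 [2, 1, 7, 3])) (.br 4 7 (.br 5 7
      (.gem [4, 5, 0, 1, 7]) (.c4 [5, 0, 7, 4])) (.br 2 7 (.br 5 7 (.gem [5, 0, 1, 2, 7]) (.ng 2))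
      (.br 5 7 (.ng 1) (.p7 [5, 4, 3, 2, 1, 7, 6]))))) (.br 2 7 (.c4 [2, 7, 0, 1]) (.br 4 7
      (.br 5 7 (.br 3 7 (.gem [3, 4, 5, 0, 7]) (.ng 3)) (.c4 [5, 0, 7, 4])) (.br 3 7 (.br 5 7
      (.c4 [5, 7, 3, 4]) (.ng 0)) (.p7 [4, 3, 2, 1, 0, 7, 6])))))
    (by decide +kernel)
    ⟨rfl, rfl, rfl, rfl, rfl, rfl, hu.mem_colSet, trivial⟩ ⟨hux, hx, trivial⟩ trivial
    ⟨fun h' => (h 0).1 ((litsHold_oppLits hv).1 h'), fun h' => (h 0).2 ((litsHold_nearLits hv).1 h'),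
      fun h' => (h 1).2 ((litsHold_nearLits hv).1 h'),
      fun h' => (h 5).2 ((litsHold_nearLits hv).1 h'), trivial⟩

/-- A vertex close to a vertex of the hexagon is adjacent to all or no vertices of a component
away from the hexagon. -/
theorem IsNear.adj_of_adj {V : Type*} {G : SimpleGraph V} (hG : ExcludedFree G) {f : Fin 6 → V}
    (hf : ∀ p q, G.Adj (f p) (f q) ↔ hexagon.Adj p q) {i : Fin 6} {x u w : V}
    (hx : IsNear G f i x) (hu : IsAnti G f u) (hw : IsAnti G f w) (huw : G.Adj u w)
    (hux : G.Adj u x) : G.Adj w x := by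
  wlog hi : i = 0 generalizing f i
  · refine this (f := fun j => f (hexRotate i j)) (i := 0)
      (fun p q => (hf _ _).trans (hexRotate i).map_adj_iff) ?_ (fun j => hu _) (fun j => hw _) rfl
    rwa [IsNear.comp, hexRotate_apply, add_zero]
  subst hi
  by_contra h
  exact refute hG ((BlowupSystem.of_embedding hf).sound_nearAll (Z := fun _ => ∅))
    ⟨hexCols [.anti, .anti], [(6, 7, true), (6, 8, true), (7, 8, false), (8, 1, true),
      (8, 2, false), (8, 3, false), (8, 4, false)], [], []⟩ (f 0)
    [f 1, f 2, f 3, f 4, f 5, u, w, x]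
    -- The path `f 4, f 3, f 2, f 1, x, u, w`.
    (.p7 [4, 3, 2, 1, 8, 6, 7])
    (by decide +kernel)
    ⟨rfl, rfl, rfl, rfl, rfl, rfl, hu.mem_colSet, hw.mem_colSet, trivial⟩
    ⟨huw, hux, h, (hx 1).2 (by decide), mt (hx 2).1 (by decide), mt (hx 3).1 (by decide),
      mt (hx 4).1 (by decide), trivial⟩ trivial trivial

/-- If `u` is adjacent to `x` close to `f 0`, its other neighbours not adjacent to `x` are close
to `f 3`. -/
theorem isNear_three {V : Type*} {G : SimpleGraph V} (hG : ExcludedFree G) {f : Fin 6 → V}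
    (hf : ∀ p q, G.Adj (f p) (f q) ↔ hexagon.Adj p q) {x u y : V} (hx : IsNear G f 0 x)
    (hu : IsAnti G f u) (hux : G.Adj u x) (huy : G.Adj u y) (hxy : ¬ G.Adj x y) (hne : x ≠ y)
    {k : Fin 6} (hy : G.Adj y (f k)) : IsNear G f 3 y := by
  by_contra h
  have hv : ∀ i : Fin 6, [f 0, f 1, f 2, f 3, f 4, f 5, x, u, y].getD i (f 0) = f i := by
    intro i
    fin_cases i <;> rfl
  refine refute hG ((BlowupSystem.of_embedding hf).sound_nearAll (Z := fun _ => ∅))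
    ⟨hexCols [.free, .anti], [(6, 7, true), (7, 8, true), (6, 8, false)] ++ nearLits 6 0, [(6, 8)],
      [hexLits 8 fun _ => false, nearLits 8 3]⟩ (f 0)
    [f 1, f 2, f 3, f 4, f 5, x, u, y]
    (.br 0 8 (.c4 [0, 8, 7, 6]) (.br 1 8 (.c4 [1, 8, 7, 6]) (.br 5 8 (.c4 [5, 8, 7, 6]) (.br 2 8
      (.br 4 8 (.br 3 8 (.ng 1) (.c4 [3, 2, 8, 4])) (.p7 [4, 5, 0, 1, 2, 8, 7])) (.br 3 8
      (.p7 [7, 8, 3, 2, 1, 0, 5]) (.br 4 8 (.c7 [4, 8, 7, 6, 1, 2, 3]) (.ng 0)))))))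
    (by decide +kernel)
    ⟨rfl, rfl, rfl, rfl, rfl, rfl, trivial, hu.mem_colSet, trivial⟩
    (litsHold_append.2 ⟨⟨hux.symm, huy, hxy, trivial⟩, (litsHold_nearLits hv).2 hx⟩) ⟨hne, trivial⟩
    ⟨fun h' => ?_, fun h' => h ((litsHold_nearLits hv).1 h'), trivial⟩
  have := ((litsHold_hexLits hv).1 h' k).1 hy
  simp at this

/-- Vertices close to antipodal vertices of the hexagon have no common neighbour which is
adjacent to a vertex with antipodal neighbours. -/
theorem not_isNear_antipodal {V : Type*} {G : SimpleGraph V} (hG : ExcludedFree G) {f : Fin 6 → V}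
    (hf : ∀ p q, G.Adj (f p) (f q) ↔ hexagon.Adj p q) {x y r z : V} (hx : IsNear G f 0 x)
    (hy : IsNear G f 3 y) (hr : IsAnti G f r) (hrx : G.Adj r x) (hry : G.Adj r y)
    (hxy : ¬ G.Adj x y) (hrz : G.Adj r z) {j : Fin 6} (hz : IsOpp G f j z) : False := by
  -- The antipodal kinds `j` and `j + 3` coincide.
  wlog hj : j = 0 ∨ j = 1 ∨ j = 2 generalizing j
  · have key : ∀ j : Fin 6, ¬ (j = 0 ∨ j = 1 ∨ j = 2) → j + 3 = 0 ∨ j + 3 = 1 ∨ j + 3 = 2 := by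
      decide
    exact this hz.add_three (key j hj)
  have hv : ∀ i : Fin 6, [f 0, f 1, f 2, f 3, f 4, f 5, x, y, r, z].getD i (f 0) = f i := by
    intro i
    fin_cases i <;> rfl
  have key (c : Cert) (hc : Config.refutedBy (blowupPalette hexagon nearAll)
      ⟨hexCols [.free, .free, .anti], [(8, 6, true), (8, 7, true), (6, 7, false), (8, 9, true)] ++
        (nearLits 6 0 ++ (nearLits 7 3 ++ oppLits 9 j)), [], []⟩ c = true) : False :=
    refute hG ((BlowupSystem.of_embedding hf).sound_nearAll (Z := fun _ => ∅))
      _ (f 0) [f 1, f 2, f 3, f 4, f 5, x, y, r, z] c hc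
      ⟨rfl, rfl, rfl, rfl, rfl, rfl, trivial, trivial, hr.mem_colSet, trivial⟩
      (litsHold_append.2 ⟨⟨hrx, hry, hxy, hrz, trivial⟩, litsHold_append.2
        ⟨(litsHold_nearLits hv).2 hx, litsHold_append.2
          ⟨(litsHold_nearLits hv).2 hy, (litsHold_oppLits hv).2 hz⟩⟩⟩) trivial trivial
  rcases hj with rfl | rfl | rfl
  · exact key (.br 6 9 (.gem [8, 9, 0, 1, 6]) (.c4 [6, 0, 9, 8])) (by decide +kernel)
  · exact key (.br 6 9 (.c4 [6, 9, 4, 5]) (.c4 [6, 1, 9, 8])) (by decide +kernel)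
  · exact key (.br 6 9 (.c4 [6, 9, 2, 1]) (.c4 [6, 5, 9, 8])) (by decide +kernel)

theorem IsOpp.mem_connectors {V : Type*} {G : SimpleGraph V} {f : Fin 6 → V}
    (hf : ∀ p q, G.Adj (f p) (f q) ↔ hexagon.Adj p q) {i : Fin 6} {x : V} (h : IsOpp G f i x) :
    x ∈ connectors G (twins G hexagon f) i := by
  refine ⟨fun q hq => ?_, ⟨f i, mem_twins_self hf i, (h i).2 (Or.inl rfl)⟩,
    f (i + 3), mem_twins_self hf _, (h _).2 (Or.inr rfl)⟩
  have key : ∀ i q : Fin 6, ∃ j, j ≠ q ∧ ((hexagon.Adj q j ∧ j ≠ i ∧ j ≠ i + 3)) := by decide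
  obtain ⟨j, hjq, hadj, h1, h2⟩ := key i q
  exact ((h j).1 ((hq j hjq).2 hadj)).elim h1 h2

/-- Two vertices with antipodal neighbours of different kinds and a common neighbour away from
the hexagon yield a hexagon with connectors of all kinds. -/
theorem exists_hexFrame_of_isOpp_zero_one {V : Type*} {G : SimpleGraph V} (hG : ExcludedFree G)
    {f : Fin 6 → V} (hf : ∀ p q, G.Adj (f p) (f q) ↔ hexagon.Adj p q) {x y u : V}
    (hx : IsOpp G f 0 x) (hy : IsOpp G f 1 y) (hu : IsAnti G f u) (hux : G.Adj u x)
    (huy : G.Adj u y) (hxy : ¬ G.Adj x y) :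
    ∃ A, HexFrame G A ∧ ∀ p, (connectors G A p).Nonempty := by
  have x0 := (hx 0).2 (by decide)
  have x1 := mt (hx 1).1 (by decide)
  have x2 := mt (hx 2).1 (by decide)
  have x3 := (hx 3).2 (by decide)
  have x4 := mt (hx 4).1 (by decide)
  have x5 := mt (hx 5).1 (by decide)
  have y0 := mt (hy 0).1 (by decide)
  have y1 := (hy 1).2 (by decide)
  have y2 := mt (hy 2).1 (by decide)
  have y3 := mt (hy 3).1 (by decide)
  have y4 := (hy 4).2 (by decide)
  have y5 := mt (hy 5).1 (by decide)
  -- Together with `x`, `y`, `u` the hexagon is a Petersen graph minus a vertex. It is read along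
  -- another hexagon, `f 0, f 1, y, f 4, f 3, x`, for which `f 5`, `f 2` and `u` are connectors of
  -- the three kinds.
  have hcols : ColsHold (colSet G hexagon (fun p => {f p}) fun _ => ∅)
      [f 0, f 1, y, f 4, f 3, x, f 5, f 2, u]
      [.mem 0, .mem 1, .free, .mem 4, .mem 3, .free, .mem 5, .mem 2, .anti] :=
    ⟨rfl, rfl, trivial, rfl, rfl, trivial, rfl, rfl, hu.mem_colSet, trivial⟩
  have hadj := Config.Holds.adj_iff (v := fun i => [f 0, f 1, y, f 4, f 3, x, f 5, f 2, u].getD i x)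
    (K := ⟨[.mem 0, .mem 1, .free, .mem 4, .mem 3, .free, .mem 5, .mem 2, .anti],
      [(5, 0, true), (5, 1, false), (5, 7, false), (5, 4, true), (5, 3, false), (5, 6, false),
        (2, 0, false), (2, 1, true), (2, 7, false), (2, 4, false), (2, 3, true), (2, 6, false),
        (8, 5, true), (8, 2, true), (5, 2, false)], [], []⟩)
    (H := petersen.comap fun i : Fin 9 => petersenLabel i.castSucc)
    ⟨fun _ _ h => hcols.mem _ _ h, litsHold_iff.1 ⟨x0, x1, x2, x3, x4, x5, y0, y1, y2, y3, y4, y5,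
      hux, huy, hxy, trivial⟩, by simp, by simp⟩
    ((BlowupSystem.of_embedding hf).sound_nearAll) (by decide +kernel)
  set g : Fin 6 → V := fun i => [f 0, f 1, y, f 4, f 3, x, f 5, f 2, u].getD i x with hg
  have hgg : ∀ p q, G.Adj (g p) (g q) ↔ hexagon.Adj p q := by
    have key : ∀ p q : Fin 6, (petersen.comap fun i : Fin 9 => petersenLabel i.castSucc).Adj
      (p.castLE (by decide)) (q.castLE (by decide)) ↔ hexagon.Adj p q := by decide +kernel
    exact fun p q => (hadj (p.castLE (by decide)) (q.castLE (by decide))).trans (key p q)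
  have hopp (k : Fin 9) (i : Fin 6) (h : ∀ q : Fin 6,
      (petersen.comap fun i : Fin 9 => petersenLabel i.castSucc).Adj k (q.castLE (by decide)) ↔
        q = i ∨ q = i + 3) :
      ([f 0, f 1, y, f 4, f 3, x, f 5, f 2, u].getD k x) ∈ connectors G (twins G hexagon g) i :=
    IsOpp.mem_connectors hgg fun q => (hadj k (q.castLE (by decide))).trans (h q)
  refine ⟨_, hexFrame_twins hG hgg, ?_⟩
  have h0 : (connectors G (twins G hexagon g) 0).Nonempty := ⟨_, hopp 6 0 (by decide +kernel)⟩
  have h1 : (connectors G (twins G hexagon g) 1).Nonempty := ⟨_, hopp 7 1 (by decide +kernel)⟩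
  have h2 : (connectors G (twins G hexagon g) 2).Nonempty := ⟨_, hopp 8 2 (by decide +kernel)⟩
  intro p
  fin_cases p
  exacts [h0, h1, h2, connectors_add_three (G := G) 0 ▸ h0, connectors_add_three (G := G) 1 ▸ h1,
    connectors_add_three (G := G) 2 ▸ h2]

/-- The path between two vertices with antipodal neighbours has a single inner vertex, and they
have different kinds. -/
theorem exists_hexFrame_of_isOpp {V : Type*} {G : SimpleGraph V} (hG : ExcludedFree G)
    {f : Fin 6 → V} (hf : ∀ p q, G.Adj (f p) (f q) ↔ hexagon.Adj p q) {p : ℕ → V} {n : ℕ}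
    (hp : IsChordlessPath G p n) (hn : 2 ≤ n) (hi : ∀ i, 0 < i → i < n → IsAnti G f (p i))
    {a b : Fin 6} (ha : IsOpp G f a (p 0)) (hb : IsOpp G f b (p n)) :
    ∃ A, HexFrame G A ∧ ∀ p, (connectors G A p).Nonempty := by
  -- Kinds agree modulo `3`, so a rotation and possibly a reversal of the path bring them to `(0,
  -- 0)` or `(0, 1)`.
  wlog hab : (a = 0 ∧ b = 0) ∨ (a = 0 ∧ b = 1) generalizing f p a b
  · have key : ∀ a b : Fin 6, (b = a + 0 ∨ b + 3 = a + 0) ∨ (b = a + 1 ∨ b + 3 = a + 1) ∨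
      (a = b + 1 ∨ a = b + 3 + 1) := by decide
    have hf' : ∀ (e : hexagon ≃g hexagon) p q, G.Adj (f (e p)) (f (e q)) ↔ hexagon.Adj p q :=
      fun e p q => (hf _ _).trans e.map_adj_iff
    have ht : ∀ {c d : Fin 6} {x : V}, IsOpp G f (c + d) x →
        IsOpp G (fun j => f (hexRotate c j)) d x := fun h =>
      (IsOpp.comp (isHexSymm_rotate _)).2 h
    have hb3 := hb.add_three
    rcases key a b with h | h | h
    · refine this (hf' (hexRotate a)) hp (fun i h1 h2 j => hi i h1 h2 _) (a := 0) (b := 0)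
        (ht (by rwa [add_zero])) (ht ?_) (Or.inl ⟨rfl, rfl⟩)
      rcases h with h | h
      exacts [h ▸ hb, h ▸ hb3]
    · refine this (hf' (hexRotate a)) hp (fun i h1 h2 j => hi i h1 h2 _) (a := 0) (b := 1)
        (ht (by rwa [add_zero])) (ht ?_) (Or.inr ⟨rfl, rfl⟩)
      rcases h with h | h
      exacts [h ▸ hb, h ▸ hb3]
    · rcases h with h | h
      · refine this (hf' (hexRotate b)) hp.reverse
          (fun i h1 h2 j => hi (n - i) (by omega) (by omega) _) (a := 0) (b := 1)
          (ht (by rwa [add_zero])) (ht ?_) (Or.inr ⟨rfl, rfl⟩)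
        rw [Nat.sub_self]
        exact h ▸ ha
      · refine this (hf' (hexRotate (b + 3))) hp.reverse
          (fun i h1 h2 j => hi (n - i) (by omega) (by omega) _) (a := 0) (b := 1)
          (ht (by rwa [add_zero])) (ht ?_) (Or.inr ⟨rfl, rfl⟩)
        rw [Nat.sub_self]
        exact h ▸ ha
  have hx : AdjsHold G [f 0, f 1, f 2, f 3, f 4, f 5] (p 0)
      [(0, true), (1, false), (2, false), (3, true), (4, false), (5, false)] := by
    obtain rfl : a = 0 := by tauto
    exact ⟨(ha 0).2 (by decide), mt (ha 1).1 (by decide), mt (ha 2).1 (by decide),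
      (ha 3).2 (by decide), mt (ha 4).1 (by decide), mt (ha 5).1 (by decide), trivial⟩
  rcases hab with ⟨rfl, rfl⟩ | ⟨rfl, rfl⟩
  · exact (refute_path hG ((BlowupSystem.of_embedding hf).sound_nearAll (Z := fun _ => ∅))
      (cols := hexCols []) (lits := []) (c₀ := .free) (ci := .anti) (c₁ := .free)
      (xs := [(0, true), (1, false), (2, false), (3, true), (4, false), (5, false)])
      (ys := [(0, true), (1, false), (2, false), (3, true), (4, false), (5, false)]) (m := 2)
      (fun
        | 2 => .c4 [0, 6, 7, 8]
        | 3 => .c4 [0, 6, 3, 9]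
        | 4 => .p7 [2, 1, 0, 6, 7, 8, 9]
        | _ => .p7 [1, 0, 6, 7, 8, 9, 10])
      (by decide +kernel) (by decide) hp hn (by omega) [f 0, f 1, f 2, f 3, f 4, f 5] rfl
      ⟨rfl, rfl, rfl, rfl, rfl, rfl, trivial⟩ trivial trivial
      (fun i h1 h2 => (hi i h1 h2).mem_colSet) trivial hx
      ⟨(hb 0).2 (by decide), mt (hb 1).1 (by decide), mt (hb 2).1 (by decide),
        (hb 3).2 (by decide), mt (hb 4).1 (by decide), mt (hb 5).1 (by decide), trivial⟩).elim
  · rcases hn.lt_or_eq with hn | rfl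
    · exact (refute_path hG ((BlowupSystem.of_embedding hf).sound_nearAll (Z := fun _ => ∅))
        (cols := hexCols []) (lits := []) (c₀ := .free) (ci := .anti) (c₁ := .free)
        (xs := [(0, true), (1, false), (2, false), (3, true), (4, false), (5, false)])
        (ys := [(0, false), (1, true), (2, false), (3, false), (4, true), (5, false)]) (m := 3)
        (fun
          | 3 => .c7 [0, 5, 4, 9, 8, 7, 6]
          | 4 => .c7 [0, 1, 10, 9, 8, 7, 6]
          | _ => .p7 [0, 1, 11, 10, 9, 8, 7])
        (by decide +kernel) (by decide) hp hn (by omega) [f 0, f 1, f 2, f 3, f 4, f 5] rfl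
        ⟨rfl, rfl, rfl, rfl, rfl, rfl, trivial⟩ trivial trivial
        (fun i h1 h2 => (hi i h1 h2).mem_colSet) trivial hx
        ⟨mt (hb 0).1 (by decide), (hb 1).2 (by decide), mt (hb 2).1 (by decide),
          mt (hb 3).1 (by decide), (hb 4).2 (by decide), mt (hb 5).1 (by decide), trivial⟩).elim
    · refine exists_hexFrame_of_isOpp_zero_one hG hf ha hb (hi 1 one_pos one_lt_two) ?_ ?_ ?_
      · exact ((hp.adj_iff 0 1 one_pos one_le_two).2 rfl).symm
      · exact (hp.adj_iff 1 2 one_lt_two le_rfl).2 rfl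
      · rw [hp.adj_iff 0 2 two_pos le_rfl]
        decide

/-- An end of a path through a component away from the hexagon is not close to a vertex of the
hexagon if the component has a neighbour with antipodal neighbours. -/
theorem not_isNear_of_path {V : Type*} {G : SimpleGraph V} (hG : ExcludedFree G) {f : Fin 6 → V}
    (hf : ∀ p q, G.Adj (f p) (f q) ↔ hexagon.Adj p q) {B : Set V} {r z : V}
    (hQ : ∀ u ∈ reachAvoiding G B r, IsAnti G f u) (hrz : G.Adj r z) {j : Fin 6}
    (hz : IsOpp G f j z) {p : ℕ → V} {n : ℕ} (hp : IsChordlessPath G p n) (hn : 2 ≤ n)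
    (hi : ∀ i, 0 < i → i < n → p i ∈ reachAvoiding G B r) {k : Fin 6} (hk : G.Adj (p n) (f k))
    {i : Fin 6} : ¬ IsNear G f i (p 0) := by
  intro hx
  have h01 := (hp.adj_iff 0 1 one_pos (by omega)).2 rfl
  have hclosed : ∀ {x : V} {i : Fin 6}, IsNear G f i x → G.Adj (p 1) x →
      ∀ w ∈ reachAvoiding G B r, G.Adj w x := fun hx h1 =>
    forall_reachAvoiding (fun u hu w hw huw hux =>
      hx.adj_of_adj hG hf (hQ u hu) (hQ w hw) huw hux) (hi 1 one_pos (by omega)) h1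
  have hall := hclosed hx h01.symm
  rcases hn.lt_or_eq with hn | rfl
  -- The end `p 0` is complete to the component, so a second inner vertex would give a chord.
  · have h2 := hall (p 2) (hi 2 two_pos hn)
    have := (hp.adj_iff 0 2 two_pos (by omega)).1 h2.symm
    omega
  · have h12 := (hp.adj_iff 1 2 one_lt_two le_rfl).2 rfl
    have h02 : ¬ G.Adj (p 0) (p 2) := by
      rw [hp.adj_iff 0 2 two_pos le_rfl]
      decide
    set e := hexRotate i with he
    have hsymm := isHexSymm_rotate i
    have hf' : ∀ p q, G.Adj (f (e p)) (f (e q)) ↔ hexagon.Adj p q :=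
      fun p q => (hf _ _).trans e.map_adj_iff
    have hx' : IsNear G (fun j => f (e j)) 0 (p 0) :=
      IsNear.comp.2 (by rwa [he, hexRotate_apply, add_zero])
    have hy := isNear_three hG hf' hx' (fun j => hQ _ (hi 1 one_pos one_lt_two) _) h01.symm h12 h02
      hp.ends_ne (k := e.symm k) (by rwa [RelIso.apply_symm_apply])
    have hr := reachAvoiding_self G B r
    -- With a single inner vertex the other end is close to the antipode. Both ends are then
    -- complete to the component, in particular adjacent to `r`, whose neighbour `z` gives the
    -- contradiction.
    exact not_isNear_antipodal hG hf' hx' hy (fun j => hQ r hr _) (hall r hr)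
      (hclosed (IsNear.comp.1 hy) h12 r hr) h02 hrz
      (j := e.symm j) ((IsOpp.comp hsymm).2 (by rwa [RelIso.apply_symm_apply]))

theorem F3_adj (i j : Fin 8) : F3.Adj i j ↔ i ≠ j ∧
    ((min i j, max i j) ∈ [((0 : Fin 8), (1 : Fin 8)), (1, 2), (2, 3), (3, 4), (4, 5), (0, 5),
      (0, 6), (3, 6), (6, 7)]) := by
  simp only [F3, fromEdgeSet_adj, Set.mem_insert_iff, Set.mem_singleton_iff, Sym2.eq_iff]
  revert i j
  decide

/-- Without clique cutset, an induced `F₃` yields a hexagon with connectors of all kinds. -/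
theorem exists_hexFrame {V : Type*} [Finite V] {G : SimpleGraph V} (hconn : G.Connected)
    (hcut : ∀ K, ¬ IsCliqueCutset G K) (hG : ExcludedFree G) (hF : F3.IsIndContained G) :
    ∃ A, HexFrame G A ∧ ∀ p, (connectors G A p).Nonempty := by
  obtain ⟨φ⟩ := hF
  have hφ : ∀ i j, G.Adj (φ i) (φ j) ↔ F3.Adj i j := fun i j => φ.map_adj_iff
  set f : Fin 6 → V := fun i => φ (i.castLE (by decide)) with hfdef
  have hf : ∀ p q, G.Adj (f p) (f q) ↔ hexagon.Adj p q := by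
    intro p q
    rw [hfdef, hφ, F3_adj]
    revert p q
    decide +kernel
  have hz : IsOpp G f 0 (φ 6) := by
    intro j
    rw [hfdef, hφ, F3_adj]
    revert j
    decide +kernel
  have hr : IsAnti G f (φ 7) := by
    intro j
    rw [hfdef, hφ, F3_adj]
    revert j
    decide +kernel
  have hrz : G.Adj (φ 7) (φ 6) := by
    rw [hφ, F3_adj]
    decide
  -- `B` is the closed neighbourhood of the hexagon of `F_3`; the pendant vertex `φ 7` lies outside
  -- it. Inner vertices of the path thus miss the hexagon, and its ends, which have neighbours off
  -- `B`, are not on the hexagon but see it.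
  set B : Set V := {x | ∃ i, x = f i ∨ G.Adj x (f i)} with hB
  have hBf : ∀ x ∉ B, IsAnti G f x := fun x hx j h => hx ⟨j, Or.inr h⟩
  have hrB : φ 7 ∉ B := by
    rintro ⟨i, h | h⟩
    · have key : ∀ i : Fin 6, (7 : Fin 8) ≠ i.castLE (by decide) := by decide
      exact key i (φ.injective h)
    · exact hr i h
  have hBc : ¬ G.IsClique B := by
    intro h
    have hne : f 0 ≠ f 2 := by
      intro h
      have := φ.injective h
      revert this
      decide
    exact absurd ((hf 0 2).1 (h ⟨0, Or.inl rfl⟩ ⟨2, Or.inl rfl⟩ hne)) (by decide)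
  obtain ⟨p, n, hp, hn, h₀, h₁, hi⟩ := exists_chordlessPath_through hconn hcut hBc hrB
  have hQ : ∀ u ∈ reachAvoiding G B (φ 7), IsAnti G f u := fun u hu =>
    hBf u (notMem_of_mem_reachAvoiding hrB hu)
  have hend : ∀ {x u : V}, x ∈ B → IsAnti G f u → G.Adj u x → ∃ k, G.Adj x (f k) := by
    rintro x u ⟨k, rfl | h⟩ hu hux
    · exact absurd hux (hu k)
    · exact ⟨k, h⟩
  have h01 := ((hp.adj_iff 0 1 one_pos (by omega)).2 rfl).symm
  have hn1 := (hp.adj_iff (n - 1) n (by omega) le_rfl).2 (by omega)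
  have hu1 := hQ _ (hi 1 one_pos (by omega))
  have hun := hQ _ (hi (n - 1) (by omega) (by omega))
  obtain ⟨k, hk⟩ := hend h₀ hu1 h01
  obtain ⟨l, hl⟩ := hend h₁ hun hn1
  obtain ⟨a, ha⟩ := isOpp_or_isNear hG hf hu1 h01 hk
  obtain ⟨b, hb⟩ := isOpp_or_isNear hG hf hun hn1 hl
  refine exists_hexFrame_of_isOpp hG hf hp hn (fun i h1 h2 => hQ _ (hi i h1 h2))
    (ha.resolve_right (not_isNear_of_path hG hf hQ hrz hz hp hn hi hl))
    (hb.resolve_right ?_)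
  have := not_isNear_of_path hG hf hQ hrz hz hp.reverse hn
    (fun i h1 h2 => hi (n - i) (by omega) (by omega)) (k := k) (by simpa using hk) (i := b)
  simpa using this

end PetersenBlowup

theorem mainTheorem7 {V : Type*} [Finite V] (G : SimpleGraph V) (hconn : G.Connected)
    (hP7 : PetersenBlowup.InducedFree (SimpleGraph.pathGraph 7) G)
    (hC7 : PetersenBlowup.InducedFree (SimpleGraph.cycleGraph 7) G)
    (hC4 : PetersenBlowup.InducedFree (SimpleGraph.cycleGraph 4) G)
    (hgem : PetersenBlowup.InducedFree PetersenBlowup.gem G)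
    (hF3 : PetersenBlowup.F3.IsIndContained G) :
    (∃ K : Set V, PetersenBlowup.IsCliqueCutset G K) ∨
      (∃ v : V, PetersenBlowup.IsBisimplicial G v) ∨
      PetersenBlowup.IsBlowup G PetersenBlowup.petersen := by
  have hG : PetersenBlowup.ExcludedFree G := ⟨hP7, hC7, hC4, hgem⟩
  by_cases hcut : ∃ K : Set V, PetersenBlowup.IsCliqueCutset G K
  · exact Or.inl hcut
  · push Not at hcut
    by_cases hP : PetersenBlowup.HasPetersen G
    · exact Or.inr (Or.inr (PetersenBlowup.isBlowup_of_hasPetersen hconn hcut hG hP))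
    · obtain ⟨A, hA, hZ⟩ := PetersenBlowup.exists_hexFrame hconn hcut hG hF3
      obtain ⟨z, hz⟩ := hZ 0
      exact Or.inr (Or.inl ⟨z, hA.isBisimplicial hG (hA.cover hconn hcut hG hZ hP) hz⟩)
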